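/- **Conventions.** For a sequence $\mathbf m=(m_i)_{i\ge 0}$ of natural numbers let $T_{\mathbf m}$ be the rooted tree in which every vertex of level $i$ has $m_i$ children, and let $\mathrm{Aut}\,T_{\mathbf m}$ be its group of root-fixing automorphisms with the congruence topology, given by the level stabilizers $\mathrm{St}(n)$; write $T_m$ if all $m_i=m$. For $G\le \mathrm{Aut}\,T_{\mathbf m}$ put $\mathrm{St}_G(n)=\mathrm{St}(n)\cap G$; let $\mathrm{rist}_G(v)$ be the subgroup of the elements of $G$ that fix $v$ and act trivially outside the subtree rooted at $v$, and $\mathrm{Rist}_G(n)=\prod_{v \text{ of level } n}\mathrm{rist}_G(v)$. $G$ is *weakly branch* if it is transitive on every level and $\mathrm{Rist}_G(n)\neq 1$ for all $n\ge1$, and *branch* if moreover every $\mathrm{Rist}_G(n)$ has finite index in $G$. A *filtration* $\mathcal N=\{G_i\}_{i\ge0}$ of $G$ is a descending chain of open normal subgroups of $G$ with $G_0=G$ and trivial intersection; it is *nice* if for every $k\ge1$, for all but finitely many $i$, $\mathrm{Rist}_G(k)G_i/G_i$ is isomorphic to $\prod_{v\text{ of level }k}\mathrm{rist}_G(v)G_i/G_i$.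 For $H\le G$ put $$\mathrm{hdim}_G^{\mathcal N}(H)=\liminf_{i\to\infty}\frac{\log|HG_i:G_i|}{\log|G:G_i|}.$$ $\mathrm{hspec}^{\mathcal N}(G)$, respectively $\mathrm{hspec}^{\mathcal N}_{\trianglelefteq}(G)$, is the set of the values $\mathrm{hdim}^{\mathcal N}_G(H)$ over all closed, respectively all closed normal, subgroups $H$ of $G$. Let $\mathcal S=\{\mathrm{St}_G(n)\}_{n\ge 0}$. A group $G\le\mathrm{Aut}\,T_m$ is *weakly regular branch over* $L\le G$ if $G$ is self-similar (all sections $g|_v$ of elements $g\in G$ lie in $G$) and level-transitive, $L\ne1$, and $\psi(\mathrm{St}_L(1))\ge L\times\overset{m}{\cdots}\times L$, where $\psi$ maps an element of $\mathrm{St}(1)$ to the tuple of its sections at the first level. For a prime $p$, $W_p\le\mathrm{Aut}\,T_p$ is the group of the automorphisms all of whose labels are powers of $\sigma=(1\,2\,\cdots\,p)$. **Proposition.** 1. Let $G\le\mathrm{Aut}\,T_{\mathbf m}$ be closed and branch, and let $\mathcal N$ be a nice filtration of $G$. Then $\mathrm{hdim}_G^{\mathcal N}(\mathrm{Rist}_G(n))=1$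 for all $n\ge1$. 2. Let $G\le \mathrm{Aut}\,T_m$ be weakly branch, and weakly regular branch over a term $K^{(i)}$, $i\ge0$, of the derived series of a finite index subgroup $K$ of $G$. Assume that (a) $m=p$ is prime and $G\le W_p$, or (b) $G$ is finitely generated (topologically finitely generated suffices). Then $\mathrm{hdim}_G^{\mathcal S}(\mathrm{Rist}_G(n)')=1$ for all $n\ge1$, and likewise $\mathrm{hdim}_{\overline G}^{\mathcal S}(\mathrm{Rist}_{\overline G}(n)')=1$ for all $n\ge1$ for the closure $\overline G$ of $G$ in $\mathrm{Aut}\,T_m$. 3. Let $\Gamma$ be one of the following groups: the Basilica group $\langle a,b\rangle\le\mathrm{Aut}\,T_2$ with $\psi(a)=(1,b)$, $\psi(b)=(1,a)\sigma$; the Brunner–Sidki–Vieira group $\langle\tau,\mu\rangle\le\mathrm{Aut}\,T_2$ with $\psi(\tau)=(1,\tau)\sigma$, $\psi(\mu)=(1,\mu^{-1})\sigma$; a constant GGS-group $\langle a,b\rangle\le\mathrm{Aut}\,T_p$, where $p$ is an odd prime, $a$ is the rooted automorphism of the $p$-cycle $\sigma$, and $\psi(b)=(a^c,\dots,a^c,b)$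 with $p\nmid c$. Then $\mathrm{hspec}^{\mathcal S}(\overline\Gamma)=[0,1]$ and $\mathrm{hspec}^{\mathcal S}_{\trianglelefteq}(\overline\Gamma)=\{0,1\}$. -/

import Mathlib

open Filter Topology

namespace RootedTree

/-! ### The rooted tree `T_𝐦` and its automorphism group -/

/-- The vertices of `T_𝐦`: finite words whose `i`-th letter (counted from `0`) is one of the
`m i` letters `0, …, m i - 1`. -/
def Vertex (m : ℕ → ℕ) : Type := {w : List ℕ // ∀ (i : ℕ) (h : i < w.length), w[i] < m i}

/-- The root, i.e. the empty word. -/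
def root (m : ℕ → ℕ) : Vertex m := ⟨[], fun i h => absurd h (Nat.not_lt_zero i)⟩

/-- The level `d(v)` of a vertex. -/
def level {m : ℕ → ℕ} (v : Vertex m) : ℕ := v.1.length

/-- `v` is an immediate descendant of `u`. -/
def IsChild {m : ℕ → ℕ} (u v : Vertex m) : Prop := ∃ x : ℕ, v.1 = u.1 ++ [x]

/-- The `𝐦`-adic tree as a graph. -/
def tree (m : ℕ → ℕ) : SimpleGraph (Vertex m) where
  Adj u v := IsChild u v ∨ IsChild v u
  symm := ⟨fun _ _ h => h.symm⟩
  loopless := ⟨fun u h => by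
    rcases h with ⟨x, hx⟩ | ⟨x, hx⟩ <;> simpa using congrArg List.length hx⟩

/-- `Aut T_𝐦`: the graph automorphisms of `T_𝐦` fixing the root. -/
def autSubgroup (m : ℕ → ℕ) : Subgroup (tree m ≃g tree m) where
  carrier := {g | g (root m) = root m}
  one_mem' := rfl
  mul_mem' {g h} hg hh := by
    change g (h (root m)) = root m
    rw [show h (root m) = root m from hh]; exact hg
  inv_mem' {g} hg := by
    change g.symm (root m) = root m
    rw [RelIso.symm_apply_eq]; exact (show g (root m) = root m from hg).symm

abbrev AutT (m : ℕ → ℕ) : Type := ↥(autSubgroup m)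

/-- The action of automorphisms on vertices. -/
def app {m : ℕ → ℕ} (g : AutT m) (v : Vertex m) : Vertex m := g.1 v

@[simp] theorem app_one {m : ℕ → ℕ} (v : Vertex m) : app (1 : AutT m) v = v := rfl

@[simp] theorem app_mul {m : ℕ → ℕ} (g h : AutT m) (v : Vertex m) :
    app (g * h) v = app g (app h v) := rfl

@[simp] theorem app_inv_app {m : ℕ → ℕ} (g : AutT m) (v : Vertex m) :
    app g⁻¹ (app g v) = v := by rw [← app_mul]; simp

@[simp] theorem app_app_inv {m : ℕ → ℕ} (g : AutT m) (v : Vertex m) :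
    app g (app g⁻¹ v) = v := by rw [← app_mul]; simp

theorem app_injective {m : ℕ → ℕ} (g : AutT m) : Function.Injective (app g) :=
  g.1.injective

theorem app_root {m : ℕ → ℕ} (g : AutT m) : app g (root m) = root m := g.2

theorem app_ext {m : ℕ → ℕ} {g h : AutT m} (H : ∀ v, app g v = app h v) : g = h :=
  Subtype.ext (RelIso.ext H)

theorem exists_parent {m : ℕ → ℕ} (v : Vertex m) {n : ℕ} (hv : level v = n + 1) :
    ∃ u : Vertex m, IsChild u v ∧ level u = n := by
  have hne : v.1 ≠ [] := by
    intro h; simp [level, h] at hv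
  refine ⟨⟨v.1.dropLast, fun i h => ?_⟩, ⟨v.1.getLast hne, ?_⟩, ?_⟩
  · rw [List.getElem_dropLast]
    exact v.2 i _
  · exact (List.dropLast_append_getLast hne).symm
  · have : v.1.length = n + 1 := hv
    simp [level, this]

theorem level_of_isChild {m : ℕ → ℕ} {u v : Vertex m} (h : IsChild u v) :
    level v = level u + 1 := by
  obtain ⟨x, hx⟩ := h
  simp [level, hx]

theorem isChild_unique {m : ℕ → ℕ} {u u' v : Vertex m} (h : IsChild u v) (h' : IsChild u' v) :
    u = u' := by
  obtain ⟨x, hx⟩ := h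
  obtain ⟨x', hx'⟩ := h'
  exact Subtype.ext (List.append_inj_left' (hx.symm.trans hx') rfl)

theorem app_isChild {m : ℕ → ℕ} (g : AutT m) (n : ℕ) : ∀ v u : Vertex m, level u = n →
    IsChild u v → level (app g u) = n ∧ IsChild (app g u) (app g v) := by
  induction n with
  | zero =>
    intro v u hu huv
    have hr : u = root m := Subtype.ext (List.eq_nil_of_length_eq_zero hu)
    have hg : app g u = root m := by rw [hr, app_root]
    refine ⟨by rw [hg]; rfl, ?_⟩
    have hadj : IsChild (app g u) (app g v) ∨ IsChild (app g v) (app g u) :=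
      g.1.map_rel_iff.2 (Or.inl huv)
    rcases hadj with h | h
    · exact h
    · have := level_of_isChild h
      rw [hg] at this
      exact absurd this (Nat.succ_ne_zero _).symm
  | succ n ih =>
    intro v u hu huv
    obtain ⟨t, htu, ht⟩ := exists_parent u hu
    obtain ⟨h1, h2⟩ := ih u t ht htu
    have hl : level (app g u) = n + 1 := by rw [level_of_isChild h2, h1]
    refine ⟨hl, ?_⟩
    have hadj : IsChild (app g u) (app g v) ∨ IsChild (app g v) (app g u) :=
      g.1.map_rel_iff.2 (Or.inl huv)
    rcases hadj with h | h
    · exact h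
    · have hvt : v = t := app_injective g (isChild_unique h h2)
      have h3 := level_of_isChild huv
      rw [hvt] at h3
      omega

theorem level_app {m : ℕ → ℕ} (g : AutT m) (v : Vertex m) : level (app g v) = level v := by
  rcases hn : level v with _ | n
  · have hr : v = root m := Subtype.ext (List.eq_nil_of_length_eq_zero hn)
    rw [hr, app_root]; rfl
  · obtain ⟨u, huv, hu⟩ := exists_parent v hn
    obtain ⟨h1, h2⟩ := app_isChild g n v u hu huv
    rw [level_of_isChild h2, h1]

/-- The `n`-th level stabilizer `St(n)` of `Aut T_𝐦`. An automorphism that fixes the vertices of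
level `n` fixes the vertices above them too, so the whole ball of radius `n` is fixed. -/
def St (m : ℕ → ℕ) (n : ℕ) : Subgroup (AutT m) where
  carrier := {g | ∀ v : Vertex m, level v ≤ n → app g v = v}
  one_mem' _ _ := rfl
  mul_mem' {g h} hg hh v hv := by rw [app_mul, hh v hv, hg v hv]
  inv_mem' {g} hg v hv := by
    conv_lhs => rw [← hg v hv]
    exact app_inv_app g v

instance St_normal (m : ℕ → ℕ) (n : ℕ) : (St m n).Normal where
  conj_mem g hg h v hv := by
    rw [app_mul, app_mul, hg _ (by rw [level_app]; exact hv), app_app_inv]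

theorem St_anti (m : ℕ → ℕ) : Antitone (St m) :=
  fun _ _ hab _ hg v hv => hg v (hv.trans hab)

theorem St_zero (m : ℕ → ℕ) : St m 0 = ⊤ := by
  refine eq_top_iff.2 fun g _ v hv => ?_
  have hr : v = root m := Subtype.ext (List.eq_nil_of_length_eq_zero (Nat.le_zero.1 hv))
  rw [hr, app_root]

theorem iInf_St (m : ℕ → ℕ) : ⨅ n, St m n = ⊥ := by
  refine eq_bot_iff.2 fun g hg => ?_
  rw [Subgroup.mem_iInf] at hg
  exact Subgroup.mem_bot.2 (app_ext fun v => hg (level v) v le_rfl)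

/-- The level stabilizers as a neighbourhood basis of the identity. -/
abbrev congruenceBasis (m : ℕ → ℕ) : GroupFilterBasis (AutT m) where
  sets := Set.range fun n => (St m n : Set (AutT m))
  nonempty := Set.range_nonempty _
  inter_sets := by
    rintro _ _ ⟨a, rfl⟩ ⟨b, rfl⟩
    exact ⟨_, ⟨max a b, rfl⟩,
      Set.subset_inter (St_anti m (le_max_left a b)) (St_anti m (le_max_right a b))⟩
  one' := by
    rintro _ ⟨n, rfl⟩
    exact (St m n).one_mem
  mul' := by
    rintro _ ⟨n, rfl⟩
    refine ⟨_, ⟨n, rfl⟩, ?_⟩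
    rintro _ ⟨a, ha, b, hb, rfl⟩
    exact (St m n).mul_mem ha hb
  inv' := by
    rintro _ ⟨n, rfl⟩
    exact ⟨_, ⟨n, rfl⟩, fun a ha => (St m n).inv_mem ha⟩
  conj' := by
    rintro x _ ⟨n, rfl⟩
    exact ⟨_, ⟨n, rfl⟩, fun a ha => (St_normal m n).conj_mem a ha x⟩

/-- The congruence topology on `Aut T_𝐦`. -/
instance instTopologicalSpaceAutT (m : ℕ → ℕ) : TopologicalSpace (AutT m) :=
  (congruenceBasis m).topology

instance instIsTopologicalGroupAutT (m : ℕ → ℕ) : IsTopologicalGroup (AutT m) :=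
  (congruenceBasis m).isTopologicalGroup

theorem isOpen_St (m : ℕ → ℕ) (n : ℕ) : IsOpen (St m n : Set (AutT m)) :=
  Subgroup.isOpen_of_mem_nhds _ (g := 1) ((congruenceBasis m).mem_nhds_one ⟨n, rfl⟩)

/-! ### Filtrations, Hausdorff dimension and Hausdorff spectra -/

/-- A filtration series of a topological group: a descending chain of open normal subgroups
starting at the whole group, with trivial intersection. -/
structure FiltrationSeries (G : Type*) [Group G] [TopologicalSpace G] where
  /-- The terms of the series. -/
  term : ℕ → Subgroup G
  term_zero : term 0 = ⊤
  antitone : Antitone term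
  normal : ∀ i, (term i).Normal
  isOpen : ∀ i, IsOpen (term i : Set G)
  iInf_eq_bot : ⨅ i, term i = ⊥

instance {G : Type*} [Group G] [TopologicalSpace G] (N : FiltrationSeries G) (i : ℕ) :
    (N.term i).Normal := N.normal i

section Dimension

variable {G : Type*} [Group G] [TopologicalSpace G]

/-- `hdim_G^N(H) = liminf_i log |H : H ∩ G_i| / log |G : G_i|`, where
`|H : H ∩ G_i| = |H G_i : G_i|`. -/
noncomputable def hdim (N : FiltrationSeries G) (H : Subgroup G) : ℝ :=
  liminf (fun i => Real.log ((N.term i).relIndex H : ℝ) / Real.log ((N.term i).index : ℝ)) atTop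

/-- The Hausdorff spectrum. -/
def hspec (N : FiltrationSeries G) : Set ℝ :=
  {d | ∃ H : Subgroup G, IsClosed (H : Set G) ∧ hdim N H = d}

/-- The normal Hausdorff spectrum. -/
def normalHspec (N : FiltrationSeries G) : Set ℝ :=
  {d | ∃ H : Subgroup G, IsClosed (H : Set G) ∧ H.Normal ∧ hdim N H = d}

end Dimension

/-- The level-stabilizer filtration `𝒮 = {St_G(n)}` of `G ≤ Aut T_𝐦`, `St_G(n) = St(n) ∩ G`. -/
def levelFiltration {m : ℕ → ℕ} (G : Subgroup (AutT m)) : FiltrationSeries G where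
  term n := (St m n).subgroupOf G
  term_zero := by rw [St_zero, Subgroup.top_subgroupOf]
  antitone _ _ hab _ hg := St_anti m hab hg
  normal _ := inferInstance
  isOpen n := (isOpen_St m n).preimage continuous_subtype_val
  iInf_eq_bot := by
    refine eq_bot_iff.2 fun g hg => Subgroup.mem_bot.2 (Subtype.ext ?_)
    have h : (g : AutT m) ∈ ⨅ n, St m n :=
      Subgroup.mem_iInf.2 fun n => Subgroup.mem_iInf.1 hg n
    rw [iInf_St] at h
    exact Subgroup.mem_bot.1 h

/-! ### Rigid stabilizers, branch groups and nice filtrations -/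

section Groups

variable {m : ℕ → ℕ}

/-- `v` lies below `u` (every vertex is taken to be below itself). -/
def IsBelow (u v : Vertex m) : Prop := u.1 <+: v.1

/-- The rigid vertex stabilizer `rist_G(v)`, as a subgroup of `G`: the elements of `G` that fix `v`
and act trivially outside the subtree rooted at `v`. -/
def rist (G : Subgroup (AutT m)) (v : Vertex m) : Subgroup G where
  carrier := {g | app g.1 v = v ∧ ∀ w, ¬ IsBelow v w → app g.1 w = w}
  one_mem' := ⟨rfl, fun _ _ => rfl⟩
  mul_mem' {g h} hg hh := by
    refine ⟨?_, fun w hw => ?_⟩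
    · rw [Subgroup.coe_mul, app_mul, hh.1, hg.1]
    · rw [Subgroup.coe_mul, app_mul, hh.2 w hw, hg.2 w hw]
  inv_mem' {g} hg := by
    refine ⟨?_, fun w hw => ?_⟩
    · conv_lhs => rw [← hg.1]
      exact app_inv_app g.1 v
    · conv_lhs => rw [← hg.2 w hw]
      exact app_inv_app g.1 w

/-- The `n`-th level `ℒ_n` of the tree. -/
abbrev Level (m : ℕ → ℕ) (n : ℕ) : Type := {v : Vertex m // level v = n}

/-- The rigid level stabilizer `Rist_G(n)`: the product of the (pairwise commuting) rigid vertex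
stabilizers of the vertices of level `n`. -/
def Rist (G : Subgroup (AutT m)) (n : ℕ) : Subgroup G := ⨆ v : Level m n, rist G v.1

/-- `G` acts transitively on every level. -/
def IsLevelTransitive (G : Subgroup (AutT m)) : Prop :=
  ∀ u v : Vertex m, level u = level v → ∃ g ∈ G, app g u = v

/-- Weakly branch groups. -/
structure IsWeaklyBranch (G : Subgroup (AutT m)) : Prop where
  levelTransitive : IsLevelTransitive G
  rist_ne_bot : ∀ n, 1 ≤ n → Rist G n ≠ ⊥

/-- Branch groups. -/
structure IsBranch (G : Subgroup (AutT m)) : Prop extends IsWeaklyBranch G where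
  finiteIndex : ∀ n, 1 ≤ n → (Rist G n).FiniteIndex

/-- A filtration `{G_i}` of `G` is nice if for every `k ≥ 1`, for all but finitely many `i`, the
group `Rist_G(k) G_i / G_i` is isomorphic to the direct product of the groups `rist_G(v) G_i / G_i`
over the vertices `v` of level `k`. Here `H G_i / G_i` is the image of `H` in `G / G_i`. -/
def IsNice (G : Subgroup (AutT m)) (N : FiltrationSeries G) : Prop :=
  ∀ k, 1 ≤ k → ∀ᶠ i in atTop,
    Nonempty ((Rist G k).map (QuotientGroup.mk' (N.term i)) ≃*
      ((v : Level m k) → (rist G v.1).map (QuotientGroup.mk' (N.term i))))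

/-- Condition (i): `hdim_G^N(Rist_G(n)) = 1` for all `n ≥ 1`. -/
def RistFullDimensional (G : Subgroup (AutT m)) (N : FiltrationSeries G) : Prop :=
  ∀ n, 1 ≤ n → hdim N (Rist G n) = 1

/-- Condition (ii): `hdim_G^N(Rist_G(n)') = 1` for all `n ≥ 1`. -/
def DerivedRistFullDimensional (G : Subgroup (AutT m)) (N : FiltrationSeries G) : Prop :=
  ∀ n, 1 ≤ n → hdim N ⁅Rist G n, Rist G n⁆ = 1

/-- `G` is topologically finitely generated: some finite subset of `G` generates a subgroup that is
dense in `G`. Every (abstractly) finitely generated group satisfies this. -/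
def IsTopologicallyFG (G : Subgroup (AutT m)) : Prop :=
  ∃ S : Finset (AutT m), (S : Set (AutT m)) ⊆ G ∧
    G ≤ (Subgroup.closure (S : Set (AutT m))).topologicalClosure

end Groups

/-! ### The `m`-adic tree -/

/-- `Aut T_m` for the `m`-adic tree `T_m`. -/
abbrev AutR (m : ℕ) : Type := AutT fun _ => m

/-- `h` is the section `g|_v` of `g` at `v`: `g(vu) = g(v) h(u)` for all words `u`. -/
def IsSection {m : ℕ} (g : AutR m) (v : Vertex fun _ => m) (h : AutR m) : Prop :=
  ∀ u w : Vertex fun _ => m, w.1 = v.1 ++ u.1 → (app g w).1 = (app g v).1 ++ (app h u).1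

/-- `g|_v ∈ G` for all `g ∈ G` and all vertices `v`. -/
def IsSelfSimilar {m : ℕ} (G : Subgroup (AutR m)) : Prop :=
  ∀ g ∈ G, ∀ v, ∃ h ∈ G, IsSection g v h

/-- `ψ(St_L(1)) ≥ L × ⋯ × L`: every `m`-tuple of elements of `L` is the tuple of first level
sections of an element of `L` that fixes the first level. -/
def IsBranching {m : ℕ} (L : Subgroup (AutR m)) : Prop :=
  ∀ h : Level (fun _ => m) 1 → L,
    ∃ g ∈ L ⊓ St (fun _ => m) 1, ∀ v : Level (fun _ => m) 1, IsSection g v.1 (h v).1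

/-- `G` is weakly regular branch over `L`: it is self-similar and level-transitive, and `L` is a
non-trivial branching subgroup of `G`. -/
structure IsWeaklyRegularBranchOver {m : ℕ} (G L : Subgroup (AutR m)) : Prop where
  selfSimilar : IsSelfSimilar G
  levelTransitive : IsLevelTransitive G
  le : L ≤ G
  ne_bot : L ≠ ⊥
  branching : IsBranching L

/-- `τ` is the label of `g` at `v`: `g(vx) = g(v) τ(x)` for all letters `x`. -/
def IsLabel {m : ℕ} (g : AutR m) (v : Vertex fun _ => m) (τ : Equiv.Perm (Fin m)) : Prop :=
  ∀ (x : Fin m) (w : Vertex fun _ => m), w.1 = v.1 ++ [(x : ℕ)] →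
    (app g w).1 = (app g v).1 ++ [(τ x : ℕ)]

/-- The iterated permutational wreath product `W_H`: all labels lie in `H`. -/
def iteratedWreath {m : ℕ} (H : Subgroup (Equiv.Perm (Fin m))) : Set (AutR m) :=
  {g | ∀ v, ∃ τ ∈ H, IsLabel g v τ}

/-- The set of `p`-adic automorphisms `W_p = W_⟨σ⟩`, `σ = (1 2 ⋯ p)`. -/
def padicAut (p : ℕ) : Set (AutR p) := iteratedWreath (Subgroup.zpowers (finRotate p))

/-- The term `K^{(i)}` of the derived series of `K`. -/
def derivedTerm {m : ℕ} (K : Subgroup (AutR m)) (i : ℕ) : Subgroup (AutR m) :=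
  (derivedSeries K i).map K.subtype

/-! ### Automorphisms defined by a recursion -/

section Recursion

variable {Q : Type*} (m : ℕ) (r : Q → ℕ) (δ : Q → ℕ → Q)

/-- The map attached to a state `q`: the label at the root is the rotation `x ↦ x + r q mod m`, and
the section at the letter `x` is the map attached to the state `δ q x`. -/
def spin : Q → List ℕ → List ℕ
  | _, [] => []
  | q, x :: u => ((x + r q) % m) :: spin (δ q x) u

/-- The inverse map of `spin`. -/
def unspin : Q → List ℕ → List ℕ
  | _, [] => []
  | q, y :: u => ((y + (m - r q % m)) % m) :: unspin (δ q ((y + (m - r q % m)) % m)) u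

theorem rot_unrot (x s : ℕ) (hx : x < m) : ((x + s) % m + (m - s % m)) % m = x := by
  have hs : s % m < m := Nat.mod_lt _ (by omega)
  rw [Nat.mod_add_mod]
  have h := Nat.div_add_mod s m
  have : x + s + (m - s % m) = x + m * (s / m + 1) := by rw [Nat.mul_add, mul_one]; omega
  rw [this, Nat.add_mul_mod_self_left, Nat.mod_eq_of_lt hx]

theorem unrot_rot (x s : ℕ) (hx : x < m) : ((x + (m - s % m)) % m + s) % m = x := by
  have hs : s % m < m := Nat.mod_lt _ (by omega)
  rw [Nat.mod_add_mod]
  have h := Nat.div_add_mod s m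
  have : x + (m - s % m) + s = x + m * (s / m + 1) := by rw [Nat.mul_add, mul_one]; omega
  rw [this, Nat.add_mul_mod_self_left, Nat.mod_eq_of_lt hx]

theorem valid_iff (w : List ℕ) :
    (∀ (i : ℕ) (h : i < w.length), w[i] < m) ↔ ∀ x ∈ w, x < m :=
  ⟨fun H x hx => by
    obtain ⟨i, hi, rfl⟩ := List.getElem_of_mem hx
    exact H i hi, fun H i h => H _ (List.getElem_mem h)⟩

theorem spin_valid (q : Q) (w : List ℕ) (hw : ∀ x ∈ w, x < m) : ∀ x ∈ spin m r δ q w, x < m := by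
  induction w generalizing q with
  | nil => simp [spin]
  | cons x u ih =>
    have hx : x < m := hw x (by simp)
    intro y hy
    rw [spin, List.mem_cons] at hy
    rcases hy with rfl | hy
    · exact Nat.mod_lt _ (by omega)
    · exact ih _ (fun z hz => hw z (by simp [hz])) y hy

theorem unspin_valid (q : Q) (w : List ℕ) (hw : ∀ x ∈ w, x < m) :
    ∀ x ∈ unspin m r δ q w, x < m := by
  induction w generalizing q with
  | nil => simp [unspin]
  | cons x u ih =>
    have hx : x < m := hw x (by simp)
    intro y hy
    rw [unspin, List.mem_cons] at hy
    rcases hy with rfl | hy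
    · exact Nat.mod_lt _ (by omega)
    · exact ih _ (fun z hz => hw z (by simp [hz])) y hy

theorem unspin_spin (q : Q) (w : List ℕ) (hw : ∀ x ∈ w, x < m) :
    unspin m r δ q (spin m r δ q w) = w := by
  induction w generalizing q with
  | nil => rfl
  | cons x u ih =>
    rw [spin, unspin, rot_unrot m x (r q) (hw x (by simp)),
      ih _ (fun z hz => hw z (by simp [hz]))]

theorem spin_unspin (q : Q) (w : List ℕ) (hw : ∀ x ∈ w, x < m) :
    spin m r δ q (unspin m r δ q w) = w := by
  induction w generalizing q with
  | nil => rfl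
  | cons x u ih =>
    rw [unspin, spin, unrot_rot m x (r q) (hw x (by simp)),
      ih _ (fun z hz => hw z (by simp [hz]))]

theorem spin_snoc (q : Q) (w : List ℕ) (x : ℕ) :
    ∃ y, spin m r δ q (w ++ [x]) = spin m r δ q w ++ [y] := by
  induction w generalizing q with
  | nil => exact ⟨_, rfl⟩
  | cons a u ih =>
    obtain ⟨y, hy⟩ := ih (δ q a)
    exact ⟨y, by simp [spin, hy]⟩

theorem unspin_snoc (q : Q) (w : List ℕ) (x : ℕ) :
    ∃ y, unspin m r δ q (w ++ [x]) = unspin m r δ q w ++ [y] := by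
  induction w generalizing q with
  | nil => exact ⟨_, rfl⟩
  | cons a u ih =>
    obtain ⟨y, hy⟩ := ih (δ q ((a + (m - r q % m)) % m))
    exact ⟨y, by simp [unspin, hy]⟩

/-- The permutation of the vertices of `T_m` given by `spin`. -/
def spinEquiv (q : Q) : Vertex (fun _ => m) ≃ Vertex (fun _ => m) where
  toFun w := ⟨spin m r δ q w.1, (valid_iff m _).2 (spin_valid m r δ q _ ((valid_iff m _).1 w.2))⟩
  invFun w :=
    ⟨unspin m r δ q w.1, (valid_iff m _).2 (unspin_valid m r δ q _ ((valid_iff m _).1 w.2))⟩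
  left_inv w := Subtype.ext (unspin_spin m r δ q _ ((valid_iff m _).1 w.2))
  right_inv w := Subtype.ext (spin_unspin m r δ q _ ((valid_iff m _).1 w.2))

theorem spinEquiv_isChild (q : Q) (u v : Vertex fun _ => m) :
    IsChild (spinEquiv m r δ q u) (spinEquiv m r δ q v) ↔ IsChild u v := by
  constructor
  · rintro ⟨x, hx⟩
    obtain ⟨y, hy⟩ := unspin_snoc m r δ q (spinEquiv m r δ q u).1 x
    refine ⟨y, ?_⟩
    rw [← hx] at hy
    have h1 := congrArg Subtype.val ((spinEquiv m r δ q).left_inv u)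
    have h2 := congrArg Subtype.val ((spinEquiv m r δ q).left_inv v)
    exact h2.symm.trans (hy.trans (congrArg (· ++ [y]) h1))
  · rintro ⟨x, hx⟩
    obtain ⟨y, hy⟩ := spin_snoc m r δ q u.1 x
    refine ⟨y, ?_⟩
    rw [← hx] at hy
    exact hy

/-- The automorphism of `T_m` given by `spin`. -/
def spinAut (q : Q) : AutR m :=
  ⟨⟨spinEquiv m r δ q, fun {u v} =>
    or_congr (spinEquiv_isChild m r δ q u v) (spinEquiv_isChild m r δ q v u)⟩, rfl⟩

end Recursion

/-! ### The Basilica group, the Brunner-Sidki-Vieira group and the constant GGS-groups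

In `ψ(g) = (g₀, …, g_{m-1}) τ` the letters are `0, …, m - 1`; such a `g` maps a word `x u` to
`τ(x) g_x(u)`. -/

/-- States of the recursion of the Basilica group. -/
inductive BasilicaState
  | e | a | b

/-- Rotation parts: only `b` has a non-trivial label at the root. -/
def basilicaRot : BasilicaState → ℕ
  | .b => 1
  | _ => 0

/-- Sections: `ψ(a) = (1, b)` and `ψ(b) = (1, a) σ`. -/
def basilicaNext : BasilicaState → ℕ → BasilicaState
  | .a, 1 => .b
  | .b, 1 => .a
  | _, _ => .e

/-- The Basilica group, generated by `a` and `b` with `ψ(a) = (1, b)`, `ψ(b) = (1, a) σ`. -/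
def basilica : Subgroup (AutR 2) :=
  Subgroup.closure {spinAut 2 basilicaRot basilicaNext .a, spinAut 2 basilicaRot basilicaNext .b}

/-- States of the recursion of the Brunner-Sidki-Vieira group (`muInv` is the inverse of `mu`). -/
inductive BSVState
  | e | tau | mu | muInv

/-- Rotation parts: `τ`, `μ` and `μ⁻¹` swap the two letters. -/
def bsvRot : BSVState → ℕ
  | .e => 0
  | _ => 1

/-- Sections: `ψ(τ) = (1, τ) σ`, `ψ(μ) = (1, μ⁻¹) σ` and `ψ(μ⁻¹) = (μ, 1) σ`. -/
def bsvNext : BSVState → ℕ → BSVState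
  | .tau, 1 => .tau
  | .mu, 1 => .muInv
  | .muInv, 0 => .mu
  | _, _ => .e

/-- The Brunner-Sidki-Vieira group, generated by `τ` and `μ` with `ψ(τ) = (1, τ) σ` and
`ψ(μ) = (1, μ⁻¹) σ`. -/
def brunnerSidkiVieira : Subgroup (AutR 2) :=
  Subgroup.closure {spinAut 2 bsvRot bsvNext .tau, spinAut 2 bsvRot bsvNext .mu}

/-- States of the recursion of a constant GGS-group (`ac` is `a ^ c`). -/
inductive GGSState
  | e | a | ac | b

/-- Rotation parts: `a` is the rooted automorphism of the cycle `σ`, and `b` fixes the letters. -/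
def ggsRot (c : ℕ) : GGSState → ℕ
  | .a => 1
  | .ac => c
  | _ => 0

/-- Sections: `ψ(b) = (a ^ c, …, a ^ c, b)`, and rooted automorphisms have trivial sections. -/
def ggsNext (p : ℕ) : GGSState → ℕ → GGSState
  | .b, x => if x + 1 = p then .b else .ac
  | _, _ => .e

/-- The GGS-group with constant defining vector `(c, …, c)`: it is generated by the rooted
automorphism `a` of the `p`-cycle `σ` and by `b` with `ψ(b) = (a ^ c, …, a ^ c, b)`. -/
def constantGGS (p c : ℕ) : Subgroup (AutR p) :=
  Subgroup.closure {spinAut p (ggsRot c) (ggsNext p) .a, spinAut p (ggsRot c) (ggsNext p) .b}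

end RootedTree

open RootedTree

/-! Everything is read off from the orders of the images of subgroups in the finite quotients by the
level stabilizers: `count`, with logarithm `logCount`.

Statement 1. Passing to a finite index subgroup changes the logarithms by a bounded amount, while
the indices of the filtration are unbounded: otherwise the group would be discrete, which
non-trivial rigid stabilizers at arbitrary depth forbid (`FiltrationSeries.tendsto_index`,
`hdim_eq_one_of_finiteIndex`).

Statement 2. Self-similarity gives `logCount k G ≤ C m ^ k`, and a non-trivial branching subgroup
`L` gives an eventual lower bound `c m ^ k`. Hence a subgroup whose logarithmic count differs from
that of `G` by `o(m ^ k)` has dimension 1; this is `IsFull`. The heart of the proof is that fullness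
passes from `N` to `⁅N, N⁆` whenever `L ≤ N` (`IsFull.commutator`). Let `g ∈ N` have at most `r`
cycles on level `n`. Modulo `St (n + k)` the fibres of `u ↦ ⁅u, g⁆` on `N ⊓ St n` lie in cosets of
the centralizer of `g`, and an element of `St n` that commutes with `g` is determined by its
sections at one vertex of each cycle. So the loss is at most `r * logCount k G` plus a constant
(`count_le_mul_commutator`), which is negligible if `r / m ^ n` is small. Such `g` exist in `L`:
each coset `y L` has an element with fewer than `m ^ l` cycles on a fixed level `l`, and correcting
first-return sections by elements of `L` multiplies such bounds (`HasFewCycles.add`), so the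
proportion of cycles decays geometrically. Fullness therefore descends the derived series of `K` to
`⁅L, L⁆`, whose grafts at level `n` lie in the derived subgroup of `Rist G n`. The closure has the
same images in all the finite quotients.

Statement 3. A double commutator shows that a non-trivial normal subgroup contains the grafts of
`⁅L, L⁆` at all vertices of some level (`exists_graft_commutator_mem`), hence has dimension 1. For
`α` in `[0, 1]`, identify vertices with `m`-adic subintervals of `[0, 1]`: the elements supported on
`[0, α]` form a closed subgroup of dimension `α`. Both arguments need a full branching `L`
normalized by the group, and fullness follows from `G'' ≤ L ≤ G'` (`spectra_of_generators`). For the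
first two groups `L = G'`; for a constant GGS-group `L = K'`, where `K` is the normal closure of `b
a ^ (-c)`. -/

namespace RootedTree

open scoped commutatorElement

/-! ### Levels and balls -/

/-- Vertices of level `n` as choice functions. -/
def levelEquiv (m : ℕ → ℕ) (n : ℕ) : Level m n ≃ ((i : Fin n) → Fin (m i)) where
  toFun v i := ⟨v.1.1[i.1]'(by have := v.2; have := i.2; simp only [level] at *; omega),
    v.1.2 _ _⟩
  invFun f := ⟨⟨List.ofFn fun i => (f i : ℕ), fun i h => by
    rw [List.getElem_ofFn]; exact (f _).2⟩, by simp [level]⟩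
  left_inv v := by
    refine Subtype.ext (Subtype.ext (List.ext_getElem ?_ fun i _ _ => ?_))
    · rw [List.length_ofFn]; exact v.2.symm
    · simp
  right_inv f := by ext i; simp

instance finite_level (m : ℕ → ℕ) (n : ℕ) : Finite (Level m n) :=
  Finite.of_equiv _ (levelEquiv m n).symm

theorem card_level (m n : ℕ) : Nat.card (Level (fun _ => m) n) = m ^ n := by
  rw [Nat.card_congr (levelEquiv _ n), Nat.card_pi]; simp

/-- The ball of radius `k` around the root. -/
abbrev Ball (m : ℕ → ℕ) (k : ℕ) := {v : Vertex m // level v ≤ k}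

instance finite_ball (m : ℕ → ℕ) (k : ℕ) : Finite (Ball m k) := by
  refine Finite.of_injective (β := (i : Fin (k + 1)) × Level m i)
    (fun v => ⟨⟨level v.1, Nat.lt_succ_of_le v.2⟩, ⟨v.1, rfl⟩⟩) fun v w h => ?_
  have := Sigma.mk.inj_iff.1 h
  obtain ⟨h1, h2⟩ := this
  have h1 := Fin.mk.inj_iff.1 h1
  apply Subtype.ext
  obtain ⟨v, hv⟩ := v
  obtain ⟨w, hw⟩ := w
  simp only at h1 h2 ⊢
  have key : ∀ a b : ℕ, ∀ (_ : a = b) (x : Level m a) (y : Level m b), HEq x y → x.1 = y.1 := by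
    rintro a _ rfl x y h; rw [eq_of_heq h]
  exact key _ _ h1 ⟨v, rfl⟩ ⟨w, rfl⟩ h2

/-- The action on the ball of radius `k`. -/
def ballHom (m : ℕ → ℕ) (k : ℕ) : AutT m →* Equiv.Perm (Ball m k) where
  toFun g := Equiv.Perm.subtypePerm g.1.toEquiv fun v => by
    change level (app g v) ≤ k ↔ _; rw [level_app]
  map_one' := rfl
  map_mul' _ _ := rfl

theorem ballHom_ker (m : ℕ → ℕ) (k : ℕ) : (ballHom m k).ker = St m k := by
  ext g
  rw [MonoidHom.mem_ker]
  constructor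
  · intro h v hv
    exact congrArg Subtype.val (Equiv.Perm.ext_iff.1 h ⟨v, hv⟩)
  · intro h
    ext v
    exact congrArg Subtype.val (Subtype.ext (h v.1 v.2) : ballHom m k g v = v)

theorem ballHom_eq_iff {m : ℕ → ℕ} {k : ℕ} (g h : AutT m) :
    ballHom m k g = ballHom m k h ↔ ∀ v, level v ≤ k → app g v = app h v := by
  rw [Equiv.ext_iff]
  exact ⟨fun H v hv => congrArg Subtype.val (H ⟨v, hv⟩), fun H v => Subtype.ext (H v.1 v.2)⟩

/-! ### Congruence counts -/

/-- The order of the image of `H` in `Aut T / St(k)`. -/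
noncomputable def count {m : ℕ → ℕ} (k : ℕ) (H : Subgroup (AutT m)) : ℕ := (St m k).relIndex H

theorem count_eq_card {m : ℕ → ℕ} (k : ℕ) (H : Subgroup (AutT m)) :
    count k H = Nat.card (H.map (ballHom m k)) := by
  rw [count, ← ballHom_ker, Subgroup.relIndex_ker]

theorem count_pos {m : ℕ → ℕ} (k : ℕ) (H : Subgroup (AutT m)) : 0 < count k H := by
  rw [count_eq_card]; exact Nat.card_pos

theorem count_mono {m : ℕ → ℕ} (k : ℕ) {H J : Subgroup (AutT m)} (h : H ≤ J) :
    count k H ≤ count k J := by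
  rw [count_eq_card, count_eq_card]
  exact Nat.card_le_card_of_injective _
    (Subgroup.inclusion_injective (Subgroup.map_mono (f := ballHom m k) h))

theorem count_congr {m : ℕ → ℕ} (k : ℕ) {H J : Subgroup (AutT m)} (hHJ : H ≤ J)
    (h : ∀ g ∈ J, ∃ x ∈ H, ∀ v, level v ≤ k → app g v = app x v) : count k H = count k J := by
  rw [count_eq_card, count_eq_card]
  congr 2
  refine le_antisymm (Subgroup.map_mono hHJ) ?_
  rintro _ ⟨g, hg, rfl⟩
  obtain ⟨x, hx, hgx⟩ := h g hg
  exact ⟨x, hx, ((ballHom_eq_iff g x).2 hgx).symm⟩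

theorem mem_topologicalClosure_iff {m : ℕ → ℕ} (G : Subgroup (AutT m)) (g : AutT m) :
    g ∈ G.topologicalClosure ↔ ∀ k, ∃ x ∈ G, ∀ v, level v ≤ k → app g v = app x v := by
  have hb := (congruenceBasis m).nhds_hasBasis g
  rw [← SetLike.mem_coe, Subgroup.topologicalClosure_coe, mem_closure_iff_nhds_basis hb]
  constructor
  · intro H k
    obtain ⟨_, hy, z, hz, rfl⟩ := H (St m k) ⟨k, rfl⟩
    refine ⟨_, hy, fun v hv => ?_⟩
    simp only [app_mul]
    rw [hz v hv]
  · rintro H _ ⟨k, rfl⟩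
    obtain ⟨x, hx, hgx⟩ := H k
    refine ⟨x, hx, g⁻¹ * x, fun v hv => ?_, by simp⟩
    rw [app_mul, ← hgx v hv, app_inv_app]

/-- By density a group and its closure have the same image in every finite quotient. This is why all
estimates are proved for `G` and then transferred. -/
theorem count_topologicalClosure {m : ℕ → ℕ} (k : ℕ) (G : Subgroup (AutT m)) :
    count k G.topologicalClosure = count k G :=
  (count_congr k G.le_topologicalClosure fun g hg => (mem_topologicalClosure_iff G g).1 hg k).symm

theorem count_le_of_relIndex {m : ℕ → ℕ} (k : ℕ) {K G : Subgroup (AutT m)} (hKG : K ≤ G)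
    (h : K.relIndex G ≠ 0) : count k G ≤ K.relIndex G * count k K := by
  have h1 : (St m k ⊓ K).relIndex G = (St m k ⊓ K).relIndex K * K.relIndex G :=
    (Subgroup.relIndex_mul_relIndex _ _ _ inf_le_right hKG).symm
  rw [Subgroup.inf_relIndex_right] at h1
  have h2 : (St m k).relIndex G ∣ (St m k ⊓ K).relIndex G :=
    Subgroup.relIndex_dvd_of_le_left _ inf_le_left
  rw [h1] at h2
  rw [mul_comm]
  exact Nat.le_of_dvd (Nat.mul_pos (count_pos k K) (Nat.pos_of_ne_zero h)) h2

theorem levelFiltration_index {m : ℕ → ℕ} (G : Subgroup (AutT m)) (k : ℕ) :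
    ((levelFiltration G).term k).index = count k G := rfl

theorem levelFiltration_relIndex {m : ℕ → ℕ} (G : Subgroup (AutT m)) (H : Subgroup G) (k : ℕ) :
    ((levelFiltration G).term k).relIndex H = count k (H.map G.subtype) := by
  rw [count, ← Subgroup.relIndex_comap]; rfl

/-- The counting principle behind the upper bounds: `X` collects the data, usually a tuple of
truncated sections, that determine the image of an element. `F` need not be a homomorphism. -/
theorem card_map_le_of_determined {A B X : Type*} [Group A] [Group B] [Finite X]
    (f : A →* B) (H : Subgroup A) (F : H → X) (hF : ∀ x y : H, F x = F y → f x = f y) :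
    Nat.card (H.map f) ≤ Nat.card X := by
  have hs : ∀ y : H.map f, ∃ x : H, f x = y := fun y => by
    obtain ⟨x, hx, hxy⟩ := y.2; exact ⟨⟨x, hx⟩, hxy⟩
  choose s hs using hs
  refine Nat.card_le_card_of_injective (fun y => F (s y)) fun y z h => Subtype.ext ?_
  rw [← hs y, ← hs z]
  exact hF _ _ h

/-- Multiplicativity of the index along `H ⊓ St m k ≤ H ⊓ St m n ≤ H`. -/
theorem count_tower {m : ℕ → ℕ} {n k : ℕ} (hnk : n ≤ k) (H : Subgroup (AutT m)) :
    count k H = count k (H ⊓ St m n) * count n H := by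
  have h := Subgroup.relIndex_inf_mul_relIndex (St m k) (St m n) H
  rw [inf_eq_left.2 (St_anti m hnk), inf_comm (St m n)] at h
  exact h.symm

/-! ### Concatenation, sections and grafts -/

section Regular

variable {m : ℕ}

/-- The vertices of the `m`-adic tree. -/
abbrev RVertex (m : ℕ) : Type := Vertex fun _ => m

/-- The levels of the `m`-adic tree. -/
abbrev RLevel (m n : ℕ) : Type := Level (fun _ => m) n

/-- Concatenation of words. -/
def cat (v u : RVertex m) : RVertex m :=
  ⟨v.1 ++ u.1, (valid_iff m _).2 fun x hx => (List.mem_append.1 hx).elim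
    ((valid_iff m _).1 v.2 x) ((valid_iff m _).1 u.2 x)⟩

theorem cat_val (v u : RVertex m) : (cat v u).1 = v.1 ++ u.1 := rfl

theorem level_cat (v u : RVertex m) : level (cat v u) = level v + level u := by
  simp [level, cat_val]

theorem cat_assoc (v u w : RVertex m) : cat (cat v u) w = cat v (cat u w) :=
  Subtype.ext (List.append_assoc _ _ _)

theorem cat_root (v : RVertex m) : cat v (root _) = v := Subtype.ext (List.append_nil _)

theorem root_cat (v : RVertex m) : cat (root _) v = v := rfl

theorem level_root (m : ℕ → ℕ) : level (root m) = 0 := rfl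

theorem eq_root_of_level {m : ℕ → ℕ} {v : Vertex m} (h : level v = 0) : v = root m :=
  Subtype.ext (List.eq_nil_of_length_eq_zero h)

theorem cat_inj {v v' u u' : RVertex m} (hl : level v = level v') (h : cat v u = cat v' u') :
    v = v' ∧ u = u' := by
  have := List.append_inj (congrArg Subtype.val h) hl
  exact ⟨Subtype.ext this.1, Subtype.ext this.2⟩

theorem cat_right_injective (v : RVertex m) : Function.Injective (cat v) :=
  fun _ _ h => (cat_inj rfl h).2

theorem isBelow_iff {v w : RVertex m} : IsBelow v w ↔ ∃ u, w = cat v u := by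
  constructor
  · rintro ⟨t, ht⟩
    refine ⟨⟨t, (valid_iff m _).2 fun x hx => (valid_iff m _).1 w.2 x ?_⟩, Subtype.ext ht.symm⟩
    rw [← ht]; exact List.mem_append_right _ hx
  · rintro ⟨u, rfl⟩
    exact ⟨u.1, rfl⟩

theorem exists_cat_of_le {w : RVertex m} {n : ℕ} (h : n ≤ level w) :
    ∃ v u, level v = n ∧ w = cat v u := by
  refine ⟨⟨w.1.take n, (valid_iff m _).2 fun x hx => (valid_iff m _).1 w.2 x
    (List.mem_of_mem_take hx)⟩, ⟨w.1.drop n, (valid_iff m _).2 fun x hx =>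
    (valid_iff m _).1 w.2 x (List.mem_of_mem_drop hx)⟩, ?_,
    Subtype.ext (List.take_append_drop n w.1).symm⟩
  have h : n ≤ w.1.length := h
  simp [level, h]

theorem exists_cat {w : RVertex m} {n k : ℕ} (h : level w = n + k) :
    ∃ v u, level v = n ∧ level u = k ∧ w = cat v u := by
  obtain ⟨v, u, hv, rfl⟩ := exists_cat_of_le (w := w) (n := n) (by omega)
  rw [level_cat] at h
  exact ⟨v, u, hv, by omega, rfl⟩

theorem isSection_iff {g h : AutR m} {v : RVertex m} :
    IsSection g v h ↔ ∀ u, app g (cat v u) = cat (app g v) (app h u) :=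
  ⟨fun H u => Subtype.ext (H u (cat v u) rfl), fun H u w hw => by
    rw [show w = cat v u from Subtype.ext hw, H]; rfl⟩

theorem app_cat_left (g : AutR m) (v u : RVertex m) : ∃ u', app g (cat v u) = cat (app g v) u' := by
  induction h : level u generalizing u with
  | zero => exact ⟨root _, by rw [eq_root_of_level h, cat_root, cat_root]⟩
  | succ n ih =>
    obtain ⟨t, ⟨x, hx⟩, ht⟩ := exists_parent u h
    obtain ⟨t', ht'⟩ := ih t ht
    have hc : IsChild (cat v t) (cat v u) := ⟨x, by simp [cat_val, hx]⟩
    obtain ⟨y, hy⟩ := (app_isChild g _ _ _ rfl hc).2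
    rw [ht'] at hy
    refine (isBelow_iff (v := app g v)).1 ⟨t'.1 ++ [y], ?_⟩
    rw [hy, cat_val, List.append_assoc]

theorem isSection_app_eq {g h : AutR m} {v : RVertex m} (H : IsSection g v h) (u : RVertex m) :
    app g (cat v u) = cat (app g v) (app h u) := isSection_iff.1 H u

theorem IsSection.mul {g g' h h' : AutR m} {v : RVertex m} (H : IsSection g (app g' v) h)
    (H' : IsSection g' v h') : IsSection (g * g') v (h * h') :=
  isSection_iff.2 fun u => by
    rw [app_mul, isSection_app_eq H', isSection_app_eq H]; rfl

theorem IsSection.inv {g h : AutR m} {v : RVertex m} (H : IsSection g v h) :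
    IsSection g⁻¹ (app g v) h⁻¹ :=
  isSection_iff.2 fun u => app_injective g <| by
    rw [app_app_inv, app_inv_app, isSection_app_eq H, app_app_inv]

theorem IsSection.one (v : RVertex m) : IsSection 1 v 1 := isSection_iff.2 fun _ => rfl

theorem IsSection.unique {g h h' : AutR m} {v : RVertex m} (H : IsSection g v h)
    (H' : IsSection g v h') : h = h' :=
  app_ext fun u => cat_right_injective (app g v) <| by
    rw [← isSection_app_eq H, isSection_app_eq H']

theorem IsSection.comp {g h k : AutR m} {v u : RVertex m} (H : IsSection g v h)
    (H' : IsSection h u k) : IsSection g (cat v u) k :=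
  isSection_iff.2 fun w => by
    rw [cat_assoc, isSection_app_eq H, isSection_app_eq H, isSection_app_eq H', cat_assoc]

theorem IsSection.root (g : AutR m) : IsSection g (root _) g :=
  isSection_iff.2 fun u => by rw [app_root, root_cat, root_cat]

/-- An automorphism of the tree from a permutation of the vertices that preserves children in both
directions. -/
def autOfPerm {m : ℕ → ℕ} (f : Equiv.Perm (Vertex m)) (hf : ∀ u v, IsChild u v → IsChild (f u) (f v))
    (hf' : ∀ u v, IsChild u v → IsChild (f.symm u) (f.symm v)) (hr : f (root m) = root m) : AutT m :=
  have h : ∀ u v, IsChild (f u) (f v) ↔ IsChild u v := fun u v =>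
    ⟨fun h => by simpa using hf' _ _ h, hf u v⟩
  ⟨⟨f, fun {u v} => or_congr (h u v) (h v u)⟩, hr⟩

open Classical in
/-- The permutation of the vertices acting as `e` below `v` and trivially elsewhere. -/
noncomputable def graftPerm (v : RVertex m) (e : Equiv.Perm (RVertex m)) :
    Equiv.Perm (RVertex m) :=
  e.extendDomain (p := fun w => w ∈ Set.range (cat v)) (Equiv.ofInjective _ (cat_right_injective v))

theorem graftPerm_cat (v : RVertex m) (e : Equiv.Perm (RVertex m)) (u : RVertex m) :
    graftPerm v e (cat v u) = cat v (e u) := by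
  classical
  exact Equiv.Perm.extendDomain_apply_image e (Equiv.ofInjective _ (cat_right_injective v)) u

theorem graftPerm_of_not_isBelow {v : RVertex m} (e : Equiv.Perm (RVertex m)) {w : RVertex m}
    (h : ¬ IsBelow v w) : graftPerm v e w = w := by
  classical
  refine Equiv.Perm.extendDomain_apply_not_subtype e _ fun ⟨u, hu⟩ => h (isBelow_iff.2 ⟨u, hu.symm⟩)

theorem graftPerm_isChild (v : RVertex m) (g : AutR m) (u w : RVertex m) (h : IsChild u w) :
    IsChild (graftPerm v g.1.toEquiv u) (graftPerm v g.1.toEquiv w) := by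
  by_cases hu : IsBelow v u
  · obtain ⟨u', rfl⟩ := isBelow_iff.1 hu
    obtain ⟨x, hx⟩ := h
    obtain ⟨w', rfl⟩ := isBelow_iff.1 (show IsBelow v w from
      ⟨u'.1 ++ [x], by rw [hx, cat_val, List.append_assoc]⟩)
    rw [graftPerm_cat, graftPerm_cat]
    rw [cat_val, cat_val, List.append_assoc, List.append_right_inj] at hx
    obtain ⟨y, hy⟩ := (app_isChild g _ _ _ rfl ⟨x, hx⟩).2
    refine ⟨y, ?_⟩
    rw [cat_val, cat_val, List.append_assoc, List.append_right_inj]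
    exact hy
  · rw [graftPerm_of_not_isBelow _ hu]
    by_cases hw : IsBelow v w
    · have hvw : w = v := by
        obtain ⟨t, ht⟩ := hw
        obtain ⟨x, hx⟩ := h
        rcases List.eq_nil_or_concat t with rfl | ⟨t', y, rfl⟩
        · exact Subtype.ext (by rw [← ht, List.append_nil])
        · refine absurd ⟨t', ?_⟩ hu
          rw [hx, List.concat_eq_append, ← List.append_assoc] at ht
          exact List.append_inj_left' ht rfl
      have : graftPerm v g.1.toEquiv w = w := by
        rw [hvw]
        have := graftPerm_cat v g.1.toEquiv (root _)
        rwa [show g.1.toEquiv (root _) = root _ from g.2, cat_root] at this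
      rw [this]; exact h
    · rw [graftPerm_of_not_isBelow _ hw]; exact h

/-- The automorphism acting as `h` on the subtree rooted at `v` and trivially elsewhere. -/
noncomputable def graft (v : RVertex m) : AutR m →* AutR m where
  toFun h := autOfPerm (graftPerm v h.1.toEquiv) (graftPerm_isChild v h)
    (graftPerm_isChild v h⁻¹) (by
      by_cases hv : IsBelow v (root _)
      · obtain ⟨t, ht⟩ := hv
        obtain rfl : v = root _ := Subtype.ext (List.append_eq_nil_iff.1 ht).1
        have := graftPerm_cat (root _) h.1.toEquiv (root fun _ => m)
        rw [root_cat, root_cat] at this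
        rw [this]; exact h.2
      · exact graftPerm_of_not_isBelow _ hv)
  map_one' := app_ext fun w => by
    change graftPerm v _ w = w
    by_cases hw : IsBelow v w
    · obtain ⟨u, rfl⟩ := isBelow_iff.1 hw
      rw [graftPerm_cat]; rfl
    · exact graftPerm_of_not_isBelow _ hw
  map_mul' g h := app_ext fun w => by
    change graftPerm v _ w = graftPerm v _ (graftPerm v _ w)
    by_cases hw : IsBelow v w
    · obtain ⟨u, rfl⟩ := isBelow_iff.1 hw
      rw [graftPerm_cat, graftPerm_cat, graftPerm_cat]; rfl
    · rw [graftPerm_of_not_isBelow _ hw, graftPerm_of_not_isBelow _ hw,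
        graftPerm_of_not_isBelow _ hw]

theorem graft_cat (v : RVertex m) (h : AutR m) (u : RVertex m) :
    app (graft v h) (cat v u) = cat v (app h u) := graftPerm_cat v _ u

theorem graft_of_not_isBelow {v : RVertex m} (h : AutR m) {w : RVertex m} (hw : ¬ IsBelow v w) :
    app (graft v h) w = w := graftPerm_of_not_isBelow _ hw

theorem graft_self (v : RVertex m) (h : AutR m) : app (graft v h) v = v := by
  have := graft_cat v h (root _)
  rwa [app_root, cat_root] at this

theorem graft_isSection (v : RVertex m) (h : AutR m) : IsSection (graft v h) v h :=
  isSection_iff.2 fun u => by rw [graft_cat, graft_self]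

theorem IsBelow.eq_of_level_le {m : ℕ → ℕ} {v w : Vertex m} (h : IsBelow v w)
    (hl : level w ≤ level v) : v = w :=
  Subtype.ext (List.IsPrefix.eq_of_length_le h hl)

theorem not_isBelow_cat {v w : RVertex m} (hl : level v = level w) (hvw : v ≠ w) (u : RVertex m) :
    ¬ IsBelow v (cat w u) := fun h => by
  obtain ⟨u', hu'⟩ := isBelow_iff.1 h
  exact hvw (cat_inj hl.symm hu').1.symm

theorem graft_cat_of_ne {v w : RVertex m} (hl : level v = level w) (hvw : v ≠ w) (h : AutR m)
    (u : RVertex m) : app (graft v h) (cat w u) = cat w u :=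
  graft_of_not_isBelow h (not_isBelow_cat hl hvw u)

theorem graft_of_level_le {v : RVertex m} (h : AutR m) {w : RVertex m} (hw : level w ≤ level v) :
    app (graft v h) w = w := by
  by_cases hb : IsBelow v w
  · rw [← hb.eq_of_level_le hw, graft_self]
  · exact graft_of_not_isBelow h hb

theorem graft_mem_St (v : RVertex m) (h : AutR m) : graft v h ∈ St (fun _ => m) (level v) :=
  fun _ hw => graft_of_level_le h hw

theorem graft_isSection_of_ne {v w : RVertex m} (hl : level v = level w) (hvw : v ≠ w)
    (h : AutR m) : IsSection (graft v h) w 1 :=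
  isSection_iff.2 fun u => by
    rw [graft_cat_of_ne hl hvw, graft_of_level_le _ hl.ge]; rfl

theorem graft_cat_graft (v u : RVertex m) (h : AutR m) : graft (cat v u) h = graft v (graft u h) := by
  refine app_ext fun w => ?_
  by_cases hw : IsBelow v w
  · obtain ⟨w, rfl⟩ := isBelow_iff.1 hw
    rw [graft_cat]
    by_cases hw' : IsBelow u w
    · obtain ⟨w, rfl⟩ := isBelow_iff.1 hw'
      rw [graft_cat, ← cat_assoc, graft_cat, cat_assoc]
    · rw [graft_of_not_isBelow h hw', graft_of_not_isBelow]
      intro hb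
      obtain ⟨t, ht⟩ := isBelow_iff.1 hb
      rw [cat_assoc] at ht
      exact hw' (isBelow_iff.2 ⟨t, cat_right_injective v ht⟩)
  · rw [graft_of_not_isBelow _ hw, graft_of_not_isBelow]
    intro hb
    obtain ⟨t, ht⟩ := isBelow_iff.1 hb
    exact hw (isBelow_iff.2 ⟨_, ht.trans (cat_assoc _ _ _)⟩)

theorem graft_root (h : AutR m) : graft (root _) h = h :=
  app_ext fun w => by
    have := graft_cat (root _) h w
    rwa [root_cat, root_cat] at this

/-- Conjugation by `g` carries the support from below `v` to below `app g v`, and the section of `g`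
at `v` conjugates the grafted element. All later computations with grafts rest on this. -/
theorem conj_graft {g s : AutR m} {v : RVertex m} (hs : IsSection g v s) (h : AutR m) :
    g * graft v h * g⁻¹ = graft (app g v) (s * h * s⁻¹) := by
  refine app_ext fun w => ?_
  obtain ⟨w, rfl⟩ : ∃ w', w = app g w' := ⟨app g⁻¹ w, by simp⟩
  rw [app_mul, app_mul, app_inv_app]
  by_cases hw : IsBelow v w
  · obtain ⟨u, rfl⟩ := isBelow_iff.1 hw
    rw [graft_cat, isSection_app_eq hs, isSection_app_eq hs, graft_cat]
    simp
  · rw [graft_of_not_isBelow h hw, graft_of_not_isBelow]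
    intro hb
    apply hw
    obtain ⟨t, ht⟩ := isBelow_iff.1 hb
    have h1 := congrArg (app g⁻¹) ht
    rw [app_inv_app] at h1
    obtain ⟨u', hu'⟩ := app_cat_left g⁻¹ (app g v) t
    rw [hu', app_inv_app] at h1
    exact isBelow_iff.2 ⟨_, h1⟩

theorem commute_graft {v w : RVertex m} (hl : level v = level w) (hvw : v ≠ w) (g h : AutR m) :
    Commute (graft v g) (graft w h) := by
  have := conj_graft (graft_isSection_of_ne hl hvw g) h
  rw [graft_of_level_le g hl.ge] at this
  simp only [one_mul, inv_one, mul_one] at this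
  exact (mul_inv_eq_iff_eq_mul.1 this)

/-- On level one, the branching property is applied to the tuple with a single non-trivial entry;
deeper vertices follow because grafting at a concatenation is iterated grafting. -/
theorem isBranching_graft {L : Subgroup (AutR m)} (hL : IsBranching L) :
    ∀ (v : RVertex m), ∀ h ∈ L, graft v h ∈ L := by
  have h1 : ∀ v : RVertex m, level v = 1 → ∀ h ∈ L, graft v h ∈ L := by
    intro v hv h hh
    classical
    obtain ⟨g, hg, hgs⟩ := hL (fun w => if w.1 = v then ⟨h, hh⟩ else 1)
    refine (?_ : g = graft v h) ▸ hg.1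
    refine (app_ext fun w => ?_).symm
    rcases Nat.eq_zero_or_pos (level w) with h0 | h0
    · rw [eq_root_of_level h0, app_root, app_root]
    · obtain ⟨w, u, hw, rfl⟩ := exists_cat_of_le h0
      have h2 := hgs ⟨w, hw⟩
      rw [isSection_app_eq h2, hg.2 w (le_of_eq hw)]
      by_cases hwv : w = v
      · subst hwv; simp [graft_cat]
      · rw [graft_cat_of_ne (by rw [hv]; exact hw.symm) (Ne.symm hwv)]; simp [hwv]
  intro v
  induction hn : level v generalizing v with
  | zero => intro h hh; rw [eq_root_of_level hn, graft_root]; exact hh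
  | succ n ih =>
    intro h hh
    obtain ⟨u, w, hu, hw, rfl⟩ := exists_cat hn
    rw [graft_cat_graft]
    exact ih u hu _ (h1 w hw h hh)

/-- Elements with prescribed sections at the vertices of a set of vertices of level `n`. -/
theorem exists_of_graft_mem {n : ℕ} (J : Subgroup (AutR m)) (s : Finset (RLevel m n))
    (f : RLevel m n → AutR m) (h : ∀ v ∈ s, graft v.1 (f v) ∈ J) :
    ∃ g ∈ J, g ∈ St (fun _ => m) n ∧ (∀ v ∈ s, IsSection g v.1 (f v)) ∧
      ∀ v ∉ s, IsSection g v.1 1 := by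
  classical
  induction s using Finset.induction_on with
  | empty => exact ⟨1, J.one_mem, (St _ n).one_mem, by simp, fun v _ => IsSection.one _⟩
  | insert a s ha ih =>
    obtain ⟨g, hgJ, hgS, hg1, hg2⟩ := ih fun v hv => h v (Finset.mem_insert_of_mem hv)
    have hfix : ∀ v : RLevel m n, app g v.1 = v.1 := fun v => hgS _ v.2.le
    have hne : ∀ v : RLevel m n, v ≠ a → IsSection (graft a.1 (f a)) (app g v.1) 1 := fun v hv => by
      rw [hfix]
      exact graft_isSection_of_ne (a.2.trans v.2.symm) (fun h => hv (Subtype.ext h.symm)) _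
    refine ⟨graft a.1 (f a) * g, J.mul_mem (h a (Finset.mem_insert_self _ _)) hgJ,
      (St _ n).mul_mem (by have := graft_mem_St a.1 (f a); rwa [a.2] at this) hgS, fun v hv => ?_,
      fun v hv => ?_⟩
    · rcases Finset.mem_insert.1 hv with rfl | hv
      · have h1 : IsSection (graft v.1 (f v)) (app g v.1) (f v) := by
          rw [hfix]; exact graft_isSection _ _
        simpa using h1.mul (hg2 v ha)
      · simpa using (hne v (fun h => ha (h ▸ hv))).mul (hg1 v hv)
    · rw [Finset.mem_insert, not_or] at hv
      simpa using (hne v hv.1).mul (hg2 v hv.2)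

end Regular

/-! ### Bounds for congruence counts -/

section Regular

variable {m : ℕ}

/-- If triviality below the vertices of `R` forces triviality on the ball of radius `n + k`, then
the sections at `R`, which lie in `G` by self-similarity, determine an element of `H` on that ball.
-/
theorem count_le_pow {G H : Subgroup (AutR m)} (hG : IsSelfSimilar G) (hHG : H ≤ G) {n k : ℕ}
    (R : Finset (RLevel m n)) (hHn : H ≤ St _ n)
    (hR : ∀ x ∈ H, (∀ v ∈ R, ∀ u, level u ≤ k → app x (cat v.1 u) = cat v.1 u) →
      ∀ w, level w ≤ n + k → app x w = w) :
    count (n + k) H ≤ count k G ^ R.card := by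
  choose sec hsec1 hsec2 using hG
  have h := card_map_le_of_determined (ballHom (fun _ => m) (n + k)) H
    (X := R → G.map (ballHom (fun _ => m) k))
    (fun x v => ⟨ballHom _ k (sec x.1 (hHG x.2) v.1.1), ⟨_, hsec1 _ _ _, rfl⟩⟩) (by
      intro x y hxy
      have key := hR (x.1⁻¹ * y.1) (H.mul_mem (H.inv_mem x.2) y.2) fun v hv u hu => by
        have h1 := congrArg Subtype.val (congrFun hxy ⟨v, hv⟩)
        have h2 := (ballHom_eq_iff _ _).1 h1 u hu
        have hx := isSection_app_eq (hsec2 x.1 (hHG x.2) v.1) u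
        have hy := isSection_app_eq (hsec2 y.1 (hHG y.2) v.1) u
        rw [hHn x.2 _ v.2.le] at hx
        rw [hHn y.2 _ v.2.le, ← h2, ← hx] at hy
        rw [app_mul, hy, app_inv_app]
      rw [ballHom_eq_iff]
      intro w hw
      have := key w hw
      rw [app_mul] at this
      conv_lhs => rw [← this, app_app_inv])
  rw [count_eq_card, count_eq_card]
  refine h.trans ?_
  rw [Nat.card_fun]
  simp

theorem count_add_le {G : Subgroup (AutR m)} (hG : IsSelfSimilar G) (n k : ℕ) :
    count (n + k) G ≤ count n G * count k G ^ (m ^ n) := by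
  classical
  have := Fintype.ofFinite (RLevel m n)
  rw [count_tower (Nat.le_add_right n k), mul_comm]
  refine Nat.mul_le_mul_left _ ?_
  have := count_le_pow hG (inf_le_left : G ⊓ St _ n ≤ G) (k := k) Finset.univ inf_le_right
    (fun x hx H w hw => by
      rcases le_total (level w) n with h | h
      · exact hx.2 w h
      · obtain ⟨v, u, hv, rfl⟩ := exists_cat_of_le h
        rw [level_cat] at hw
        exact H ⟨v, hv⟩ (Finset.mem_univ _) u (by omega))
  rwa [Finset.card_univ, ← Nat.card_eq_fintype_card, card_level] at this

/-- Grafts at distinct vertices of one level are independent, so `J` contains a copy of a power of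
`M`, and its sections survive down to depth `n + k`. -/
theorem pow_le_count {J M : Subgroup (AutR m)} {n k : ℕ} (D : Finset (RLevel m n))
    (hD : ∀ v ∈ D, ∀ h ∈ M, graft v.1 h ∈ J) : count k M ^ D.card ≤ count (n + k) J := by
  classical
  have hs : ∀ y : M.map (ballHom (fun _ => m) k), ∃ x ∈ M, ballHom _ k x = y := fun y => y.2
  choose s hs1 hs2 using hs
  have hg : ∀ f : D → M.map (ballHom (fun _ => m) k), ∃ g ∈ J, g ∈ St (fun _ => m) n ∧
      ∀ v : D, IsSection g v.1.1 (s (f v)) := fun f => by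
    -- The value `1` off `D` is a dummy; only the sections at `D` are used.
    obtain ⟨g, h1, h2, h3, -⟩ := exists_of_graft_mem J D
      (fun v => if hv : v ∈ D then s (f ⟨v, hv⟩) else 1)
      (fun v hv => hD v hv _ (by rw [dif_pos hv]; exact hs1 _))
    exact ⟨g, h1, h2, fun v => by simpa using h3 v.1 v.2⟩
  choose g hg1 hg2 hg3 using hg
  have := Nat.card_le_card_of_injective
    (fun f : D → M.map (ballHom (fun _ => m) k) =>
      (⟨ballHom _ (n + k) (g f), ⟨_, hg1 f, rfl⟩⟩ : J.map (ballHom (fun _ => m) (n + k)))) (by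
    intro f f' hff
    have h1 := (ballHom_eq_iff _ _).1 (congrArg Subtype.val hff)
    funext v
    refine Subtype.ext ?_
    rw [← hs2, ← hs2, ballHom_eq_iff]
    intro u hu
    have h2 := h1 (cat v.1.1 u) (by rw [level_cat]; exact Nat.add_le_add v.1.2.le hu)
    rw [isSection_app_eq (hg3 f v), isSection_app_eq (hg3 f' v), hg2 f _ v.1.2.le,
      hg2 f' _ v.1.2.le] at h2
    exact cat_right_injective _ h2)
  rw [Nat.card_fun] at this
  rw [count_eq_card, count_eq_card]
  simpa using this

/-! ### Commutators with an element having few cycles -/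

/-- Two elements of `S` with the same commutator with `t` differ by an element centralizing `t`, so
each fibre of `u ↦ ⁅u, t⁆` is at most as large as the centralizer of `t` in `S`. -/
theorem card_le_card_centralizer_mul {Q : Type*} [Group Q] [Finite Q] (S D : Subgroup Q) (t : Q)
    (h : ∀ u ∈ S, ⁅u, t⁆ ∈ D) :
    Nat.card S ≤ Nat.card (S ⊓ Subgroup.centralizer {t} : Subgroup Q) * Nat.card D := by
  classical
  have := Fintype.ofFinite Q
  have key := Finset.card_le_mul_card_image_of_maps_to (s := (Finset.univ : Finset S))
    (t := (Finset.univ : Finset D)) (f := fun u => ⟨⁅u.1, t⁆, h u.1 u.2⟩) (by simp)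
    (Nat.card (S ⊓ Subgroup.centralizer {t} : Subgroup Q)) (by
      rintro b -
      rcases Finset.eq_empty_or_nonempty
        (Finset.univ.filter fun u : S => (⟨⁅u.1, t⁆, h u.1 u.2⟩ : D) = b) with he | ⟨a, ha⟩
      · rw [he]; simp
      rw [← Nat.card_eq_finsetCard]
      refine Nat.card_le_card_of_injective
        (fun u => ⟨a.1⁻¹ * u.1.1, S.mul_mem (S.inv_mem a.2) u.1.2, ?_⟩) fun u w huw => ?_
      · have h1 := congrArg Subtype.val (Finset.mem_filter.1 ha).2
        have h2 := congrArg Subtype.val (Finset.mem_filter.1 u.2).2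
        simp only [commutatorElement_def] at h1 h2
        rw [← h2, mul_left_inj] at h1
        refine Subgroup.mem_centralizer_singleton_iff.2 ?_
        calc a.1⁻¹ * u.1.1 * t = a.1⁻¹ * (u.1.1 * t * (u.1.1)⁻¹) * u.1.1 := by group
          _ = t * (a.1⁻¹ * u.1.1) := by rw [← h1]; group
      · exact Subtype.ext (Subtype.ext (mul_left_cancel (congrArg Subtype.val huw))))
  simpa [Nat.card_eq_fintype_card] using key

/-- The cycles of `z` on level `n` are represented by at most `r` vertices. -/
def HasTransversal (z : AutR m) (n r : ℕ) : Prop :=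
  ∃ R : Finset (RLevel m n), R.card ≤ r ∧
    ∀ v : RLevel m n, ∃ w ∈ R, ∃ j : ℤ, app (z ^ j) w.1 = v.1

/-- The commutator map `u ↦ ⁅u, g⁆` on `N ⊓ St n` loses only the centralizer of `g`. An element
commuting with `g` is propagated along the cycles of `g`, so its sections at the `r` representatives
suffice. -/
theorem count_le_mul_commutator {G N : Subgroup (AutR m)} (hG : IsSelfSimilar G) (hNG : N ≤ G)
    {g : AutR m} (hg : g ∈ N) {n r : ℕ} (hr : HasTransversal g n r) (k : ℕ) :
    count (n + k) N ≤ count n N * (count k G ^ r * count (n + k) ⁅N, N⁆) := by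
  obtain ⟨R, hRr, hR⟩ := hr
  set f := ballHom (fun _ => m) (n + k)
  set C : Subgroup (AutR m) := (N ⊓ St _ n) ⊓ (Subgroup.centralizer {f g}).comap f with hC
  have h1 : count (n + k) (N ⊓ St _ n) ≤ count (n + k) C * count (n + k) ⁅N, N⁆ := by
    rw [count_eq_card, count_eq_card, count_eq_card]
    refine (card_le_card_centralizer_mul _ ((⁅N, N⁆ : Subgroup _).map f) (f g) ?_).trans
      (Nat.mul_le_mul_right _ ?_)
    · rintro _ ⟨u, hu, rfl⟩
      rw [← map_commutatorElement]
      exact ⟨_, Subgroup.commutator_mem_commutator hu.1 hg, rfl⟩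
    · refine Nat.card_le_card_of_injective _ (Subgroup.inclusion_injective ?_)
      rintro _ ⟨⟨u, hu, rfl⟩, hc⟩
      exact ⟨u, ⟨hu, hc⟩, rfl⟩
  have h2 : count (n + k) C ≤ count k G ^ r := by
    refine (count_le_pow hG (((inf_le_left.trans inf_le_left) : C ≤ N).trans hNG) R
      (inf_le_left.trans inf_le_right) fun x hx H w hw => ?_).trans
      (Nat.pow_le_pow_right (count_pos k G) hRr)
    rcases le_total (level w) n with h | h
    · exact hx.1.2 w h
    obtain ⟨w0, t, hw0, rfl⟩ := exists_cat_of_le h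
    obtain ⟨v, hv, j, hj⟩ := hR ⟨w0, hw0⟩
    obtain ⟨t', ht'⟩ := app_cat_left (g ^ j)⁻¹ w0 t
    have hlt : level t' = level t := by
      have := congrArg level ht'
      rw [level_app, level_cat, level_cat, level_app] at this
      omega
    simp only at hj
    rw [← hj, app_inv_app] at ht'
    -- The vertex is pulled back along its cycle to one below a representative, where `x` acts
    -- trivially; `x` commutes with `g ^ j` on the ball.
    have hwt : cat w0 t = app (g ^ j) (cat v.1 t') := by
      rw [← ht', ← hj, app_app_inv]
    have hcomm : f (x * g ^ j) = f (g ^ j * x) := by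
      have h3 : Commute (f x) (f g) := (Subgroup.mem_centralizer_singleton_iff.1 hx.2)
      rw [map_mul, map_mul, map_zpow]
      exact h3.zpow_right j
    have hl := level_cat w0 t
    have h4 := (ballHom_eq_iff _ _).1 hcomm (cat v.1 t') (by
      rw [level_cat, v.2, hlt]; omega)
    rw [app_mul, app_mul, H v hv t' (by omega)] at h4
    rw [hwt, h4]
  calc count (n + k) N = count (n + k) (N ⊓ St _ n) * count n N :=
        count_tower (Nat.le_add_right n k) N
    _ ≤ (count k G ^ r * count (n + k) ⁅N, N⁆) * count n N :=
        Nat.mul_le_mul_right _ (h1.trans (Nat.mul_le_mul_right _ h2))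
    _ = _ := mul_comm _ _

/-- In each coset `y L` with `y ∈ G` some element has at most `r` cycles on level `n`. -/
def HasFewCycles (G L : Subgroup (AutR m)) (n r : ℕ) : Prop :=
  ∀ y ∈ G, ∃ x ∈ L, HasTransversal (y * x) n r

theorem exists_moved {L : Subgroup (AutR m)} (hL : L ≠ ⊥) :
    ∃ h ∈ L, ∃ v, app h v ≠ v := by
  obtain ⟨⟨h, hh⟩, h1⟩ := Subgroup.ne_bot_iff_exists_ne_one.1 hL
  refine ⟨h, hh, ?_⟩
  by_contra! H
  exact h1 (Subtype.ext (app_ext H))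

/-- A moved vertex lies in the same cycle as its image, so the image can be dropped from the list of
all vertices. -/
theorem hasTransversal_of_moved {z : AutR m} {v : RVertex m} (hz : app z v ≠ v) :
    HasTransversal z (level v) (m ^ level v - 1) := by
  classical
  have := Fintype.ofFinite (RLevel m (level v))
  refine ⟨Finset.univ.erase ⟨app z v, level_app z v⟩, ?_, fun w => ?_⟩
  · rw [Finset.card_erase_of_mem (Finset.mem_univ _), Finset.card_univ,
      ← Nat.card_eq_fintype_card, card_level]
  · by_cases hw : w = ⟨app z v, level_app z v⟩
    · refine ⟨⟨v, rfl⟩, ?_, 1, ?_⟩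
      · simp only [Finset.mem_erase, Finset.mem_univ, and_true]
        exact fun h => hz (congrArg Subtype.val h).symm
      · rw [hw, zpow_one]
    · exact ⟨w, by simp [hw], 0, rfl⟩

/-- Let `h ∈ L` move `v`. For every `y`, one of `y` and `y * h` moves `v`. The level depends only on
`v` and so is the same for all cosets. -/
theorem exists_hasFewCycles (G : Subgroup (AutR m)) {L : Subgroup (AutR m)} (hL : L ≠ ⊥) :
    ∃ n, HasFewCycles G L n (m ^ n - 1) := by
  obtain ⟨h, hh, v, hv⟩ := exists_moved hL
  refine ⟨level v, fun y _ => ?_⟩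
  by_cases hy : app y v = v
  · refine ⟨h, hh, hasTransversal_of_moved (v := v) ?_⟩
    rw [app_mul]
    intro h'
    exact hv (app_injective y (h'.trans hy.symm))
  · exact ⟨1, L.one_mem, hasTransversal_of_moved (by rwa [mul_one])⟩

/-- Representatives from distinct cycles are needed so that a correction placed at one
representative is met only once while running through its cycle. -/
theorem HasTransversal.exists_reduced {z : AutR m} {n r : ℕ} (h : HasTransversal z n r) :
    ∃ R : Finset (RLevel m n), R.card ≤ r ∧
      (∀ v : RLevel m n, ∃ w ∈ R, ∃ j : ℤ, app (z ^ j) w.1 = v.1) ∧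
      ∀ v ∈ R, ∀ w ∈ R, ∀ j : ℤ, app (z ^ j) v.1 = w.1 → v = w := by
  classical
  obtain ⟨R, hRr, hR⟩ := h
  let st : Setoid (RLevel m n) :=
    { r := fun v w => ∃ j : ℤ, app (z ^ j) v.1 = w.1
      iseqv := ⟨fun v => ⟨0, rfl⟩, fun {v w} ⟨j, hj⟩ => ⟨-j, by
          rw [← hj, zpow_neg, app_inv_app]⟩, fun {u v w} ⟨i, hi⟩ ⟨j, hj⟩ => ⟨j + i, by
          rw [zpow_add, app_mul, hi, hj]⟩⟩ }
  let rep : RLevel m n → RLevel m n := fun v => (Quotient.mk st v).out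
  have hrep : ∀ v, st (rep v) v := fun v => Quotient.exact (Quotient.out_eq _)
  have hrep' : ∀ v w, st v w → rep v = rep w := fun v w h => by
    change (Quotient.mk st v).out = (Quotient.mk st w).out
    rw [Quotient.sound h]
  have hrr : ∀ v, rep (rep v) = rep v := fun v => hrep' _ _ (hrep v)
  refine ⟨R.image rep, Finset.card_image_le.trans hRr, fun v => ?_, ?_⟩
  · obtain ⟨w, hw, hwv⟩ := hR v
    refine ⟨rep w, Finset.mem_image_of_mem _ hw, ?_⟩
    exact st.trans (hrep w) hwv
  · intro v hv w hw j hj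
    obtain ⟨v, -, rfl⟩ := Finset.mem_image.1 hv
    obtain ⟨w, -, rfl⟩ := Finset.mem_image.1 hw
    rw [← hrr v, ← hrr w]
    exact hrep' _ _ ⟨j, hj⟩

/-- Let `z ∈ y L` have few cycles on level `l`. Below a representative `v`, the cycles of `z`
correspond to those of the first-return section, that of `z ^ p v` at `v`. Multiplying `z` by an
element of `L ⊓ St l` with section `x v` at `v` replaces this section by any chosen element of its
coset of `L`, hence by one with at most `s` cycles on level `n`. The statement is about all cosets
because first-return sections are arbitrary elements of `G`. -/
theorem HasFewCycles.add {G L : Subgroup (AutR m)} (hG : IsSelfSimilar G) (hLG : L ≤ G)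
    (hL : IsBranching L) {l n r s : ℕ} (hl : HasFewCycles G L l r) (hn : HasFewCycles G L n s) :
    HasFewCycles G L (l + n) (r * s) := by
  classical
  intro y hy
  obtain ⟨x₀, hx₀, hR⟩ := hl y hy
  obtain ⟨R, hRr, hRcov, hRred⟩ := hR.exists_reduced
  set z := y * x₀ with hz
  have hzG : z ∈ G := G.mul_mem hy (hLG hx₀)
  -- the cycle length of each representative
  have hper : ∀ v : RLevel m l, ∃ p : ℕ, 0 < p ∧ app (z ^ p) v.1 = v.1 ∧
      ∀ i, 0 < i → i < p → app (z ^ i) v.1 ≠ v.1 := by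
    intro v
    have hex : ∃ p : ℕ, 0 < p ∧ app (z ^ p) v.1 = v.1 := by
      let e : Equiv.Perm (Ball (fun _ => m) l) := ballHom _ l z
      refine ⟨orderOf e, orderOf_pos e, ?_⟩
      have h1 : ballHom _ l (z ^ orderOf e) = ballHom _ l 1 := by
        rw [map_pow, map_one]; exact pow_orderOf_eq_one e
      exact (ballHom_eq_iff _ _).1 h1 v.1 v.2.le
    refine ⟨Nat.find hex, (Nat.find_spec hex).1, (Nat.find_spec hex).2, fun i hi hlt h => ?_⟩
    exact Nat.find_min hex hlt ⟨hi, h⟩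
  choose p hp0 hpv hpmin using hper
  choose sec hsec1 hsec2 using hG
  have hx : ∀ v : RLevel m l, ∃ x ∈ L,
      HasTransversal (sec (z ^ p v) (G.pow_mem hzG _) v.1 * x) n s := fun v => hn _ (hsec1 _ _ _)
  choose x hxL hxT using hx
  choose T hTs hT using hxT
  obtain ⟨k, hkL, hkS, hk1, hk2⟩ := exists_of_graft_mem L R x
    fun v _ => isBranching_graft hL v.1 _ (hxL v)
  refine ⟨x₀ * k, L.mul_mem hx₀ hkL, ?_⟩
  rw [← mul_assoc, ← hz]
  -- powers of `z * k` agree with those of `z` on level `l`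
  have hball : ballHom (fun _ => m) l (z * k) = ballHom _ l z := by
    rw [ballHom_eq_iff]
    intro v hv
    rw [app_mul, hkS v hv]
  have hpowl : ∀ (j : ℤ) (v : RLevel m l), app ((z * k) ^ j) v.1 = app (z ^ j) v.1 := by
    intro j v
    refine (ballHom_eq_iff _ _).1 ?_ v.1 v.2.le
    rw [map_zpow, map_zpow, hball]
  -- The correction acts only in the first step: the later vertices of the cycle of `v` are not in
  -- `R`, so `k` is trivial below them.
  have hstep : ∀ v ∈ R, ∀ i, i < p v → ∀ u,
      app ((z * k) ^ (i + 1)) (cat v.1 u) = app (z ^ (i + 1)) (cat v.1 (app (x v) u)) := by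
    intro v hv i
    induction i with
    | zero =>
      intro _ u
      rw [zero_add, pow_one, pow_one, app_mul, isSection_app_eq (hk1 v hv), hkS _ v.2.le]
    | succ i ih =>
      intro hi u
      rw [pow_succ', app_mul, ih (by omega), app_mul, pow_succ' z (i + 1), app_mul]
      suffices hk : app k (app (z ^ (i + 1)) (cat v.1 (app (x v) u))) =
          app (z ^ (i + 1)) (cat v.1 (app (x v) u)) by rw [hk]; rfl
      obtain ⟨u', hu'⟩ := app_cat_left (z ^ (i + 1)) v.1 (app (x v) u)
      rw [hu']
      have hw : level (app (z ^ (i + 1)) v.1) = l := by rw [level_app, v.2]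
      have hnot : (⟨app (z ^ (i + 1)) v.1, hw⟩ : RLevel m l) ∉ R := fun hin => by
        have h1 := hRred v hv _ hin ((i + 1 : ℕ) : ℤ) (by rw [zpow_natCast])
        exact hpmin v (i + 1) (by omega) hi (congrArg Subtype.val h1).symm
      have := isSection_app_eq (hk2 _ hnot) u'
      rw [hkS _ hw.le] at this
      exact this
  have hret : ∀ v ∈ R, ∀ u, app ((z * k) ^ p v) (cat v.1 u) =
      cat v.1 (app (sec (z ^ p v) (G.pow_mem hzG _) v.1 * x v) u) := by
    intro v hv u
    have h1 := hstep v hv (p v - 1) (by have := hp0 v; omega) u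
    rw [Nat.sub_add_cancel (hp0 v)] at h1
    rw [h1, isSection_app_eq (hsec2 (z ^ p v) (G.pow_mem hzG _) v.1), hpv, app_mul]
  have hretz : ∀ v ∈ R, ∀ (j : ℤ) u, app ((z * k) ^ ((p v : ℤ) * j)) (cat v.1 u) =
      cat v.1 (app ((sec (z ^ p v) (G.pow_mem hzG _) v.1 * x v) ^ j) u) := by
    intro v hv j
    have hsecn : ∀ j : ℕ, ∀ u, app (((z * k) ^ p v) ^ j) (cat v.1 u) =
        cat v.1 (app ((sec (z ^ p v) (G.pow_mem hzG _) v.1 * x v) ^ j) u) := by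
      intro j
      induction j with
      | zero => intro u; simp
      | succ j ih => intro u; rw [pow_succ, app_mul, hret v hv, ih, ← app_mul,
          ← pow_succ _ j]
    intro u
    rw [zpow_mul, zpow_natCast]
    obtain ⟨j, rfl | rfl⟩ := j.eq_nat_or_neg
    · rw [zpow_natCast, zpow_natCast]; exact hsecn j u
    · rw [zpow_neg, zpow_neg, zpow_natCast, zpow_natCast]
      apply app_injective (((z * k) ^ p v) ^ j)
      rw [app_app_inv, hsecn, app_app_inv]
  let F : RLevel m l × RLevel m n → RLevel m (l + n) := fun a =>
    ⟨cat a.1.1 a.2.1, by rw [level_cat, a.1.2, a.2.2]⟩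
  refine ⟨(R.sigma T).image (fun a => F (a.1, a.2)), ?_, fun w => ?_⟩
  · refine Finset.card_image_le.trans ?_
    rw [Finset.card_sigma]
    refine (Finset.sum_le_card_nsmul R _ s fun v _ => hTs v).trans ?_
    rw [smul_eq_mul]
    exact Nat.mul_le_mul_right _ hRr
  · obtain ⟨w0, t, hw0, ht, hw⟩ := exists_cat w.2
    obtain ⟨v, hv, j, hj⟩ := hRcov ⟨w0, hw0⟩
    rw [← hpowl] at hj
    obtain ⟨t', ht'⟩ := app_cat_left ((z * k) ^ j)⁻¹ w0 t
    have hlt : level t' = n := by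
      have := congrArg level ht'
      rw [level_app, level_cat, level_cat, level_app] at this
      omega
    simp only at hj
    rw [← hj, app_inv_app] at ht'
    have hwt : w.1 = app ((z * k) ^ j) (cat v.1 t') := by
      rw [← ht', app_app_inv, hj, hw]
    obtain ⟨q, hq, i, hi⟩ := hT v ⟨t', hlt⟩
    refine ⟨F (v, q), Finset.mem_image.2 ⟨⟨v, q⟩, Finset.mem_sigma.2 ⟨hv, hq⟩, rfl⟩,
      j + p v * i, ?_⟩
    rw [zpow_add, app_mul, hwt]
    congr 1
    change app _ (cat v.1 q.1) = _
    rw [hretz v hv, hi]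

/-- Iterating the bound `m ^ l - 1` on level `l` gives `(m ^ l - 1) ^ t` on level `l * t`, a
proportion that tends to `0` with `t`. -/
theorem exists_hasFewCycles_le {G L : Subgroup (AutR m)} (hG : IsSelfSimilar G) (hLG : L ≤ G)
    (hL : IsBranching L) (hL1 : L ≠ ⊥) (hm : 0 < m) {ε : ℝ} (hε : 0 < ε) :
    ∃ n r : ℕ, HasFewCycles G L n r ∧ (r : ℝ) ≤ ε * m ^ n := by
  obtain ⟨l, hl⟩ := exists_hasFewCycles G hL1
  have hpow : ∀ t, HasFewCycles G L (l * t) ((m ^ l - 1) ^ t) := by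
    intro t
    induction t with
    | zero =>
      have := Fintype.ofFinite (RLevel m (l * 0))
      refine fun y _ => ⟨1, L.one_mem, Finset.univ, ?_, fun v => ⟨v, Finset.mem_univ _, 0, rfl⟩⟩
      rw [Finset.card_univ, ← Nat.card_eq_fintype_card, card_level]; simp
    | succ t ih =>
      rw [mul_add, mul_one, pow_succ]
      exact ih.add hG hLG hL hl
  have hml : (0 : ℝ) < (m : ℝ) ^ l := by positivity
  have hlt : ((m : ℝ) ^ l - 1) / m ^ l < 1 := by rw [div_lt_one hml]; linarith
  have hm1 : (1 : ℝ) ≤ (m : ℝ) ^ l := one_le_pow₀ (by exact_mod_cast hm)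
  obtain ⟨t, ht⟩ := exists_pow_lt_of_lt_one hε hlt
  refine ⟨l * t, _, hpow t, ?_⟩
  rw [div_pow, div_lt_iff₀ (by positivity)] at ht
  push_cast [Nat.one_le_pow l m hm]
  rw [pow_mul]
  exact ht.le

end Regular

/-! ### Finite index subgroups have full dimension -/

theorem exists_St_le {m : ℕ → ℕ} {G : Subgroup (AutT m)} {U : Subgroup G}
    (hU : IsOpen (U : Set G)) : ∃ n, (St m n).subgroupOf G ≤ U := by
  have h1 : (U : Set G) ∈ 𝓝 (1 : G) := hU.mem_nhds U.one_mem
  rw [nhds_subtype_eq_comap] at h1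
  obtain ⟨V, ⟨n, rfl⟩, hV⟩ := ((congruenceBasis m).nhds_one_hasBasis.comap _).mem_iff.1 h1
  exact ⟨n, fun g hg => hV hg⟩

theorem FiltrationSeries.index_ne_zero {m : ℕ → ℕ} {G : Subgroup (AutT m)}
    (N : FiltrationSeries G) (i : ℕ) : (N.term i).index ≠ 0 := by
  obtain ⟨n, hn⟩ := exists_St_le (N.isOpen i)
  intro h
  have h1 := Subgroup.index_dvd_of_le hn
  rw [h, zero_dvd_iff] at h1
  exact (count_pos n G).ne' h1

theorem Rist_le_St {m : ℕ → ℕ} (G : Subgroup (AutT m)) (n : ℕ) :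
    Rist G n ≤ (St m n).subgroupOf G := by
  refine iSup_le fun v g hg w hw => ?_
  by_cases hb : IsBelow v.1 w
  · rw [← hb.eq_of_level_le (hw.trans v.2.ge)]; exact hg.1
  · exact hg.2 w hb

/-- If the indices were bounded, the chain would stabilize, necessarily at the trivial group. Then
the trivial group is open, so some level stabilizer in `G` is trivial, and with it the next rigid
level stabilizer. -/
theorem FiltrationSeries.tendsto_index {m : ℕ → ℕ} {G : Subgroup (AutT m)}
    (hG : ∀ n, 1 ≤ n → Rist G n ≠ ⊥) (N : FiltrationSeries G) :
    Tendsto (fun i => (N.term i).index) atTop atTop := by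
  have hmono : Monotone fun i => (N.term i).index := fun i j hij =>
    Nat.le_of_dvd (Nat.pos_of_ne_zero (N.index_ne_zero j))
      (Subgroup.index_dvd_of_le (N.antitone hij))
  refine tendsto_atTop_atTop_of_monotone hmono ?_
  by_contra! H
  obtain ⟨b, hb⟩ := H
  obtain ⟨i, hi⟩ : ∃ i, ∀ j, i ≤ j → (N.term j).index = (N.term i).index := by
    have hfin : (Set.range fun i => (N.term i).index).Finite :=
      (Set.finite_Iio b).subset (by rintro _ ⟨i, rfl⟩; exact hb i)
    obtain ⟨_, ⟨⟨i, rfl⟩, hmax⟩⟩ := hfin.exists_maximal (Set.range_nonempty _)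
    exact ⟨i, fun j hij => le_antisymm (hmax ⟨j, rfl⟩ (hmono hij)) (hmono hij)⟩
  have hbot : N.term i = ⊥ := by
    refine eq_bot_iff.2 (N.iInf_eq_bot ▸ le_iInf fun j => ?_)
    refine le_trans ?_ (N.antitone (le_max_right i j))
    have h1 := Subgroup.relIndex_mul_index (N.antitone (le_max_left i j))
    rw [hi _ (le_max_left i j)] at h1
    exact Subgroup.relIndex_eq_one.1
      (Nat.eq_of_mul_eq_mul_right (Nat.pos_of_ne_zero (N.index_ne_zero i)) (by rw [h1, one_mul]))
  obtain ⟨n, hn⟩ := exists_St_le (N.isOpen i)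
  rw [hbot] at hn
  refine hG (n + 1) (by omega) (eq_bot_iff.2 ((Rist_le_St G (n + 1)).trans (le_trans ?_ hn)))
  exact fun g hg => St_anti m (Nat.le_succ n) hg

/-- The quotient of logarithms is squeezed between `1 - log |G : H| / log |G : G_i|` and `1`. -/
theorem hdim_eq_one_of_finiteIndex {m : ℕ → ℕ} {G : Subgroup (AutT m)}
    (N : FiltrationSeries G) (hN : Tendsto (fun i => (N.term i).index) atTop atTop)
    (H : Subgroup G) (hH : H.FiniteIndex) : hdim N H = 1 := by
  refine Tendsto.liminf_eq ?_
  have hlog : Tendsto (fun i => Real.log ((N.term i).index : ℝ)) atTop atTop :=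
    Real.tendsto_log_atTop.comp (tendsto_natCast_atTop_atTop.comp hN)
  have hlow : Tendsto (fun i => 1 - Real.log (H.index : ℝ) / Real.log ((N.term i).index : ℝ))
      atTop (𝓝 1) := by
    have := (tendsto_const_nhds (x := (1 : ℝ))).sub
      ((tendsto_const_nhds (x := Real.log (H.index : ℝ))).div_atTop hlog)
    rwa [sub_zero] at this
  have hrel : ∀ i, (N.term i).index ≤ (N.term i).relIndex H * H.index := fun i => by
    have h1 := Subgroup.relIndex_mul_index (inf_le_right : N.term i ⊓ H ≤ H)
    rw [Subgroup.inf_relIndex_right] at h1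
    rw [h1]
    have := N.index_ne_zero i
    refine Nat.le_of_dvd (Nat.pos_of_ne_zero ?_) (Subgroup.index_dvd_of_le inf_le_left)
    exact Subgroup.index_inf_ne_zero this hH.index_ne_zero
  have hpos : ∀ i, 0 < (N.term i).relIndex H := fun i =>
    Nat.pos_of_ne_zero fun h => by
      have := hrel i
      rw [h, zero_mul] at this
      exact N.index_ne_zero i (Nat.le_zero.1 this)
  have hle : ∀ i, (N.term i).relIndex H ≤ (N.term i).index := fun i =>
    Nat.le_of_dvd (Nat.pos_of_ne_zero (N.index_ne_zero i))
      (Subgroup.relIndex_dvd_index_of_normal _ _)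
  refine tendsto_of_tendsto_of_tendsto_of_le_of_le' hlow tendsto_const_nhds ?_ ?_
  · filter_upwards [hlog.eventually_gt_atTop 0] with i hi
    rw [le_div_iff₀ hi, sub_mul, div_mul_cancel₀ _ hi.ne', one_mul, sub_le_iff_le_add,
      ← Real.log_mul (by exact_mod_cast (hpos i).ne')
        (by exact_mod_cast hH.index_ne_zero)]
    refine Real.log_le_log (by exact_mod_cast Nat.pos_of_ne_zero (N.index_ne_zero i)) ?_
    exact_mod_cast hrel i
  · filter_upwards [hlog.eventually_gt_atTop 0] with i hi
    rw [div_le_one hi]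
    exact Real.log_le_log (by exact_mod_cast hpos i) (by exact_mod_cast hle i)

theorem IsBranch.ristFullDimensional {m : ℕ → ℕ} {G : Subgroup (AutT m)} (hG : IsBranch G)
    (N : FiltrationSeries G) : RistFullDimensional G N := fun n hn =>
  hdim_eq_one_of_finiteIndex N (N.tendsto_index hG.rist_ne_bot) _ (hG.finiteIndex n hn)

/-! ### Asymptotics of congruence counts -/

/-- The logarithmic congruence count. -/
noncomputable def logCount {m : ℕ → ℕ} (k : ℕ) (H : Subgroup (AutT m)) : ℝ :=
  Real.log (count k H)

theorem logCount_nonneg {m : ℕ → ℕ} (k : ℕ) (H : Subgroup (AutT m)) : 0 ≤ logCount k H :=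
  Real.log_natCast_nonneg _

theorem logCount_mono {m : ℕ → ℕ} (k : ℕ) {H J : Subgroup (AutT m)} (h : H ≤ J) :
    logCount k H ≤ logCount k J :=
  Real.log_le_log (by exact_mod_cast count_pos k H) (by exact_mod_cast count_mono k h)

theorem hdim_eq_of_tendsto {m : ℕ → ℕ} {G : Subgroup (AutT m)} (H : Subgroup G) {α : ℝ}
    (h : Tendsto (fun k => logCount k (H.map G.subtype) / logCount k G) atTop (𝓝 α)) :
    hdim (levelFiltration G) H = α := by
  rw [hdim]
  simp only [levelFiltration_index, levelFiltration_relIndex]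
  exact h.liminf_eq

theorem eventually_of_add {P : ℕ → Prop} (n : ℕ) (h : ∀ᶠ k in atTop, P (n + k)) :
    ∀ᶠ k in atTop, P k := by
  rw [eventually_atTop] at h ⊢
  obtain ⟨a, ha⟩ := h
  refine ⟨n + a, fun k hk => ?_⟩
  obtain ⟨j, rfl⟩ := Nat.exists_eq_add_of_le (show n ≤ k by omega)
  exact ha j (by omega)

theorem eventually_add {P : ℕ → Prop} (n : ℕ) (h : ∀ᶠ k in atTop, P k) :
    ∀ᶠ k in atTop, P (n + k) := by
  rw [eventually_atTop] at h ⊢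
  obtain ⟨a, ha⟩ := h
  exact ⟨a, fun k hk => ha _ (by omega)⟩

theorem eventually_le_mul_pow {m : ℕ} (hm : 2 ≤ m) (C : ℝ) {ε : ℝ} (hε : 0 < ε) :
    ∀ᶠ k : ℕ in atTop, C ≤ ε * (m : ℝ) ^ k :=
  ((tendsto_pow_atTop_atTop_of_one_lt (by exact_mod_cast hm : (1 : ℝ) < m)).const_mul_atTop
    hε).eventually_ge_atTop C

/-- Since `g` grows at least like `m ^ k`, errors of size `o(m ^ k)` do not affect the limit of the
quotient. -/
theorem tendsto_div_of_abs_sub_le {m : ℕ} (hm : 2 ≤ m) {g h : ℕ → ℝ} {α c : ℝ} (hc : 0 < c)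
    (hg : ∀ᶠ k in atTop, c * (m : ℝ) ^ k ≤ g k)
    (H : ∀ ε : ℝ, 0 < ε → ∀ᶠ k in atTop, |α * g k - h k| ≤ ε * (m : ℝ) ^ k) :
    Tendsto (fun k => h k / g k) atTop (𝓝 α) := by
  rw [Metric.tendsto_nhds]
  intro ε hε
  filter_upwards [hg, H (ε / 2 * c) (by positivity)] with k h1 h2
  have hmk : (0 : ℝ) < (m : ℝ) ^ k := by positivity
  have hgk : 0 < g k := lt_of_lt_of_le (by positivity) h1
  rw [Real.dist_eq, div_sub' hgk.ne', abs_div, abs_of_pos hgk, div_lt_iff₀ hgk, abs_sub_comm,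
    mul_comm (g k)]
  calc |α * g k - h k| ≤ ε / 2 * c * (m : ℝ) ^ k := h2
    _ = ε / 2 * (c * (m : ℝ) ^ k) := by ring
    _ ≤ ε / 2 * g k := by gcongr
    _ < ε * g k := by gcongr; linarith

/-! ### Subgroups of full logarithmic size: commutators, grafts, finite index -/

section Regular

variable {m : ℕ}

/-- `H` has full logarithmic size in `G`. -/
def IsFull (G H : Subgroup (AutR m)) : Prop :=
  ∀ ε : ℝ, 0 < ε → ∀ᶠ k in atTop, logCount k G - logCount k H ≤ ε * (m : ℝ) ^ k

theorem IsFull.mono {G H J : Subgroup (AutR m)} (h : IsFull G H) (hHJ : H ≤ J) : IsFull G J :=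
  fun ε hε => (h ε hε).mono fun k hk => by
    have := logCount_mono k hHJ
    linarith

theorem IsFull.refl (G : Subgroup (AutR m)) : IsFull G G := fun ε hε =>
  Eventually.of_forall fun k => by rw [sub_self]; positivity

/-- For `m ≤ 1` no level has two vertices, so nothing can be moved. -/
theorem two_le_of_ne_bot {L : Subgroup (AutR m)} (hL : L ≠ ⊥) : 2 ≤ m := by
  obtain ⟨h, -, v, hv⟩ := exists_moved hL
  by_contra! hm
  have h1 : Nat.card (RLevel m (level v)) ≤ 1 := by
    rw [card_level]; exact (Nat.pow_le_pow_left (by omega : m ≤ 1) _).trans (one_pow _).le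
  have := Finite.card_le_one_iff_subsingleton.1 h1
  exact hv (congrArg Subtype.val
    (Subsingleton.elim (⟨app h v, level_app h v⟩ : RLevel m (level v)) ⟨v, rfl⟩))

theorem exists_logCount_le {G : Subgroup (AutR m)} (hG : IsSelfSimilar G) (hm : 2 ≤ m) :
    ∃ C : ℝ, 0 < C ∧ ∀ k, logCount k G ≤ C * (m : ℝ) ^ k := by
  have hm' : (2 : ℝ) ≤ m := by exact_mod_cast hm
  have h0 := logCount_nonneg 1 G
  -- The `- 1` makes the induction close: it absorbs the additive term `logCount 1 G` in the
  -- recursion for `k + 1`.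
  suffices h : ∀ k, logCount k G ≤ (logCount 1 G + 1) * ((m : ℝ) ^ k - 1) from
    ⟨logCount 1 G + 1, by linarith, fun k => (h k).trans (by gcongr; linarith)⟩
  intro k
  induction k with
  | zero =>
    have : count 0 G = 1 := by rw [count, St_zero, Subgroup.relIndex_top_left]
    simp [logCount, this]
  | succ k ih =>
    have h1 : logCount (k + 1) G ≤ logCount 1 G + m * logCount k G := by
      have h2 := count_add_le hG 1 k
      rw [pow_one, add_comm] at h2
      have h3 := Real.log_le_log (by exact_mod_cast count_pos _ _)
        (by exact_mod_cast h2 : (count (k + 1) G : ℝ) ≤ count 1 G * (count k G : ℝ) ^ m)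
      rwa [Real.log_mul (by exact_mod_cast (count_pos _ _).ne')
        (by have := count_pos k G; positivity), Real.log_pow] at h3
    calc logCount (k + 1) G ≤ logCount 1 G + m * ((logCount 1 G + 1) * ((m : ℝ) ^ k - 1)) := by
          refine h1.trans ?_; gcongr
      _ ≤ (logCount 1 G + 1) * ((m : ℝ) ^ (k + 1) - 1) := by
          rw [pow_succ]; nlinarith

theorem mul_logCount_le {J M : Subgroup (AutR m)} {n k : ℕ} (D : Finset (RLevel m n))
    (hD : ∀ v ∈ D, ∀ h ∈ M, graft v.1 h ∈ J) : D.card * logCount k M ≤ logCount (n + k) J := by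
  have h1 := Real.log_le_log (by have := count_pos k M; positivity)
    (by exact_mod_cast pow_le_count (k := k) D hD :
      (count k M : ℝ) ^ D.card ≤ (count (n + k) J : ℝ))
  rwa [Real.log_pow] at h1

theorem pow_mul_logCount_le {J M : Subgroup (AutR m)} {n k : ℕ}
    (h : ∀ v, level v = n → ∀ x ∈ M, graft v x ∈ J) :
    (m : ℝ) ^ n * logCount k M ≤ logCount (n + k) J := by
  classical
  have := Fintype.ofFinite (RLevel m n)
  have h1 := mul_logCount_le (k := k) (M := M) (J := J) (Finset.univ : Finset (RLevel m n))
    fun v _ => h v.1 v.2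
  rw [Finset.card_univ, ← Nat.card_eq_fintype_card, card_level] at h1
  exact_mod_cast h1

theorem exists_le_logCount {L : Subgroup (AutR m)} (hL : IsBranching L) (hL1 : L ≠ ⊥) :
    ∃ c : ℝ, 0 < c ∧ ∀ᶠ k in atTop, c * (m : ℝ) ^ k ≤ logCount k L := by
  have hm := two_le_of_ne_bot hL1
  have hm0 : (0 : ℝ) < m := by exact_mod_cast (by omega : 0 < m)
  obtain ⟨h, hh, v, hv⟩ := exists_moved hL1
  set k₀ := level v
  have h2 : 2 ≤ count k₀ L := by
    by_contra! hlt
    have h1 : count k₀ L = 1 := by have := count_pos k₀ L; omega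
    exact hv (Subgroup.relIndex_eq_one.1 h1 hh v le_rfl)
  have h3 : Real.log 2 ≤ logCount k₀ L :=
    Real.log_le_log (by norm_num) (by exact_mod_cast h2)
  -- On level `k₀` the image of `L` has at least two elements, and the depth `n + k₀` carries `m ^
  -- n` grafted copies of it.
  refine ⟨Real.log 2 / (m : ℝ) ^ k₀, by have := Real.log_pos one_lt_two; positivity,
    eventually_of_add k₀ (Eventually.of_forall fun n => ?_)⟩
  have h4 := pow_mul_logCount_le (k := k₀) (n := n) (M := L) (J := L)
    fun v _ => isBranching_graft hL v
  rw [pow_add, div_mul_eq_mul_div, ← mul_assoc, mul_right_comm, mul_div_assoc, add_comm k₀ n]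
  calc Real.log 2 * (m : ℝ) ^ n * ((m : ℝ) ^ k₀ / (m : ℝ) ^ k₀)
      = (m : ℝ) ^ n * Real.log 2 := by rw [div_self (by positivity)]; ring
    _ ≤ (m : ℝ) ^ n * logCount k₀ L := by gcongr
    _ ≤ _ := h4

theorem logCount_add_le {G : Subgroup (AutR m)} (hG : IsSelfSimilar G) (n k : ℕ) :
    logCount (n + k) G ≤ logCount n G + (m : ℝ) ^ n * logCount k G := by
  have h3 := Real.log_le_log (by exact_mod_cast count_pos _ _)
    (by exact_mod_cast count_add_le hG n k :
      (count (n + k) G : ℝ) ≤ count n G * (count k G : ℝ) ^ (m ^ n))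
  rw [Real.log_mul (by exact_mod_cast (count_pos _ _).ne')
    (by have := count_pos k G; positivity), Real.log_pow] at h3
  exact_mod_cast h3

/-- The element with few cycles is taken in the coset `1 L = L`, hence in `N`. The level `n` is
fixed first, from `ε`; only then does `k` tend to infinity, so that `logCount n N` becomes
negligible. -/
theorem IsFull.commutator {G L N : Subgroup (AutR m)} (hG : IsSelfSimilar G) (hLN : L ≤ N)
    (hNG : N ≤ G) (hL : IsBranching L) (hL1 : L ≠ ⊥) (hN : IsFull G N) :
    IsFull G ⁅N, N⁆ := by
  have hm := two_le_of_ne_bot hL1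
  intro ε hε
  obtain ⟨C, hC, hGC⟩ := exists_logCount_le hG hm
  obtain ⟨n, r, hcyc, hr⟩ := exists_hasFewCycles_le hG (hLN.trans hNG) hL hL1 (by omega : 0 < m)
    (show 0 < ε / (2 * C) by positivity)
  obtain ⟨g, hg, hgr⟩ := hcyc 1 G.one_mem
  rw [one_mul] at hgr
  refine eventually_of_add n ?_
  filter_upwards [eventually_add n (hN (ε / 4) (by positivity)),
    eventually_add n (eventually_le_mul_pow hm (logCount n N) (show 0 < ε / 4 by positivity))]
    with k h1 h2
  have h3 : logCount (n + k) N ≤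
      logCount n N + (r * logCount k G + logCount (n + k) ⁅N, N⁆) := by
    have h4 := Real.log_le_log (by exact_mod_cast count_pos _ _)
      (by exact_mod_cast count_le_mul_commutator hG hNG (hLN hg) hgr k :
        (count (n + k) N : ℝ) ≤ count n N * ((count k G : ℝ) ^ r * count (n + k) ⁅N, N⁆))
    have hp1 : (count n N : ℝ) ≠ 0 := by exact_mod_cast (count_pos _ _).ne'
    have hp2 : (count k G : ℝ) ≠ 0 := by exact_mod_cast (count_pos _ _).ne'
    have hp3 : (count (n + k) ⁅N, N⁆ : ℝ) ≠ 0 := by exact_mod_cast (count_pos _ _).ne'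
    rwa [Real.log_mul hp1 (mul_ne_zero (pow_ne_zero _ hp2) hp3),
      Real.log_mul (pow_ne_zero _ hp2) hp3, Real.log_pow] at h4
  have h5 : r * logCount k G ≤ ε / 2 * (m : ℝ) ^ (n + k) := by
    calc r * logCount k G ≤ (ε / (2 * C) * (m : ℝ) ^ n) * (C * (m : ℝ) ^ k) :=
          mul_le_mul hr (hGC k) (logCount_nonneg _ _) (by positivity)
      _ = ε / 2 * (m : ℝ) ^ (n + k) := by rw [pow_add]; field_simp
  linarith

/-- `G` at depth `n + k` is bounded by `m ^ n` copies of itself at depth `k`, up to a constant, and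
`J` contains `m ^ n` copies of the full subgroup `M`. -/
theorem IsFull.of_graft {G M J : Subgroup (AutR m)} (hG : IsSelfSimilar G) (hm : 2 ≤ m)
    (hM : IsFull G M) {n : ℕ} (h : ∀ v, level v = n → ∀ x ∈ M, graft v x ∈ J) : IsFull G J := by
  intro ε hε
  refine eventually_of_add n ?_
  filter_upwards [hM (ε / 2) (by positivity),
    eventually_add n (eventually_le_mul_pow hm (logCount n G) (show 0 < ε / 2 by positivity))]
    with k h1 h2
  have h3 := logCount_add_le hG n k
  have h4 := pow_mul_logCount_le (k := k) h
  have h5 : (m : ℝ) ^ n * (logCount k G - logCount k M) ≤ ε / 2 * (m : ℝ) ^ (n + k) := by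
    rw [pow_add, mul_left_comm]; gcongr
  rw [mul_sub] at h5
  linarith

theorem IsFull.of_relIndex {G K : Subgroup (AutR m)} (hm : 2 ≤ m) (hKG : K ≤ G)
    (hK : K.relIndex G ≠ 0) : IsFull G K := by
  intro ε hε
  filter_upwards [eventually_le_mul_pow hm (Real.log (K.relIndex G)) hε] with k hk
  have h4 := Real.log_le_log (by exact_mod_cast count_pos _ _)
    (by exact_mod_cast count_le_of_relIndex k hKG hK :
      (count k G : ℝ) ≤ K.relIndex G * count k K)
  rw [Real.log_mul (by exact_mod_cast hK) (by exact_mod_cast (count_pos _ _).ne')] at h4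
  unfold logCount
  linarith

/-- The ambient group `G₁` only has to share its counts with `G`, so that `G₁` can be `G` or its
closure. -/
theorem IsFull.hdim_eq_one {G G₁ : Subgroup (AutR m)} {H : Subgroup G₁} {c : ℝ} (hm : 2 ≤ m)
    (hc : 0 < c) (hg : ∀ᶠ k in atTop, c * (m : ℝ) ^ k ≤ logCount k G)
    (hG₁ : ∀ k, count k G₁ = count k G) (h : IsFull G (H.map G₁.subtype)) :
    hdim (levelFiltration G₁) H = 1 := by
  have hG₁' : ∀ k, logCount k G₁ = logCount k G := fun k => by rw [logCount, hG₁]; rfl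
  refine hdim_eq_of_tendsto H ?_
  simp only [hG₁']
  refine tendsto_div_of_abs_sub_le hm hc hg fun ε hε => (h ε hε).mono fun k hk => ?_
  rwa [one_mul, abs_of_nonneg]
  rw [sub_nonneg, ← hG₁']
  exact logCount_mono k (Subgroup.map_subtype_le _)

/-! ### Rigid level stabilizers of weakly regular branch groups -/

theorem graft_mem_map_Rist {G : Subgroup (AutR m)} {v : RVertex m} {n : ℕ} (hv : level v = n)
    {x : AutR m} (hx : graft v x ∈ G) : graft v x ∈ (Rist G n).map G.subtype :=
  ⟨⟨graft v x, hx⟩, (le_iSup (fun v : RLevel m n => rist G v.1) ⟨v, hv⟩ : rist G v ≤ Rist G n)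
    ⟨graft_self v x, fun _ hw => graft_of_not_isBelow x hw⟩, rfl⟩

/-- The grafts of `L` at level `n` lie in `Rist G₁ n`, so the grafts of `⁅L, L⁆` lie in its derived
subgroup. -/
theorem derivedRistFullDimensional_of_isFull {G G₁ L : Subgroup (AutR m)} (hG : IsSelfSimilar G)
    (hLG : L ≤ G) (hGG₁ : G ≤ G₁) (hG₁ : ∀ k, count k G₁ = count k G) (hL : IsBranching L)
    (hL1 : L ≠ ⊥) (hfull : IsFull G ⁅L, L⁆) :
    DerivedRistFullDimensional G₁ (levelFiltration G₁) := by
  have hm := two_le_of_ne_bot hL1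
  obtain ⟨c, hc, hcL⟩ := exists_le_logCount hL hL1
  intro n _
  refine IsFull.hdim_eq_one hm hc (hcL.mono fun k hk => hk.trans (logCount_mono k hLG)) hG₁
    (hfull.of_graft hG hm (n := n) fun v hv x hx => ?_)
  rw [Subgroup.map_commutator]
  have h1 : graft v x ∈ (⁅L, L⁆ : Subgroup _).map (graft v) := ⟨x, hx, rfl⟩
  rw [Subgroup.map_commutator] at h1
  have h2 : L.map (graft v) ≤ (Rist G₁ n).map G₁.subtype := by
    rintro _ ⟨y, hy, rfl⟩
    exact graft_mem_map_Rist hv (hGG₁ (hLG (isBranching_graft hL v y hy)))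
  exact Subgroup.commutator_mono h2 h2 h1

theorem derivedTerm_zero (K : Subgroup (AutR m)) : derivedTerm K 0 = K := by
  rw [derivedTerm, derivedSeries_zero, ← MonoidHom.range_eq_map, Subgroup.range_subtype]

theorem derivedTerm_succ (K : Subgroup (AutR m)) (i : ℕ) :
    derivedTerm K (i + 1) = ⁅derivedTerm K i, derivedTerm K i⁆ := by
  rw [derivedTerm, derivedSeries_succ, Subgroup.map_commutator]; rfl

theorem derivedTerm_antitone (K : Subgroup (AutR m)) : Antitone (derivedTerm K) :=
  antitone_nat_of_succ_le fun i => Subgroup.map_mono (derivedSeries_antitone _ (Nat.le_succ i))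

/-- Fullness starts at `K` by finite index and descends one derived step at a time. The step from
`j` to `j + 1` needs `L = K^{(i)} ≤ K^{(j)}`, so the last term reached is the one with index `i +
1`, namely `⁅L, L⁆`. -/
theorem derivedRistFullDimensional_of_derivedTerm {G K : Subgroup (AutR m)} {i : ℕ} (hKG : K ≤ G)
    (hK : K.relIndex G ≠ 0) (h : IsWeaklyRegularBranchOver G (derivedTerm K i)) :
    DerivedRistFullDimensional G (levelFiltration G) ∧
      DerivedRistFullDimensional G.topologicalClosure (levelFiltration G.topologicalClosure) := by
  have hm := two_le_of_ne_bot h.ne_bot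
  have hfull : ∀ j, j ≤ i + 1 → IsFull G (derivedTerm K j) := by
    intro j
    induction j with
    | zero => intro _; rw [derivedTerm_zero]; exact IsFull.of_relIndex hm hKG hK
    | succ j ih =>
      intro hj
      rw [derivedTerm_succ]
      have hKj : derivedTerm K j ≤ G :=
        (derivedTerm_antitone K (Nat.zero_le j)).trans ((derivedTerm_zero K).le.trans hKG)
      exact (ih (by omega)).commutator h.selfSimilar (derivedTerm_antitone K (by omega)) hKj
        h.branching h.ne_bot
  have hf := hfull (i + 1) le_rfl
  rw [derivedTerm_succ] at hf
  exact ⟨derivedRistFullDimensional_of_isFull h.selfSimilar h.le le_rfl (fun _ => rfl)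
      h.branching h.ne_bot hf,
    derivedRistFullDimensional_of_isFull h.selfSimilar h.le G.le_topologicalClosure
      (fun k => count_topologicalClosure k G) h.branching h.ne_bot hf⟩

end Regular

/-! ### Hausdorff spectra of weakly regular branch groups -/

theorem hdim_mem_Icc {m : ℕ → ℕ} (G : Subgroup (AutT m)) (H : Subgroup G) :
    hdim (levelFiltration G) H ∈ Set.Icc (0 : ℝ) 1 := by
  have h0 : ∀ k, 0 ≤ logCount k (H.map G.subtype) / logCount k G := fun k =>
    div_nonneg (logCount_nonneg _ _) (logCount_nonneg _ _)
  have h1 : ∀ k, logCount k (H.map G.subtype) / logCount k G ≤ 1 := fun k =>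
    div_le_one_of_le₀ (logCount_mono k (Subgroup.map_subtype_le _)) (logCount_nonneg _ _)
  rw [hdim]
  simp only [levelFiltration_index, levelFiltration_relIndex]
  have hb : IsBoundedUnder (· ≥ ·) atTop
      fun k => logCount k (H.map G.subtype) / logCount k G := isBoundedUnder_of ⟨0, h0⟩
  have hb' : IsBoundedUnder (· ≤ ·) atTop
      fun k => logCount k (H.map G.subtype) / logCount k G := isBoundedUnder_of ⟨1, h1⟩
  constructor
  · exact le_liminf_of_le hb'.isCoboundedUnder_ge (Eventually.of_forall h0)
  · exact liminf_le_of_le hb fun b hb => by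
      obtain ⟨k, hk⟩ := hb.exists
      exact hk.trans (h1 k)

theorem hdim_bot {m : ℕ → ℕ} (G : Subgroup (AutT m)) : hdim (levelFiltration G) ⊥ = 0 := by
  refine hdim_eq_of_tendsto _ ?_
  have : ∀ k, logCount k ((⊥ : Subgroup G).map G.subtype) = 0 := fun k => by
    rw [Subgroup.map_bot, logCount, count, Subgroup.relIndex_bot_right]; simp
  simp only [this, zero_div]
  exact tendsto_const_nhds

theorem FiltrationSeries.isClosed_bot {G : Type*} [Group G] [TopologicalSpace G]
    [IsTopologicalGroup G] (N : FiltrationSeries G) :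
    IsClosed ((⊥ : Subgroup G) : Set G) := by
  rw [← N.iInf_eq_bot, Subgroup.coe_iInf]
  exact isClosed_iInter fun i => Subgroup.isClosed_of_isOpen _ (N.isOpen i)

theorem conj_mem_map_subtype {A : Type*} [Group A] {G : Subgroup A} {H : Subgroup G}
    (hH : H.Normal) : ∀ g ∈ G, ∀ x ∈ H.map G.subtype, g * x * g⁻¹ ∈ H.map G.subtype := by
  intro g hg x hx
  obtain ⟨y, hy, rfl⟩ := Subgroup.mem_map.1 hx
  exact Subgroup.mem_map.2 ⟨⟨g, hg⟩ * y * ⟨g, hg⟩⁻¹, hH.conj_mem y hy _, rfl⟩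

/-! ### Existence of sections, and non-trivial normal subgroups -/

section Regular

variable {m : ℕ}

theorem exists_isSection (g : AutR m) (v : RVertex m) : ∃ h, IsSection g v h := by
  choose f hf using app_cat_left g v
  choose f' hf' using app_cat_left g⁻¹ (app g v)
  have h1 : ∀ u, f' (f u) = u := fun u => by
    have := hf' (f u)
    rw [← hf, app_inv_app, app_inv_app] at this
    exact (cat_right_injective v this).symm
  have h2 : ∀ u, f (f' u) = u := fun u => by
    have := congrArg (app g) (hf' u)
    rw [app_app_inv, app_inv_app, hf] at this
    exact (cat_right_injective _ this).symm
  have hcat : ∀ v u w : RVertex m, IsChild (cat v u) (cat v w) ↔ IsChild u w := fun v u w => by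
    simp only [IsChild, cat_val, List.append_assoc, List.append_right_inj]
  refine ⟨autOfPerm ⟨f, f', h1, h2⟩ (fun u w h => ?_) (fun u w h => ?_) ?_,
    isSection_iff.2 fun u => hf u⟩
  · rw [← hcat v] at h
    have := (app_isChild g _ _ _ rfl h).2
    rw [hf, hf, hcat] at this
    exact this
  · rw [← hcat (app g v)] at h
    have := (app_isChild g⁻¹ _ _ _ rfl h).2
    rw [hf', hf', hcat] at this
    exact this
  · have := congrArg level (hf (root _))
    rw [level_app, level_cat, level_cat, level_app] at this
    exact eq_root_of_level (by
      have h0 := level_root fun _ => m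
      change level (f (root _)) = 0
      omega)

/-- A non-trivial subgroup normalized by a level-transitive group contains the grafts of the
commutator subgroup of a branching subgroup at all vertices of some level. -/
theorem exists_graft_commutator_mem {G G₁ L H : Subgroup (AutR m)} (hG : IsSelfSimilar G)
    (hGt : IsLevelTransitive G) (hLG : L ≤ G) (hGG₁ : G ≤ G₁) (hL : IsBranching L)
    (hLn : ∀ g ∈ G, ∀ x ∈ L, g * x * g⁻¹ ∈ L) (hH : H ≠ ⊥)
    (hHn : ∀ g ∈ G₁, ∀ x ∈ H, g * x * g⁻¹ ∈ H) :
    ∃ n, ∀ v, level v = n → ∀ x ∈ (⁅L, L⁆ : Subgroup (AutR m)), graft v x ∈ H := by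
  obtain ⟨h, hh, v, hv⟩ := exists_moved hH
  have hgL : ∀ x ∈ L, graft v x ∈ G₁ := fun x hx => hGG₁ (hLG (isBranching_graft hL v x hx))
  -- The commutator of `graft v x` with `h` is `graft v x` times an element supported below `app h v
  -- ≠ v`. That factor commutes with `graft v y`, so a second commutator removes it.
  have key : ∀ x ∈ L, ∀ y ∈ L, graft v ⁅x, y⁆ ∈ H := by
    intro x hx y hy
    obtain ⟨s, hs⟩ := exists_isSection h v
    have hc : h * (graft v x)⁻¹ * h⁻¹ = graft (app h v) (s * x⁻¹ * s⁻¹) := by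
      rw [← map_inv, conj_graft hs]
    have hcomm : Commute (graft v y) (h * (graft v x)⁻¹ * h⁻¹) := by
      rw [hc]; exact commute_graft (level_app h v).symm (Ne.symm hv) _ _
    have h1 : ⁅graft v x, h⁆ ∈ H := by
      rw [commutatorElement_def]
      exact H.mul_mem (hHn _ (hgL x hx) h hh) (H.inv_mem hh)
    have h2 : ⁅⁅graft v x, h⁆, graft v y⁆ ∈ H := by
      rw [commutatorElement_def, mul_assoc, mul_assoc]
      refine H.mul_mem h1 ?_
      rw [← mul_assoc]
      exact hHn _ (hgL y hy) _ (H.inv_mem h1)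
    have h3 : ⁅⁅graft v x, h⁆, graft v y⁆ = graft v ⁅x, y⁆ := by
      have e1 : ⁅graft v x, h⁆ = graft v x * (h * (graft v x)⁻¹ * h⁻¹) := by
        rw [commutatorElement_def]; group
      rw [e1, map_commutatorElement]
      generalize h * (graft v x)⁻¹ * h⁻¹ = d at hcomm
      simp only [commutatorElement_def]
      calc graft v x * d * graft v y * (graft v x * d)⁻¹ * (graft v y)⁻¹
          = graft v x * (d * graft v y) * d⁻¹ * (graft v x)⁻¹ * (graft v y)⁻¹ := by group
        _ = _ := by rw [← hcomm.eq]; group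
    rwa [h3] at h2
  refine ⟨level v, fun u hu => ?_⟩
  obtain ⟨g, hg, rfl⟩ := hGt v u hu.symm
  obtain ⟨s, hsG, hs⟩ := hG g hg v
  have hle : (⁅L, L⁆ : Subgroup (AutR m)) ≤ H.comap (graft (app g v)) := by
    refine Subgroup.commutator_le.2 fun x hx y hy => ?_
    -- Transporting a graft from `v` to `app g v` conjugates it by the section `s`; conjugating
    -- beforehand by `s⁻¹`, which preserves `L`, compensates.
    have hLn' : ∀ x ∈ L, s⁻¹ * x * s ∈ L := fun x hx => by
      have := hLn s⁻¹ (G.inv_mem hsG) x hx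
      rwa [inv_inv] at this
    have h1 := hHn g (hGG₁ hg) _ (key _ (hLn' x hx) _ (hLn' y hy))
    rw [conj_graft hs] at h1
    have e : ⁅x, y⁆ = s * ⁅s⁻¹ * x * s, s⁻¹ * y * s⁆ * s⁻¹ := by
      simp only [commutatorElement_def]; group
    rw [Subgroup.mem_comap, e]
    exact h1
  exact fun x hx => hle hx

/-! ### Subgroups of prescribed dimension -/

/-- The value of a word as a number in base `m`. -/
def val (w : RVertex m) : ℕ := Nat.ofDigits m w.1.reverse

theorem val_cat (v u : RVertex m) : val (cat v u) = m ^ level u * val v + val u := by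
  rw [val, cat_val, List.reverse_append, Nat.ofDigits_append, List.length_reverse, add_comm]; rfl

theorem val_lt (hm : 2 ≤ m) (w : RVertex m) : val w < m ^ level w := by
  have := Nat.ofDigits_lt_base_pow_length (b := m) (l := w.1.reverse) hm
    fun x hx => (valid_iff m _).1 w.2 x (List.mem_reverse.1 hx)
  rwa [List.length_reverse] at this

theorem val_injective (hm : 2 ≤ m) (n : ℕ) :
    Function.Injective fun v : RLevel m n => val v.1 := by
  intro v w h
  refine Subtype.ext (Subtype.ext (List.reverse_injective ?_))
  refine Nat.ofDigits_inj_of_len_eq (b := m) hm ?_ (fun x hx => ?_) (fun x hx => ?_) h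
  · rw [List.length_reverse, List.length_reverse]
    exact v.2.trans w.2.symm
  · exact (valid_iff m _).1 v.1.2 x (List.mem_reverse.1 hx)
  · exact (valid_iff m _).1 w.1.2 x (List.mem_reverse.1 hx)

theorem exists_val_eq (hm : 2 ≤ m) {n i : ℕ} (hi : i < m ^ n) : ∃ v : RLevel m n, val v.1 = i := by
  let f : RLevel m n → Fin (m ^ n) := fun v => ⟨val v.1, by
    have := val_lt hm v.1; rwa [v.2] at this⟩
  have hf : Function.Injective f := fun v w h => val_injective hm n (congrArg Fin.val h)
  have hb := (Nat.bijective_iff_injective_and_card f).2 ⟨hf, by rw [card_level, Nat.card_fin]⟩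
  obtain ⟨v, hv⟩ := hb.2 ⟨i, hi⟩
  exact ⟨v, congrArg Fin.val hv⟩

/-- The elements of `G` that fix all vertices whose `m`-adic interval is not contained in
`[0, α]`. -/
def intervalSubgroup (G : Subgroup (AutR m)) (α : ℝ) : Subgroup (AutR m) where
  carrier := {g | g ∈ G ∧ ∀ w : RVertex m, α * (m : ℝ) ^ level w < val w + 1 → app g w = w}
  one_mem' := ⟨G.one_mem, fun _ _ => rfl⟩
  mul_mem' {g h} hg hh := ⟨G.mul_mem hg.1 hh.1, fun w hw => by
    rw [app_mul, hh.2 w hw, hg.2 w hw]⟩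
  inv_mem' {g} hg := ⟨G.inv_mem hg.1, fun w hw => by
    conv_lhs => rw [← hg.2 w hw]
    exact app_inv_app g w⟩

theorem intervalSubgroup_le (G : Subgroup (AutR m)) (α : ℝ) : intervalSubgroup G α ≤ G :=
  fun _ hg => hg.1

theorem isClosed_intervalSubgroup {G : Subgroup (AutR m)} (hG : IsClosed (G : Set (AutR m)))
    (α : ℝ) : IsClosed (intervalSubgroup G α : Set (AutR m)) := by
  have hGc : G.topologicalClosure = G :=
    SetLike.coe_injective (by rw [Subgroup.topologicalClosure_coe, hG.closure_eq])
  suffices h : (intervalSubgroup G α).topologicalClosure ≤ intervalSubgroup G α by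
    rw [← le_antisymm h (Subgroup.le_topologicalClosure _)]
    exact Subgroup.isClosed_topologicalClosure _
  intro g hg
  have hg' := (mem_topologicalClosure_iff _ _).1 hg
  refine ⟨?_, fun w hw => ?_⟩
  · rw [← hGc]
    exact (mem_topologicalClosure_iff _ _).2 fun k => by
      obtain ⟨x, hx, hgx⟩ := hg' k
      exact ⟨x, hx.1, hgx⟩
  · obtain ⟨x, hx, hgx⟩ := hg' (level w)
    rw [hgx w le_rfl, hx.2 w hw]

/-- The interval of a vertex below `v` lies in that of `v`, hence in `[0, α]`, so a graft at `v`
moves no vertex that has to be fixed. -/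
theorem graft_mem_intervalSubgroup {G L : Subgroup (AutR m)} {α : ℝ} (hm : 2 ≤ m) (hLG : L ≤ G)
    (hL : IsBranching L) {v : RVertex m} (hv : (val v : ℝ) + 1 ≤ α * (m : ℝ) ^ level v)
    {x : AutR m} (hx : x ∈ L) : graft v x ∈ intervalSubgroup G α := by
  refine ⟨hLG (isBranching_graft hL v x hx), fun w hw => ?_⟩
  by_cases hb : IsBelow v w
  · obtain ⟨u, rfl⟩ := isBelow_iff.1 hb
    exfalso
    rw [level_cat, val_cat, pow_add] at hw
    have h1 : (val u : ℝ) + 1 ≤ (m : ℝ) ^ level u := by exact_mod_cast val_lt hm u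
    have h2 : ((val v : ℝ) + 1) * (m : ℝ) ^ level u ≤
        α * (m : ℝ) ^ level v * (m : ℝ) ^ level u := by gcongr
    push_cast at hw
    nlinarith
  · exact graft_of_not_isBelow x hb

theorem app_eq_of_mem_intervalSubgroup {G : Subgroup (AutR m)} {α : ℝ} {g : AutR m}
    (hg : g ∈ intervalSubgroup G α) {v : RVertex m} (hv : α * (m : ℝ) ^ level v ≤ val v)
    (u : RVertex m) : app g (cat v u) = cat v u := by
  refine hg.2 _ ?_
  rw [level_cat, val_cat, pow_add]
  have h2 : α * (m : ℝ) ^ level v * (m : ℝ) ^ level u ≤ (val v : ℝ) * (m : ℝ) ^ level u := by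
    gcongr
  push_cast
  have h3 : (0 : ℝ) ≤ val u := Nat.cast_nonneg _
  nlinarith

/-- The first `⌊α m ^ n⌋` vertices of level `n` have intervals inside `[0, α]` and each carries a
copy of `L`. -/
theorem le_logCount_intervalSubgroup {G L : Subgroup (AutR m)} {α : ℝ} (hm : 2 ≤ m)
    (hα0 : 0 ≤ α) (hα : α ≤ 1) (hLG : L ≤ G) (hL : IsBranching L) (n k : ℕ) :
    (α * (m : ℝ) ^ n - 1) * logCount k L ≤ logCount (n + k) (intervalSubgroup G α) := by
  classical
  have := Fintype.ofFinite (RLevel m n)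
  set N := ⌊α * (m : ℝ) ^ n⌋₊ with hN
  have hNle : (N : ℝ) ≤ α * (m : ℝ) ^ n := Nat.floor_le (by positivity)
  have hNm : N ≤ m ^ n := by
    have : (N : ℝ) ≤ (m : ℝ) ^ n := hNle.trans (mul_le_of_le_one_left (by positivity) hα)
    exact_mod_cast this
  have h1 := mul_logCount_le (k := k) (M := L) (J := intervalSubgroup G α)
    (Finset.univ.filter fun v : RLevel m n => val v.1 < N) fun v hv x hx => by
      refine graft_mem_intervalSubgroup hm hLG hL ?_ hx
      rw [v.2]
      refine le_trans ?_ hNle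
      exact_mod_cast (Finset.mem_filter.1 hv).2
  refine le_trans ?_ h1
  refine mul_le_mul_of_nonneg_right ?_ (logCount_nonneg _ _)
  have hcard : N ≤ (Finset.univ.filter fun v : RLevel m n => val v.1 < N).card := by
    calc N = (Finset.range N).card := (Finset.card_range N).symm
      _ ≤ ((Finset.univ.filter fun v : RLevel m n => val v.1 < N).image
            fun v => val v.1).card := by
          refine Finset.card_le_card fun i hi => ?_
          have hi := Finset.mem_range.1 hi
          obtain ⟨v, hv⟩ := exists_val_eq hm (hi.trans_le hNm)
          exact Finset.mem_image.2 ⟨v, by simp [hv, hi], hv⟩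
      _ ≤ _ := Finset.card_image_le
  have h2 : α * (m : ℝ) ^ n < N + 1 := Nat.lt_floor_add_one _
  have h3 : (N : ℝ) ≤ (Finset.univ.filter fun v : RLevel m n => val v.1 < N).card := by
    exact_mod_cast hcard
  linarith

/-- Beyond the first `⌈α m ^ n⌉` vertices of level `n` everything is fixed, so an element of `St n`
in the subgroup is determined by its sections at those. -/
theorem logCount_intervalSubgroup_le {G : Subgroup (AutR m)} {α : ℝ} (hm : 2 ≤ m)
    (hα0 : 0 ≤ α) (hG : IsSelfSimilar G) (n k : ℕ) :
    logCount (n + k) (intervalSubgroup G α) ≤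
      logCount n G + (α * (m : ℝ) ^ n + 1) * logCount k G := by
  classical
  have := Fintype.ofFinite (RLevel m n)
  set H := intervalSubgroup G α
  set N := ⌈α * (m : ℝ) ^ n⌉₊ with hN
  set R := Finset.univ.filter fun v : RLevel m n => val v.1 < N with hR
  have h1 := count_le_pow hG (H := H ⊓ St _ n) (inf_le_left.trans (intervalSubgroup_le G α))
    (k := k) R inf_le_right fun x hx hxR w hw => by
      rcases le_total (level w) n with h | h
      · exact hx.2 w h
      · obtain ⟨v, u, hv, rfl⟩ := exists_cat_of_le h
        rw [level_cat] at hw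
        by_cases hvN : val v < N
        · exact hxR ⟨v, hv⟩ (by simp [hR, hvN]) u (by omega)
        · refine app_eq_of_mem_intervalSubgroup hx.1 ?_ u
          rw [hv]
          refine (Nat.le_ceil _).trans ?_
          exact Nat.cast_le.2 (not_lt.1 hvN)
  have hcard : R.card ≤ N := by
    rw [← Finset.card_range N]
    refine Finset.card_le_card_of_injOn (fun v => val v.1) (fun v hv => ?_)
      (val_injective hm n).injOn
    have := (Finset.mem_filter.1 hv).2
    simpa using this
  have h2 : count (n + k) H ≤ count k G ^ N * count n G := by
    rw [count_tower (Nat.le_add_right n k) H]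
    exact Nat.mul_le_mul (h1.trans (Nat.pow_le_pow_right (count_pos k G) hcard))
      (count_mono n (intervalSubgroup_le G α))
  have h3 := Real.log_le_log (by exact_mod_cast count_pos _ _)
    (by exact_mod_cast h2 : (count (n + k) H : ℝ) ≤ (count k G : ℝ) ^ N * count n G)
  rw [Real.log_mul (by have := count_pos k G; positivity)
    (by exact_mod_cast (count_pos _ _).ne'), Real.log_pow] at h3
  have h4 : (N : ℝ) < α * (m : ℝ) ^ n + 1 := Nat.ceil_lt_add_one (by positivity)
  have h5 : N * logCount k G ≤ (α * (m : ℝ) ^ n + 1) * logCount k G :=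
    mul_le_mul_of_nonneg_right h4.le (logCount_nonneg _ _)
  change logCount _ _ ≤ N * logCount k G + logCount n G at h3
  linarith

/-- There are three errors, each at most a third of the total: the ball of radius `n`, the one
vertex of level `n` cut by `α`, and the gap between `G` and `L`. The level `n` is chosen so that a
single vertex is negligible. -/
theorem abs_logCount_intervalSubgroup_le {G G₁ L : Subgroup (AutR m)} {α : ℝ} (hα0 : 0 ≤ α)
    (hα : α ≤ 1) (hG : IsSelfSimilar G) (hLG : L ≤ G) (hGG₁ : G ≤ G₁) (hG₁s : IsSelfSimilar G₁)
    (hG₁ : ∀ k, count k G₁ = count k G) (hL : IsBranching L) (hL1 : L ≠ ⊥) (hfull : IsFull G L)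
    {ε : ℝ} (hε : 0 < ε) : ∀ᶠ k in atTop,
      |α * logCount k G - logCount k (intervalSubgroup G₁ α)| ≤ ε * (m : ℝ) ^ k := by
  have hm := two_le_of_ne_bot hL1
  have hm1 : (1 : ℝ) < m := by exact_mod_cast hm
  have hG₁' : ∀ k, logCount k G₁ = logCount k G := fun k => by rw [logCount, hG₁]; rfl
  obtain ⟨C, hC, hGC⟩ := exists_logCount_le hG hm
  obtain ⟨n, hn⟩ := (eventually_le_mul_pow hm C (show 0 < ε / 3 by positivity)).exists
  refine eventually_of_add n ?_
  filter_upwards [hfull (ε / 3) (by positivity),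
    eventually_add n (eventually_le_mul_pow hm (logCount n G) (show 0 < ε / 3 by positivity))]
    with k h1 h2
  have hpn : (0 : ℝ) < (m : ℝ) ^ n := by positivity
  have hpk : (0 : ℝ) < (m : ℝ) ^ k := by positivity
  have hlow := le_logCount_intervalSubgroup hm hα0 hα (hLG.trans hGG₁) hL n k
  have hup := logCount_intervalSubgroup_le hm hα0 hG₁s n k
  rw [hG₁', hG₁'] at hup
  have hg1 := logCount_add_le hG n k
  have hg2 := pow_mul_logCount_le (k := k) (n := n) (M := L) (J := G)
    fun v _ x hx => hLG (isBranching_graft hL v x hx)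
  have hLG' := logCount_mono k hLG
  have hGk : logCount k G ≤ ε / 3 * (m : ℝ) ^ (n + k) := by
    rw [pow_add, ← mul_assoc]
    exact (hGC k).trans (by gcongr)
  have hd : α * (m : ℝ) ^ n * (logCount k G - logCount k L) ≤ ε / 3 * (m : ℝ) ^ (n + k) := by
    calc α * (m : ℝ) ^ n * (logCount k G - logCount k L)
        ≤ 1 * (m : ℝ) ^ n * (ε / 3 * (m : ℝ) ^ k) := by
          gcongr
      _ = _ := by rw [pow_add]; ring
  have hα1 : α * logCount (n + k) G ≤ α * (logCount n G + (m : ℝ) ^ n * logCount k G) := by gcongr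
  have hα2 : α * ((m : ℝ) ^ n * logCount k L) ≤ α * logCount (n + k) G := by gcongr
  have hα3 : α * logCount n G ≤ logCount n G := mul_le_of_le_one_left (logCount_nonneg _ _) hα
  rw [abs_le]
  constructor <;> nlinarith

theorem isSelfSimilar_topologicalClosure {G : Subgroup (AutR m)} (hG : IsSelfSimilar G) :
    IsSelfSimilar G.topologicalClosure := by
  intro g hg v
  obtain ⟨h, hh⟩ := exists_isSection g v
  refine ⟨h, (mem_topologicalClosure_iff _ _).2 fun k => ?_, hh⟩
  obtain ⟨x, hx, hgx⟩ := (mem_topologicalClosure_iff _ _).1 hg (level v + k)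
  obtain ⟨s, hs, hxs⟩ := hG x hx v
  refine ⟨s, hs, fun u hu => cat_right_injective (app g v) ?_⟩
  rw [← isSection_app_eq hh, hgx _ (by rw [level_cat]; omega), hgx v (by omega),
    isSection_app_eq hxs]

theorem spectra_topologicalClosure {G L : Subgroup (AutR m)} (hG : IsSelfSimilar G)
    (hGt : IsLevelTransitive G) (hLG : L ≤ G) (hL : IsBranching L) (hL1 : L ≠ ⊥)
    (hLn : ∀ g ∈ G, ∀ x ∈ L, g * x * g⁻¹ ∈ L) (hfull : IsFull G L) :
    hspec (levelFiltration G.topologicalClosure) = Set.Icc 0 1 ∧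
      normalHspec (levelFiltration G.topologicalClosure) = {0, 1} := by
  have hm := two_le_of_ne_bot hL1
  obtain ⟨c, hc, hcL⟩ := exists_le_logCount hL hL1
  have hcG : ∀ᶠ k in atTop, c * (m : ℝ) ^ k ≤ logCount k G :=
    hcL.mono fun k hk => hk.trans (logCount_mono k hLG)
  set G₁ := G.topologicalClosure
  have hGG₁ : G ≤ G₁ := G.le_topologicalClosure
  have hG₁ : ∀ k, count k G₁ = count k G := fun k => count_topologicalClosure k G
  have hG₁' : ∀ k, logCount k G₁ = logCount k G := fun k => by rw [logCount, hG₁]; rfl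
  constructor
  · refine Set.Subset.antisymm ?_ ?_
    · rintro _ ⟨H, -, rfl⟩
      exact hdim_mem_Icc _ H
    · rintro α ⟨hα0, hα1⟩
      refine ⟨(intervalSubgroup G₁ α).subgroupOf G₁, ?_, hdim_eq_of_tendsto _ ?_⟩
      · exact (isClosed_intervalSubgroup G.isClosed_topologicalClosure α).preimage
          continuous_subtype_val
      · rw [Subgroup.map_subgroupOf_eq_of_le (intervalSubgroup_le G₁ α)]
        simp only [hG₁']
        exact tendsto_div_of_abs_sub_le hm hc hcG fun ε hε =>
          abs_logCount_intervalSubgroup_le hα0 hα1 hG hLG hGG₁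
            (isSelfSimilar_topologicalClosure hG) hG₁ hL hL1 hfull hε
  · refine Set.Subset.antisymm ?_ ?_
    · rintro _ ⟨H, -, hHn, rfl⟩
      by_cases hH : H = ⊥
      · left; rw [hH]; exact hdim_bot _
      · right
        have hH1 : H.map G₁.subtype ≠ ⊥ := fun h =>
          hH ((Subgroup.map_eq_bot_iff_of_injective _ G₁.subtype_injective).1 h)
        obtain ⟨n, hn⟩ := exists_graft_commutator_mem (G₁ := G₁) (H := H.map G₁.subtype) hG hGt
          hLG hGG₁ hL hLn hH1
          (conj_mem_map_subtype hHn)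
        exact IsFull.hdim_eq_one hm hc hcG hG₁
          ((hfull.commutator hG le_rfl hLG hL hL1).of_graft hG hm hn)
    · rintro _ (rfl | rfl)
      · exact ⟨⊥, (levelFiltration G₁).isClosed_bot, inferInstance, hdim_bot _⟩
      · refine ⟨⊤, isClosed_univ, inferInstance, IsFull.hdim_eq_one hm hc hcG hG₁ ?_⟩
        rw [← MonoidHom.range_eq_map, Subgroup.range_subtype]
        exact (IsFull.refl G).mono hGG₁

end Regular

/-! ### Groups given by generators -/

/-- Generators that commute modulo a normalized subgroup generate a group that commutes modulo it;
the identities for commutators of products and inverses are applied in each variable. -/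
theorem commutator_le_of_closure {A : Type*} [Group A] {S : Set A} {M : Subgroup A}
    (hM : ∀ g ∈ Subgroup.closure S, ∀ x ∈ M, g * x * g⁻¹ ∈ M)
    (h : ∀ s ∈ S, ∀ t ∈ S, ⁅s, t⁆ ∈ M) : ⁅Subgroup.closure S, Subgroup.closure S⁆ ≤ M := by
  have hinv : ∀ g ∈ Subgroup.closure S, ∀ x ∈ M, g⁻¹ * x * g ∈ M := fun g hg x hx => by
    have := hM g⁻¹ (inv_mem hg) x hx
    rwa [inv_inv] at this
  have h1 : ∀ s ∈ S, ∀ y ∈ Subgroup.closure S, ⁅s, y⁆ ∈ M := by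
    intro s hs y hy
    induction hy using Subgroup.closure_induction with
    | mem t ht => exact h s hs t ht
    | one => rw [commutatorElement_one_right]; exact M.one_mem
    | mul y z hy _ ihy ihz =>
      rw [show ⁅s, y * z⁆ = ⁅s, y⁆ * (y * ⁅s, z⁆ * y⁻¹) by simp only [commutatorElement_def]; group]
      exact M.mul_mem ihy (hM y hy _ ihz)
    | inv y hy ih =>
      rw [show ⁅s, y⁻¹⁆ = y⁻¹ * ⁅s, y⁆⁻¹ * y by simp only [commutatorElement_def]; group]
      exact hinv y hy _ (M.inv_mem ih)
  refine Subgroup.commutator_le.2 fun x hx y hy => ?_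
  induction hx using Subgroup.closure_induction with
  | mem s hs => exact h1 s hs y hy
  | one => rw [commutatorElement_one_left]; exact M.one_mem
  | mul x z hx _ ihx ihz =>
    rw [show ⁅x * z, y⁆ = (x * ⁅z, y⁆ * x⁻¹) * ⁅x, y⁆ by simp only [commutatorElement_def]; group]
    exact M.mul_mem (hM x hx _ ihz) ihx
  | inv x hx ih =>
    rw [show ⁅x⁻¹, y⁆ = x⁻¹ * ⁅x, y⁆⁻¹ * x by simp only [commutatorElement_def]; group]
    exact hinv x hx _ (M.inv_mem ih)

theorem conj_mem_commutator {A : Type*} [Group A] {K : Subgroup A} {g : A}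
    (hg : ∀ x ∈ K, g * x * g⁻¹ ∈ K) {x : A} (hx : x ∈ (⁅K, K⁆ : Subgroup A)) :
    g * x * g⁻¹ ∈ (⁅K, K⁆ : Subgroup A) := by
  have h1 : K.map (MulAut.conj g).toMonoidHom ≤ K := by
    rintro _ ⟨y, hy, rfl⟩
    exact hg y hy
  have h2 := Subgroup.mem_map_of_mem (MulAut.conj g).toMonoidHom hx
  rw [Subgroup.map_commutator] at h2
  exact Subgroup.commutator_mono h1 h1 h2

section Regular

variable {m : ℕ}

theorem isSelfSimilar_of_level_one {G : Subgroup (AutR m)}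
    (h : ∀ g ∈ G, ∀ v, level v = 1 → ∃ s ∈ G, IsSection g v s) : IsSelfSimilar G := by
  intro g hg v
  induction hn : level v generalizing v with
  | zero => exact ⟨g, hg, by rw [eq_root_of_level hn]; exact IsSection.root g⟩
  | succ n ih =>
    obtain ⟨u, w, hu, hw, rfl⟩ := exists_cat hn
    obtain ⟨s, hs, hgs⟩ := ih u hu
    obtain ⟨t, ht, hst⟩ := h s hs w hw
    exact ⟨t, ht, hgs.comp hst⟩

theorem isSelfSimilar_closure {S : Set (AutR m)}
    (h : ∀ s ∈ S, ∀ v, level v = 1 → ∃ t ∈ Subgroup.closure S, IsSection s v t) :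
    IsSelfSimilar (Subgroup.closure S) := by
  refine isSelfSimilar_of_level_one fun g hg => ?_
  induction hg using Subgroup.closure_induction with
  | mem s hs => exact h s hs
  | one => exact fun v _ => ⟨1, one_mem _, IsSection.one v⟩
  | mul x y _ _ ihx ihy =>
    intro v hv
    obtain ⟨t, ht, hyt⟩ := ihy v hv
    obtain ⟨s, hs, hxs⟩ := ihx (app y v) (by rw [level_app, hv])
    exact ⟨s * t, mul_mem hs ht, hxs.mul hyt⟩
  | inv x _ ih =>
    intro v hv
    obtain ⟨s, hs, hxs⟩ := ih (app x⁻¹ v) (by rw [level_app, hv])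
    have := hxs.inv
    rw [app_app_inv] at this
    exact ⟨s⁻¹, inv_mem hs, this⟩

/-- Every element of `G` is the section at `v` of an element of `G` that fixes `v`. -/
def IsFractalAt (G : Subgroup (AutR m)) (v : RVertex m) : Prop :=
  ∀ h ∈ G, ∃ g ∈ G, app g v = v ∧ IsSection g v h

theorem isFractalAt_closure {S : Set (AutR m)} {v : RVertex m}
    (h : ∀ s ∈ S, ∃ g ∈ Subgroup.closure S, app g v = v ∧ IsSection g v s) :
    IsFractalAt (Subgroup.closure S) v := by
  intro x hx
  induction hx using Subgroup.closure_induction with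
  | mem s hs => exact h s hs
  | one => exact ⟨1, one_mem _, rfl, IsSection.one v⟩
  | mul x y _ _ ihx ihy =>
    obtain ⟨g, hg, hgv, hgx⟩ := ihx
    obtain ⟨k, hk, hkv, hky⟩ := ihy
    exact ⟨g * k, mul_mem hg hk, by rw [app_mul, hkv, hgv],
      IsSection.mul (by rwa [hkv]) hky⟩
  | inv x _ ih =>
    obtain ⟨g, hg, hgv, hgx⟩ := ih
    have := hgx.inv
    rw [hgv] at this
    exact ⟨g⁻¹, inv_mem hg, by conv_lhs => rw [← hgv, app_inv_app], this⟩

/-- The orbit of the repeated word `v v ⋯ v` is the whole level: `ht` adjusts the first letter, and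
an element fixing `v` with prescribed section adjusts the tail. -/
theorem isLevelTransitive_of_isFractalAt {G : Subgroup (AutR m)} {v : RVertex m}
    (hG : IsFractalAt G v) (ht : ∀ w, level w = 1 → ∃ g ∈ G, app g v = w) :
    IsLevelTransitive G := by
  have key : ∀ n, ∃ b : RVertex m, ∀ w, level w = n → ∃ g ∈ G, app g b = w := by
    intro n
    induction n with
    | zero => exact ⟨root _, fun w hw => ⟨1, one_mem _, (eq_root_of_level hw).symm⟩⟩
    | succ n ih =>
      obtain ⟨b, hb⟩ := ih
      refine ⟨cat v b, fun w hw => ?_⟩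
      obtain ⟨x, u, hx, hu, rfl⟩ := exists_cat (show level w = 1 + n by omega)
      obtain ⟨g, hg, rfl⟩ := ht x hx
      obtain ⟨u', hu'⟩ := app_cat_left g⁻¹ (app g v) u
      rw [app_inv_app] at hu'
      have hl := congrArg level hu'
      rw [level_app, level_cat, level_cat, level_app] at hl
      obtain ⟨h, hh, hhb⟩ := hb u' (by omega)
      obtain ⟨k, hk, hkv, hkh⟩ := hG h hh
      refine ⟨g * k, mul_mem hg hk, ?_⟩
      rw [app_mul, isSection_app_eq hkh, hkv, hhb, ← hu', app_app_inv]
  intro u w huw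
  obtain ⟨b, hb⟩ := key (level u)
  obtain ⟨g, hg, hgu⟩ := hb u rfl
  obtain ⟨k, hk, hkw⟩ := hb w huw.symm
  exact ⟨k * g⁻¹, mul_mem hk (inv_mem hg), by rw [app_mul, ← hgu, app_inv_app, hkw]⟩

/-- Each `g ∈ G` is a section at `v` of an element of `G` fixing `v`, and conjugating a graft at `v`
by that element conjugates its argument by `g`. This allows commutators of generators to be tested
alone. -/
theorem IsFractalAt.conj_mem_comap_graft {G L : Subgroup (AutR m)} {v : RVertex m}
    (hG : IsFractalAt G v) (hLn : ∀ g ∈ G, ∀ x ∈ L, g * x * g⁻¹ ∈ L) :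
    ∀ g ∈ G, ∀ x ∈ L.comap (graft v), g * x * g⁻¹ ∈ L.comap (graft v) := by
  intro g hg x hx
  obtain ⟨k, hk, hkv, hks⟩ := hG g hg
  have := hLn k hk _ hx
  rwa [conj_graft hks, hkv] at this

theorem isBranching_of_graft {L : Subgroup (AutR m)}
    (h : ∀ v, level v = 1 → ∀ x ∈ L, graft v x ∈ L) : IsBranching L := by
  classical
  have := Fintype.ofFinite (RLevel m 1)
  intro f
  obtain ⟨g, hg, hgS, hgs, -⟩ := exists_of_graft_mem L (Finset.univ : Finset (RLevel m 1))
    (fun v => (f v).1) fun v _ => h v.1 v.2 _ (f v).2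
  exact ⟨g, ⟨hg, hgS⟩, fun v => hgs v (Finset.mem_univ v)⟩

theorem isBranching_of_graft_at {G L : Subgroup (AutR m)} (hG : IsSelfSimilar G) {v : RVertex m}
    (ht : ∀ w, level w = 1 → ∃ g ∈ G, app g v = w)
    (hLn : ∀ g ∈ G, ∀ x ∈ L, g * x * g⁻¹ ∈ L) (h : ∀ x ∈ L, graft v x ∈ L) : IsBranching L := by
  refine isBranching_of_graft fun w hw x hx => ?_
  obtain ⟨g, hg, rfl⟩ := ht w hw
  obtain ⟨s, hs, hgs⟩ := hG g hg v
  have h1 := hLn s⁻¹ (inv_mem hs) x hx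
  have h2 := hLn g hg _ (h _ h1)
  rw [conj_graft hgs] at h2
  convert h2 using 2
  group

/-- Two derived steps from `G` are full, the second because `L ≤ G'` supplies the element with few
cycles inside `G'`. Hence `L`, which contains `G''`, is full. -/
theorem spectra_of_generators {S : Set (AutR m)} {L : Subgroup (AutR m)} {v : RVertex m}
    (hS : ∀ s ∈ S, ∀ w, level w = 1 → ∃ t ∈ Subgroup.closure S, IsSection s w t)
    (ht : ∀ w, level w = 1 → ∃ g ∈ Subgroup.closure S, app g v = w)
    (hf : IsFractalAt (Subgroup.closure S) v)
    (hLn : ∀ g ∈ Subgroup.closure S, ∀ x ∈ L, g * x * g⁻¹ ∈ L) (hL1 : L ≠ ⊥)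
    (hLv : ∀ x ∈ L, graft v x ∈ L) (hLG : L ≤ ⁅Subgroup.closure S, Subgroup.closure S⁆)
    (hL : ⁅⁅Subgroup.closure S, Subgroup.closure S⁆, ⁅Subgroup.closure S, Subgroup.closure S⁆⁆ ≤
      L) :
    hspec (levelFiltration (Subgroup.closure S).topologicalClosure) = Set.Icc 0 1 ∧
      normalHspec (levelFiltration (Subgroup.closure S).topologicalClosure) = {0, 1} := by
  set G := Subgroup.closure S
  have hG : IsSelfSimilar G := isSelfSimilar_closure hS
  have hLb : IsBranching L := isBranching_of_graft_at hG ht hLn hLv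
  have hG' : ⁅G, G⁆ ≤ G := Subgroup.commutator_le_self G
  have h1 : IsFull G ⁅G, G⁆ :=
    (IsFull.refl G).commutator hG (hLG.trans hG') le_rfl hLb hL1
  exact spectra_topologicalClosure hG (isLevelTransitive_of_isFractalAt hf ht)
    (hLG.trans hG') hLb hL1 hLn ((h1.commutator hG hLG hG' hLb hL1).mono hL)

/-- The criterion for a group that is generated by two elements and branches over its commutator
subgroup. -/
theorem spectra_of_two_generators {a b : AutR m} {v : RVertex m}
    (hS : ∀ s ∈ ({a, b} : Set (AutR m)), ∀ w, level w = 1 →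
      ∃ t ∈ Subgroup.closure {a, b}, IsSection s w t)
    (ht : ∀ w, level w = 1 → ∃ g ∈ Subgroup.closure {a, b}, app g v = w)
    (hf : IsFractalAt (Subgroup.closure {a, b}) v) (hab : a * b ≠ b * a)
    (h : graft v ⁅a, b⁆ ∈ ⁅Subgroup.closure {a, b}, Subgroup.closure {a, b}⁆) :
    hspec (levelFiltration (Subgroup.closure {a, b}).topologicalClosure) = Set.Icc 0 1 ∧
      normalHspec (levelFiltration (Subgroup.closure {a, b}).topologicalClosure) = {0, 1} := by
  set G := Subgroup.closure ({a, b} : Set (AutR m))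
  have haG : a ∈ G := Subgroup.subset_closure (by simp)
  have hbG : b ∈ G := Subgroup.subset_closure (by simp)
  have hn : ∀ g ∈ G, ∀ x ∈ (⁅G, G⁆ : Subgroup (AutR m)), g * x * g⁻¹ ∈
      (⁅G, G⁆ : Subgroup (AutR m)) := fun g hg x hx =>
    conj_mem_commutator (fun y hy => mul_mem (mul_mem hg hy) (inv_mem hg)) hx
  refine spectra_of_generators hS ht hf hn (fun h0 => hab ?_) ?_ le_rfl
    (Subgroup.commutator_le_self _)
  · have : ⁅a, b⁆ ∈ (⁅G, G⁆ : Subgroup (AutR m)) := Subgroup.commutator_mem_commutator haG hbG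
    rw [h0, Subgroup.mem_bot] at this
    exact commutatorElement_eq_one_iff_mul_comm.1 this
  -- The elements whose graft at `v` lies in `G'` form a subgroup normalized by `G`, so the
  -- commutator of the two generators decides.
  · refine commutator_le_of_closure (hf.conj_mem_comap_graft hn) ?_
    rintro s (rfl | rfl) t (rfl | rfl)
    · rw [commutatorElement_self]; exact one_mem _
    · exact h
    · rw [← commutatorElement_inv]; exact inv_mem (Subgroup.mem_comap.2 h)
    · rw [commutatorElement_self]; exact one_mem _

/-! ### Letters -/

/-- The vertex of level one given by a letter. -/
def letter (x : Fin m) : RVertex m := ⟨[x], (valid_iff m _).2 fun y hy => by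
  rw [List.mem_singleton.1 hy]; exact x.2⟩

theorem level_letter (x : Fin m) : level (letter x) = 1 := rfl

theorem level_letter_eq (x y : Fin m) : level (letter x) = level (letter y) := rfl

theorem letter_injective : Function.Injective (letter (m := m)) := fun x y h => by
  have := congrArg Subtype.val h
  exact Fin.ext (by simpa [letter] using this)

theorem exists_letter {v : RVertex m} (hv : level v = 1) : ∃ x, v = letter x := by
  obtain ⟨a, ha⟩ := List.length_eq_one_iff.1 hv
  refine ⟨⟨a, (valid_iff m _).1 v.2 a (by rw [ha]; simp)⟩, Subtype.ext ha⟩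

theorem ext_letters {g h : AutR m} (H : ∀ x : Fin m, app g (letter x) = app h (letter x) ∧
    ∃ s, IsSection g (letter x) s ∧ IsSection h (letter x) s) : g = h := by
  refine app_ext fun v => ?_
  rcases Nat.eq_zero_or_pos (level v) with h0 | h0
  · rw [eq_root_of_level h0, app_root, app_root]
  · obtain ⟨v, u, hv, rfl⟩ := exists_cat_of_le h0
    obtain ⟨x, rfl⟩ := exists_letter hv
    obtain ⟨h1, s, h2, h3⟩ := H x
    rw [isSection_app_eq h2, isSection_app_eq h3, h1]

section Spin

variable {Q : Type*} {r : Q → ℕ} {δ : Q → ℕ → Q}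

theorem spinAut_letter (q : Q) (x : Fin m) :
    app (spinAut m r δ q) (letter x) =
      letter ⟨(x + r q) % m, Nat.mod_lt _ (Nat.zero_lt_of_lt x.2)⟩ := rfl

theorem spinAut_isSection (q : Q) (x : Fin m) :
    IsSection (spinAut m r δ q) (letter x) (spinAut m r δ (δ q x)) :=
  isSection_iff.2 fun _ => rfl

theorem spinAut_eq_one {e : Q} (hr : r e = 0) (hδ : ∀ x, δ e x = e) : spinAut m r δ e = 1 := by
  refine app_ext fun v => Subtype.ext ?_
  change spin m r δ e v.1 = v.1
  have h := (valid_iff m _).1 v.2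
  generalize v.1 = w at h
  induction w with
  | nil => rfl
  | cons x u ih =>
    rw [spin, hr, hδ, ih fun y hy => h y (by simp [hy]), add_zero,
      Nat.mod_eq_of_lt (h x (by simp))]

end Spin

theorem IsSection.zpow {g h : AutR m} {v : RVertex m} (H : IsSection g v h) (hv : app g v = v)
    (j : ℤ) : IsSection (g ^ j) v (h ^ j) := by
  have hn : ∀ n : ℕ, app (g ^ n) v = v ∧ IsSection (g ^ n) v (h ^ n) := by
    intro n
    induction n with
    | zero => exact ⟨rfl, by rw [pow_zero, pow_zero]; exact IsSection.one v⟩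
    | succ n ih =>
      refine ⟨by rw [pow_succ, app_mul, hv, ih.1], ?_⟩
      rw [pow_succ, pow_succ]
      exact IsSection.mul (by rw [hv]; exact ih.2) H
  obtain ⟨n, rfl | rfl⟩ := j.eq_nat_or_neg
  · rw [zpow_natCast, zpow_natCast]; exact (hn n).2
  · rw [zpow_neg, zpow_neg, zpow_natCast, zpow_natCast]
    have := (hn n).2.inv
    rwa [(hn n).1] at this

theorem app_zpow_eq_self {g : AutR m} {v : RVertex m} (hv : app g v = v) (j : ℤ) :
    app (g ^ j) v = v := by
  have hn : ∀ n : ℕ, app (g ^ n) v = v := by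
    intro n
    induction n with
    | zero => rfl
    | succ n ih => rw [pow_succ, app_mul, hv, ih]
  obtain ⟨n, rfl | rfl⟩ := j.eq_nat_or_neg
  · rw [zpow_natCast]; exact hn n
  · rw [zpow_neg, zpow_natCast]
    conv_lhs => rw [← hn n]
    rw [app_inv_app]

end Regular

theorem exists_letter_two {v : RVertex 2} (hv : level v = 1) : v = letter 0 ∨ v = letter 1 := by
  obtain ⟨x, rfl⟩ := exists_letter hv
  fin_cases x
  · exact Or.inl rfl
  · exact Or.inr rfl

theorem letter_zero_ne_one : (letter 0 : RVertex 2) ≠ letter 1 := fun h =>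
  absurd (letter_injective h) (by decide)

theorem ext_letters_two {g h s t : AutR 2} (h0 : app g (letter 0) = app h (letter 0))
    (h1 : app g (letter 1) = app h (letter 1)) (gs : IsSection g (letter 0) s)
    (hs : IsSection h (letter 0) s) (gt : IsSection g (letter 1) t)
    (ht : IsSection h (letter 1) t) : g = h := by
  refine ext_letters fun x => ?_
  obtain h | h := exists_letter_two (level_letter x)
  · rw [h]; exact ⟨h0, s, gs, hs⟩
  · rw [h]; exact ⟨h1, t, gt, ht⟩

/-! ### The Basilica group -/

section Basilica

local notation "bas" => spinAut 2 basilicaRot basilicaNext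

theorem basilica_e : bas .e = 1 := spinAut_eq_one rfl fun _ => rfl

theorem basilica_a_eq : bas .a = graft (letter 1) (bas .b) := by
  have h : IsSection (bas .a) (letter 0) 1 := by
    rw [← basilica_e]; exact spinAut_isSection _ _
  have h0 : app (bas .a) (letter 0) = letter 0 := rfl
  have h1 : app (bas .a) (letter 1) = letter 1 := rfl
  exact ext_letters_two (h0.trans (graft_of_level_le _ (level_letter_eq _ _).le).symm) (h1.trans (graft_self _ _).symm)
    h (graft_isSection_of_ne (level_letter_eq _ _) letter_zero_ne_one.symm _) (spinAut_isSection _ _)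
    (graft_isSection _ _)

theorem basilica_b_one : app (bas .b) (letter 1) = letter 0 := rfl

theorem basilica_b_isSection_zero : IsSection (bas .b) (letter 0) 1 := by
  rw [← basilica_e]; exact spinAut_isSection _ _

theorem basilica_b_isSection_one : IsSection (bas .b) (letter 1) (bas .a) := spinAut_isSection _ _

theorem basilica_b_sq_one : app (bas .b * bas .b) (letter 1) = letter 1 := rfl

theorem basilica_b_sq_isSection : IsSection (bas .b * bas .b) (letter 1) (bas .a) := by
  have := IsSection.mul (g := bas .b) (by rw [basilica_b_one]; exact basilica_b_isSection_zero)
    basilica_b_isSection_one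
  rwa [one_mul] at this

theorem basilica_spectra : hspec (levelFiltration basilica.topologicalClosure) = Set.Icc 0 1 ∧
    normalHspec (levelFiltration basilica.topologicalClosure) = {0, 1} := by
  have ha : bas .a ∈ basilica := Subgroup.subset_closure (by simp)
  have hb : bas .b ∈ basilica := Subgroup.subset_closure (by simp)
  refine spectra_of_two_generators (v := letter 1) ?_ ?_ (isFractalAt_closure ?_) ?_ ?_
  · rintro s (rfl | rfl) w hw <;> rcases exists_letter_two hw with rfl | rfl
    · exact ⟨1, one_mem _, by rw [← basilica_e]; exact spinAut_isSection _ _⟩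
    · exact ⟨_, hb, spinAut_isSection _ _⟩
    · exact ⟨1, one_mem _, basilica_b_isSection_zero⟩
    · exact ⟨_, ha, spinAut_isSection _ _⟩
  · intro w hw
    rcases exists_letter_two hw with rfl | rfl
    · exact ⟨_, hb, basilica_b_one⟩
    · exact ⟨1, one_mem _, rfl⟩
  · rintro s (rfl | rfl)
    · exact ⟨_, mul_mem hb hb, basilica_b_sq_one, basilica_b_sq_isSection⟩
    · exact ⟨_, ha, rfl, spinAut_isSection _ _⟩
  · intro h
    -- If `a` and `b` commuted, conjugation by `b` would move the support of `a` from below letter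
    -- `1` to below letter `0`; but `a` maps `10` to `11`.
    have h1 : bas .a = bas .b * bas .a * (bas .b)⁻¹ := by rw [← h]; group
    have h2 := conj_graft basilica_b_isSection_one (bas .b)
    rw [← basilica_a_eq, ← h1, basilica_b_one] at h2
    have h3 : app (bas .a) (cat (letter 1) (letter 0)) = cat (letter 1) (letter 0) := by
      rw [h2]; exact graft_cat_of_ne (v := letter 0) (w := letter 1) (level_letter_eq _ _) letter_zero_ne_one _ _
    have h4 : app (bas .a) (cat (letter 1) (letter 0)) = cat (letter 1) (letter 1) := rfl
    exact letter_zero_ne_one (cat_right_injective _ (h3.symm.trans h4))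
  · have h1 := conj_graft basilica_b_sq_isSection (bas .b)
    rw [basilica_b_sq_one] at h1
    -- `a` is `b` grafted at letter `1`, and `b²` fixes that letter with section `a`.
    have h2 : graft (letter 1) ⁅bas .a, bas .b⁆ = ⁅bas .b * bas .b, bas .a⁆ := by
      rw [commutatorElement_def, map_mul, ← h1, map_inv, ← basilica_a_eq,
        commutatorElement_def (bas .b * bas .b)]
    rw [h2]
    exact Subgroup.commutator_mem_commutator (mul_mem hb hb) ha

end Basilica

/-! ### The Brunner-Sidki-Vieira group -/

section BSV

local notation "bsv" => spinAut 2 bsvRot bsvNext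

theorem bsv_e : bsv .e = 1 := spinAut_eq_one rfl fun x => by cases x <;> rfl

/-- Each of the two products of `mu` and `muInv` has the other, or itself, as a section, so both are
shown to be trivial together by induction on the level. -/
theorem bsv_muInv : bsv .muInv = (bsv .mu)⁻¹ := by
  refine eq_inv_of_mul_eq_one_left (app_ext fun v => ?_)
  have key : ∀ n, ∀ v : RVertex 2, level v = n →
      app (bsv .muInv * bsv .mu) v = v ∧ app (bsv .mu * bsv .muInv) v = v := by
    intro n
    induction n with
    | zero => intro v hv; rw [eq_root_of_level hv, app_root, app_root]; exact ⟨rfl, rfl⟩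
    | succ n ih =>
      intro v hv
      obtain ⟨x, u, hx, hu, rfl⟩ := exists_cat (show level v = 1 + n by omega)
      have e := fun u => congrArg (fun g => app g u) bsv_e
      simp only [app_one] at e
      obtain ⟨h1, h2⟩ := ih u hu
      have s := fun q x => isSection_app_eq (spinAut_isSection (m := 2) (r := bsvRot)
        (δ := bsvNext) q x)
      have m0 : ∀ u, app (bsv .mu) (cat (letter 0) u) = cat (letter 1) u := fun u =>
        (s .mu 0 u).trans (congrArg (cat (letter 1)) (e u))
      have m1 : ∀ u, app (bsv .mu) (cat (letter 1) u) = cat (letter 0) (app (bsv .muInv) u) :=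
        fun u => s .mu 1 u
      have i0 : ∀ u, app (bsv .muInv) (cat (letter 0) u) = cat (letter 1) (app (bsv .mu) u) :=
        fun u => s .muInv 0 u
      have i1 : ∀ u, app (bsv .muInv) (cat (letter 1) u) = cat (letter 0) u := fun u => by
        have := s .muInv 1 u
        rwa [show app (bsv .muInv) (letter 1) = letter 0 from rfl,
          show bsvNext .muInv ((1 : Fin 2) : ℕ) = .e from rfl, e] at this
      rw [app_mul] at h1 h2
      rcases exists_letter_two hx with rfl | rfl
      · exact ⟨by rw [app_mul, m0, i1], by rw [app_mul, i0, m1, h1]⟩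
      · exact ⟨by rw [app_mul, m1, i0, h2], by rw [app_mul, i1, m0]⟩
  exact (key _ v rfl).1

theorem bsv_tau_isSection_zero : IsSection (bsv .tau) (letter 0) 1 := by
  rw [← bsv_e]; exact spinAut_isSection _ _

theorem bsv_tau_isSection_one : IsSection (bsv .tau) (letter 1) (bsv .tau) := spinAut_isSection _ _

theorem bsv_mu_isSection_zero : IsSection (bsv .mu) (letter 0) 1 := by
  rw [← bsv_e]; exact spinAut_isSection _ _

theorem bsv_mu_isSection_one : IsSection (bsv .mu) (letter 1) (bsv .mu)⁻¹ := by
  rw [← bsv_muInv]; exact spinAut_isSection _ _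

theorem bsv_tau_zero : app (bsv .tau) (letter 0) = letter 1 := rfl

theorem bsv_tau_one : app (bsv .tau) (letter 1) = letter 0 := rfl

theorem bsv_mu_zero : app (bsv .mu) (letter 0) = letter 1 := rfl

theorem bsv_mu_one : app (bsv .mu) (letter 1) = letter 0 := rfl

theorem bsv_tau_sq_isSection : IsSection (bsv .tau * bsv .tau) (letter 1) (bsv .tau) := by
  have := IsSection.mul (g := bsv .tau) (by rw [bsv_tau_one]; exact bsv_tau_isSection_zero)
    bsv_tau_isSection_one
  rwa [one_mul] at this

theorem bsv_mu_sq_isSection : IsSection (bsv .mu * bsv .mu)⁻¹ (letter 1) (bsv .mu) := by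
  have h1 := IsSection.mul (g := bsv .mu) (by rw [bsv_mu_one]; exact bsv_mu_isSection_zero)
    bsv_mu_isSection_one
  have h2 := h1.inv
  rwa [one_mul, inv_inv] at h2

theorem bsv_mu_inv_mul_tau :
    (bsv .mu)⁻¹ * bsv .tau = graft (letter 1) (bsv .mu * bsv .tau) := by
  have i1 := bsv_mu_isSection_zero.inv
  have i0 := bsv_mu_isSection_one.inv
  rw [bsv_mu_zero, inv_one] at i1
  rw [bsv_mu_one, inv_inv] at i0
  have h0 : app ((bsv .mu)⁻¹ * bsv .tau) (letter 0) = letter 0 := by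
    rw [app_mul, bsv_tau_zero, ← bsv_mu_zero, app_inv_app]
  have h1 : app ((bsv .mu)⁻¹ * bsv .tau) (letter 1) = letter 1 := by
    rw [app_mul, bsv_tau_one, ← bsv_mu_one, app_inv_app]
  have s0 : IsSection ((bsv .mu)⁻¹ * bsv .tau) (letter 0) 1 := by
    have := IsSection.mul (g := (bsv .mu)⁻¹) (by rw [bsv_tau_zero]; exact i1)
      bsv_tau_isSection_zero
    rwa [one_mul] at this
  have s1 : IsSection ((bsv .mu)⁻¹ * bsv .tau) (letter 1) (bsv .mu * bsv .tau) :=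
    IsSection.mul (by rw [bsv_tau_one]; exact i0) bsv_tau_isSection_one
  exact ext_letters_two (h0.trans (graft_of_level_le _ (level_letter_eq _ _).le).symm) (h1.trans (graft_self _ _).symm)
    s0 (graft_isSection_of_ne (level_letter_eq _ _) letter_zero_ne_one.symm _) s1 (graft_isSection _ _)

theorem bsv_spectra :
    hspec (levelFiltration brunnerSidkiVieira.topologicalClosure) = Set.Icc 0 1 ∧
      normalHspec (levelFiltration brunnerSidkiVieira.topologicalClosure) = {0, 1} := by
  have ht : bsv .tau ∈ brunnerSidkiVieira := Subgroup.subset_closure (by simp)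
  have hm : bsv .mu ∈ brunnerSidkiVieira := Subgroup.subset_closure (by simp)
  have ht2 : app (bsv .tau * bsv .tau) (letter 1) = letter 1 := rfl
  have hm2 : app (bsv .mu * bsv .mu) (letter 1) = letter 1 := rfl
  refine spectra_of_two_generators (v := letter 1) ?_ ?_ (isFractalAt_closure ?_) ?_ ?_
  · rintro s (rfl | rfl) w hw <;> rcases exists_letter_two hw with rfl | rfl
    · exact ⟨1, one_mem _, bsv_tau_isSection_zero⟩
    · exact ⟨_, ht, bsv_tau_isSection_one⟩
    · exact ⟨1, one_mem _, bsv_mu_isSection_zero⟩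
    · exact ⟨_, inv_mem hm, bsv_mu_isSection_one⟩
  · intro w hw
    rcases exists_letter_two hw with rfl | rfl
    · exact ⟨_, ht, bsv_tau_one⟩
    · exact ⟨1, one_mem _, rfl⟩
  · rintro s (rfl | rfl)
    · exact ⟨_, mul_mem ht ht, ht2, bsv_tau_sq_isSection⟩
    · refine ⟨_, inv_mem (mul_mem hm hm), ?_, bsv_mu_sq_isSection⟩
      conv_lhs => rw [← hm2]
      exact app_inv_app _ _
  · intro h
    -- If `τ` and `μ` commuted, `μ⁻¹τ` would be invariant under conjugation by `τ`, which moves its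
    -- support from below letter `1` to below letter `0`; but its section `μτ` at letter `1` maps
    -- `00` to `01`.
    have h1 : bsv .tau * ((bsv .mu)⁻¹ * bsv .tau) * (bsv .tau)⁻¹ = (bsv .mu)⁻¹ * bsv .tau := by
      rw [mul_assoc, mul_inv_cancel_right, eq_inv_mul_iff_mul_eq, ← mul_assoc, ← h,
        mul_inv_cancel_right]
    rw [bsv_mu_inv_mul_tau, conj_graft bsv_tau_isSection_one, bsv_tau_one,
      ← bsv_mu_inv_mul_tau] at h1
    set u : RVertex 2 := cat (letter 0) (letter 0)
    have h2 : app ((bsv .mu)⁻¹ * bsv .tau) (cat (letter 1) u) = cat (letter 1) u := by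
      rw [← h1]; exact graft_cat_of_ne (v := letter 0) (w := letter 1) (level_letter_eq _ _) letter_zero_ne_one _ _
    rw [bsv_mu_inv_mul_tau, graft_cat] at h2
    have h3 : app (bsv .mu * bsv .tau) u = cat (letter 0) (letter 1) := rfl
    have h4 := cat_right_injective _ h2
    rw [h3] at h4
    exact letter_zero_ne_one (cat_right_injective _ h4).symm
  · have h1 := conj_graft bsv_tau_sq_isSection (bsv .mu * bsv .tau)
    rw [ht2, ← bsv_mu_inv_mul_tau] at h1
    -- `τ²` has section `τ` at letter `1`, and `μ⁻¹τ` is the graft of `μτ` there; moreover `⁅τ, μτ⁆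
    -- = ⁅τ, μ⁆`.
    have h2 : graft (letter 1) ⁅bsv .tau, bsv .mu⁆ =
        ⁅bsv .tau * bsv .tau, (bsv .mu)⁻¹ * bsv .tau⁆ := by
      rw [commutatorElement_def (bsv .tau * bsv .tau), h1, bsv_mu_inv_mul_tau, ← map_inv,
        ← map_mul, commutatorElement_def]
      congr 1
      group
    rw [h2]
    exact Subgroup.commutator_mem_commutator (mul_mem ht ht) (mul_mem (inv_mem hm) ht)

end BSV

/-! ### The constant GGS-groups -/

theorem commutatorElement_mul_mul_of_commute {A : Type*} [Group A] {x y z w : A}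
    (hyz : Commute y z) (hyw : Commute y w) (hwx : Commute w x) :
    ⁅x * y, z * w⁆ = ⁅x, z⁆ := by
  have h1 : y * (z * w) * y⁻¹ = z * w := by rw [(hyz.mul_right hyw).eq, mul_inv_cancel_right]
  have h2 : w * x⁻¹ * w⁻¹ = x⁻¹ := by rw [hwx.inv_right.eq, mul_inv_cancel_right]
  simp only [commutatorElement_def]
  calc x * y * (z * w) * (x * y)⁻¹ * (z * w)⁻¹
      = x * (y * (z * w) * y⁻¹) * x⁻¹ * w⁻¹ * z⁻¹ := by group
    _ = x * z * (w * x⁻¹ * w⁻¹) * z⁻¹ := by rw [h1]; group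
    _ = _ := by rw [h2]

section GGSGenerators

variable {p c : ℕ}

theorem ggs_e : spinAut p (ggsRot c) (ggsNext p) .e = 1 := spinAut_eq_one rfl fun _ => rfl

variable (p c) in
/-- The generator `a ^ c`. -/
def ggsA : AutR p := spinAut p (ggsRot c) (ggsNext p) .ac

variable (p c) in
/-- The directed generator. -/
def ggsB : AutR p := spinAut p (ggsRot c) (ggsNext p) .b

variable (p c) in
/-- The conjugate of the directed generator by `a ^ (c i)`. -/
def ggsConj (i : ℤ) : AutR p := ggsA p c ^ i * ggsB p c * (ggsA p c ^ i)⁻¹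

variable (p c) in
/-- The generators of the normal closure of `b a ^ (-c)`. -/
def ggsY (i : ℤ) : AutR p := ggsConj p c i * (ggsA p c)⁻¹

theorem ggsY_zero : ggsY p c 0 = ggsB p c * (ggsA p c)⁻¹ := by
  rw [ggsY, ggsConj, zpow_zero, one_mul, inv_one, mul_one]

theorem conj_ggsY (i j : ℤ) :
    ggsA p c ^ j * ggsY p c i * (ggsA p c ^ j)⁻¹ = ggsY p c (j + i) := by
  rw [ggsY, ggsY, ggsConj, ggsConj, zpow_add]
  group

theorem ggsConj_mul_inv (i j : ℤ) :
    ggsConj p c i * (ggsConj p c j)⁻¹ = ggsY p c i * (ggsY p c j)⁻¹ := by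
  rw [ggsY, ggsY]; group

variable (p c) in
/-- The normal closure of `b a ^ (-c)`. -/
def ggsK : Subgroup (AutR p) := Subgroup.closure (Set.range (ggsY p c))

theorem ggsY_mem (i : ℤ) : ggsY p c i ∈ ggsK p c := Subgroup.subset_closure ⟨i, rfl⟩

/-- Conjugation by powers of `ggsA` shifts the index of the generators `ggsY`, and `ggsB` is `ggsY p
c 0 * ggsA p c`. -/
theorem conj_mem_ggsK : ∀ g ∈ Subgroup.closure {ggsA p c, ggsB p c}, ∀ x ∈ ggsK p c,
    g * x * g⁻¹ ∈ ggsK p c := by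
  have hA : ∀ j : ℤ, ∀ x ∈ ggsK p c, ggsA p c ^ j * x * (ggsA p c ^ j)⁻¹ ∈ ggsK p c := by
    intro j x hx
    have hle : ggsK p c ≤ (ggsK p c).comap (MulAut.conj (ggsA p c ^ j)).toMonoidHom := by
      refine (Subgroup.closure_le _).2 ?_
      rintro _ ⟨i, rfl⟩
      change ggsA p c ^ j * ggsY p c i * (ggsA p c ^ j)⁻¹ ∈ ggsK p c
      rw [conj_ggsY]
      exact ggsY_mem _
    exact hle hx
  have hAn : ggsA p c ∈ Subgroup.normalizer (ggsK p c : Set (AutR p)) := by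
    refine Subgroup.mem_normalizer_iff.2 fun x => ⟨fun hx => ?_, fun hx => ?_⟩
    · have := hA 1 x hx
      rwa [zpow_one] at this
    · have := hA (-1) _ hx
      rw [zpow_neg_one] at this
      convert this using 1
      group
  have hle : Subgroup.closure {ggsA p c, ggsB p c} ≤
      Subgroup.normalizer (ggsK p c : Set (AutR p)) := by
    refine (Subgroup.closure_le _).2 ?_
    rintro s (rfl | rfl)
    · exact hAn
    · have h := mul_mem (Subgroup.le_normalizer (ggsY_mem (p := p) (c := c) 0)) hAn
      rw [ggsY_zero, inv_mul_cancel_right] at h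
      exact h
  exact fun g hg x hx => (Subgroup.mem_normalizer_iff.1 (hle hg) x).1 hx

end GGSGenerators

section GGS

variable {p : ℕ} [Fact p.Prime] {c : ℕ}

/-- The letters of the `p`-adic tree indexed by residues modulo `p`. -/
def resLetter (x : ZMod p) : RVertex p := letter ⟨x.val, ZMod.val_lt x⟩

theorem level_resLetter_eq (x y : ZMod p) : level (resLetter x) = level (resLetter y) := rfl

theorem resLetter_injective : Function.Injective (resLetter (p := p)) := fun _ _ h =>
  ZMod.val_injective p (congrArg Fin.val (letter_injective h))

theorem exists_resLetter {v : RVertex p} (hv : level v = 1) : ∃ x, v = resLetter x := by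
  obtain ⟨x, rfl⟩ := exists_letter hv
  exact ⟨(x : ℕ), congrArg letter (Fin.ext (ZMod.val_natCast_of_lt x.2).symm)⟩

theorem ext_resLetters {g h : AutR p} (H : ∀ x : ZMod p,
    app g (resLetter x) = app h (resLetter x) ∧
      ∃ s, IsSection g (resLetter x) s ∧ IsSection h (resLetter x) s) : g = h := by
  refine ext_letters fun x => ?_
  obtain ⟨y, hy⟩ := exists_resLetter (level_letter x)
  rw [hy]
  exact H y

/-- `g` is the rooted automorphism of the rotation by `d`. -/
def IsRotation (g : AutR p) (d : ZMod p) : Prop :=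
  ∀ x, app g (resLetter x) = resLetter (x + d) ∧ IsSection g (resLetter x) 1

theorem IsRotation.eq {g h : AutR p} {d : ZMod p} (hg : IsRotation g d) (hh : IsRotation h d) :
    g = h :=
  ext_resLetters fun x => ⟨(hg x).1.trans (hh x).1.symm, 1, (hg x).2, (hh x).2⟩

theorem IsRotation.inv {g : AutR p} {d : ZMod p} (hg : IsRotation g d) :
    IsRotation g⁻¹ (-d) := fun x => by
  obtain ⟨h1, h2⟩ := hg (x + -d)
  rw [neg_add_cancel_right] at h1
  have h3 := h2.inv
  rw [h1, inv_one] at h3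
  exact ⟨by rw [← h1, app_inv_app], h3⟩

theorem IsRotation.zpow {g : AutR p} {d : ZMod p} (hg : IsRotation g d) (i : ℤ) :
    IsRotation (g ^ i) (i * d) := by
  have hn : ∀ n : ℕ, IsRotation (g ^ n) (n * d) := by
    intro n
    induction n with
    | zero => exact fun x => ⟨by simp, by rw [pow_zero]; exact IsSection.one _⟩
    | succ n ih =>
      intro x
      have h1 := ih (x + d)
      rw [pow_succ]
      refine ⟨?_, ?_⟩
      · rw [app_mul, (hg x).1, h1.1]
        congr 1
        push_cast
        ring
      · have := IsSection.mul (g := g ^ n) (by rw [(hg x).1]; exact h1.2) (hg x).2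
        rwa [one_mul] at this
  obtain ⟨n, rfl | rfl⟩ := i.eq_nat_or_neg
  · rw [zpow_natCast, Int.cast_natCast]; exact hn n
  · rw [zpow_neg, zpow_natCast, Int.cast_neg, Int.cast_natCast, neg_mul]; exact (hn n).inv

theorem ggs_app (q : GGSState) (x : ZMod p) :
    app (spinAut p (ggsRot c) (ggsNext p) q) (resLetter x) = resLetter (x + ((ggsRot c q : ℕ) : ZMod p)) := by
  rw [resLetter, spinAut_letter]
  refine congrArg letter (Fin.ext ?_)
  change (x.val + ggsRot c q) % p = (x + _ : ZMod p).val
  rw [ZMod.val_add, ZMod.val_natCast, Nat.add_mod_mod]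

theorem ggs_isSection (q : GGSState) (x : ZMod p) :
    IsSection (spinAut p (ggsRot c) (ggsNext p) q) (resLetter x)
      (spinAut p (ggsRot c) (ggsNext p) (ggsNext p q x.val)) := spinAut_isSection _ _

theorem ggsA_isRotation : IsRotation (ggsA p c) c := fun x =>
  ⟨ggs_app .ac x, by rw [← ggs_e (c := c)]; exact ggs_isSection .ac x⟩

theorem ggs_a_isRotation : IsRotation (spinAut p (ggsRot c) (ggsNext p) .a) 1 := fun x =>
  ⟨by have := ggs_app (c := c) .a x; rwa [show ggsRot c .a = 1 from rfl, Nat.cast_one] at this,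
    by rw [← ggs_e (c := c)]; exact ggs_isSection .a x⟩

theorem ggsB_app (x : ZMod p) : app (ggsB p c) (resLetter x) = resLetter x := by
  have := ggs_app (c := c) .b x
  rwa [show ggsRot c .b = 0 from rfl, Nat.cast_zero, add_zero] at this

theorem val_add_one_eq_iff (x : ZMod p) : x.val + 1 = p ↔ x = -1 := by
  have h : x = -1 ↔ p ∣ x.val + 1 := by
    rw [← ZMod.natCast_eq_zero_iff, Nat.cast_add, ZMod.natCast_zmod_val, Nat.cast_one,
      eq_neg_iff_add_eq_zero]
  rw [h]
  refine ⟨fun h => by rw [h], fun h => ?_⟩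
  have h1 := Nat.le_of_dvd (Nat.succ_pos _) h
  have h2 := ZMod.val_lt x
  omega

theorem ggsB_isSection (x : ZMod p) :
    IsSection (ggsB p c) (resLetter x) (if x = -1 then ggsB p c else ggsA p c) := by
  have h := ggs_isSection (c := c) .b x
  have h1 : ggsNext p .b x.val = if x.val + 1 = p then GGSState.b else GGSState.ac := rfl
  rw [h1] at h
  by_cases hx : x = -1
  · rw [if_pos ((val_add_one_eq_iff x).2 hx)] at h
    rw [if_pos hx]; exact h
  · rw [if_neg fun h => hx ((val_add_one_eq_iff x).1 h)] at h
    rw [if_neg hx]; exact h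

/-- As `c` is invertible modulo `p`, the rotations `a` and `a ^ c` are powers of each other. -/
theorem constantGGS_eq (hc : ¬ p ∣ c) :
    constantGGS p c = Subgroup.closure {ggsA p c, ggsB p c} := by
  have hc0 : (c : ZMod p) ≠ 0 := fun h => hc ((ZMod.natCast_eq_zero_iff c p).1 h)
  set a := spinAut p (ggsRot c) (ggsNext p) .a with ha
  have h1 : ggsA p c = a ^ (c : ℤ) := by
    refine ggsA_isRotation.eq ?_
    have := (ggs_a_isRotation (p := p) (c := c)).zpow c
    rwa [mul_one, Int.cast_natCast] at this
  have h2 : a = ggsA p c ^ (((c : ZMod p)⁻¹.val : ℕ) : ℤ) := by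
    refine ggs_a_isRotation.eq ?_
    have := (ggsA_isRotation (p := p) (c := c)).zpow (((c : ZMod p)⁻¹.val : ℕ) : ℤ)
    rwa [Int.cast_natCast, ZMod.natCast_zmod_val, inv_mul_cancel₀ hc0] at this
  refine le_antisymm ((Subgroup.closure_le _).2 ?_) ((Subgroup.closure_le _).2 ?_)
  · rintro s (rfl | rfl)
    · rw [← ha, h2]
      exact Subgroup.zpow_mem _ (Subgroup.subset_closure (by simp)) _
    · exact Subgroup.subset_closure (Or.inr rfl)
  · rintro s (rfl | rfl)
    · rw [h1]
      exact Subgroup.zpow_mem _ (Subgroup.subset_closure (Set.mem_insert _ _)) _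
    · exact Subgroup.subset_closure (Or.inr rfl)

variable (p c) in
/-- The letter at which `ggsConj p c i` has the section `ggsB p c`. -/
def ggsPos (i : ℤ) : ZMod p := -1 + (i : ZMod p) * (c : ZMod p)

theorem ggsConj_spec (i : ℤ) (x : ZMod p) : app (ggsConj p c i) (resLetter x) = resLetter x ∧
    IsSection (ggsConj p c i) (resLetter x)
      (if x = ggsPos p c i then ggsB p c else ggsA p c) := by
  have h1 := (ggsA_isRotation (p := p) (c := c)).zpow i
  have h2 := h1.inv x
  have h3 := h1 (x + -((i : ZMod p) * (c : ZMod p)))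
  have h4 := ggsB_isSection (c := c) (x + -((i : ZMod p) * (c : ZMod p)))
  constructor
  · rw [ggsConj, app_mul, app_mul, h2.1, ggsB_app, h3.1, neg_add_cancel_right]
  · have h5 : IsSection (ggsA p c ^ i * ggsB p c) (resLetter (x + -((i : ZMod p) * (c : ZMod p)))) _ :=
      IsSection.mul (by rw [ggsB_app]; exact h3.2) h4
    have h6 := IsSection.mul (g' := (ggsA p c ^ i)⁻¹) (by rw [h2.1]; exact h5) h2.2
    have h7 : x + -((i : ZMod p) * (c : ZMod p)) = -1 ↔ x = ggsPos p c i := by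
      rw [← sub_eq_add_neg, sub_eq_iff_eq_add, ggsPos]
    rw [one_mul, mul_one] at h6
    simp only [h7] at h6
    exact h6

/-- Because the defining vector is constant, two conjugates of `b` have equal sections except at
their two special letters. Their quotient is an element of `K` supported below just two letters. -/
theorem ggsConj_mul_inv_eq_graft {i j : ℤ} (hij : ggsPos p c i ≠ ggsPos p c j) :
    ggsConj p c i * (ggsConj p c j)⁻¹ =
      graft (resLetter (ggsPos p c i)) (ggsY p c 0) *
        graft (resLetter (ggsPos p c j)) (ggsA p c * (ggsB p c)⁻¹) := by
  rw [ggsY_zero]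
  refine ext_resLetters fun x => ?_
  obtain ⟨h1, h2⟩ := ggsConj_spec (c := c) i x
  obtain ⟨h3, h4⟩ := ggsConj_spec (c := c) j x
  have h5 := h4.inv
  rw [h3] at h5
  have h6 : app (ggsConj p c j)⁻¹ (resLetter x) = resLetter x := by
    conv_lhs => rw [← h3]
    exact app_inv_app _ _
  have h7 : ∀ (y : ZMod p) (s : AutR p), app (graft (resLetter y) s) (resLetter x) = resLetter x :=
    fun y s => graft_of_level_le _ (level_resLetter_eq _ _).le
  have h8 : ∀ (y : ZMod p) (s : AutR p), IsSection (graft (resLetter y) s) (resLetter x)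
      (if x = y then s else 1) := by
    intro y s
    by_cases hxy : x = y
    · rw [if_pos hxy, hxy]; exact graft_isSection _ _
    · rw [if_neg hxy]
      exact graft_isSection_of_ne (level_resLetter_eq _ _)
        (fun h => hxy (resLetter_injective h).symm) _
  refine ⟨by rw [app_mul, app_mul, h6, h1, h7, h7], _,
    IsSection.mul (by rw [h6]; exact h2) h5, ?_⟩
  have h9 := IsSection.mul (g' := graft (resLetter (ggsPos p c j)) (ggsA p c * (ggsB p c)⁻¹))
    (by rw [h7]; exact h8 (ggsPos p c i) (ggsB p c * (ggsA p c)⁻¹)) (h8 _ _)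
  convert h9 using 1
  by_cases hi : x = ggsPos p c i
  · have hj : x ≠ ggsPos p c j := fun h => hij (hi.symm.trans h)
    rw [if_pos hi, if_pos hi, if_neg hj, if_neg hj, mul_one]
  · by_cases hj : x = ggsPos p c j
    · rw [if_neg hi, if_neg hi, if_pos hj, if_pos hj, one_mul]
    · rw [if_neg hi, if_neg hi, if_neg hj, if_neg hj, one_mul, mul_inv_cancel]

theorem constantGGS_spectra (hp2 : p ≠ 2) (hc : ¬ p ∣ c) :
    hspec (levelFiltration (constantGGS p c).topologicalClosure) = Set.Icc 0 1 ∧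
      normalHspec (levelFiltration (constantGGS p c).topologicalClosure) = {0, 1} := by
  have hc0 : (c : ZMod p) ≠ 0 := fun h => hc ((ZMod.natCast_eq_zero_iff c p).1 h)
  have h2 : (2 : ZMod p) ≠ 0 := by
    have h : ((2 : ℕ) : ZMod p) ≠ 0 := fun h => hp2 (((Nat.prime_dvd_prime_iff_eq Fact.out
      Nat.prime_two).1 ((ZMod.natCast_eq_zero_iff 2 p).1 h)))
    exact_mod_cast h
  have hpos : ∀ i j : ℤ, (i : ZMod p) ≠ j → ggsPos p c i ≠ ggsPos p c j :=
    fun i j hij h => hij (mul_right_cancel₀ hc0 (add_left_cancel h))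
  have h01 : ((0 : ℤ) : ZMod p) ≠ (1 : ℤ) := by push_cast; exact zero_ne_one
  have h02 : ((0 : ℤ) : ZMod p) ≠ (2 : ℤ) := by push_cast; exact h2.symm
  have h12 : ((1 : ℤ) : ZMod p) ≠ (2 : ℤ) := by
    push_cast
    intro h
    have : (1 : ZMod p) + 0 = 1 + 1 := by rw [add_zero, one_add_one_eq_two]; exact h
    exact zero_ne_one (add_left_cancel this)
  rw [constantGGS_eq hc]
  set G := Subgroup.closure {ggsA p c, ggsB p c} with hG
  have hA : ggsA p c ∈ G := Subgroup.subset_closure (Or.inl rfl)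
  have hB : ggsB p c ∈ G := Subgroup.subset_closure (Or.inr rfl)
  have hconj : ∀ i, ggsConj p c i ∈ G := fun i =>
    mul_mem (mul_mem (zpow_mem hA i) hB) (inv_mem (zpow_mem hA i))
  have hKG : ggsK p c ≤ G := (Subgroup.closure_le _).2 <| by
    rintro _ ⟨i, rfl⟩
    exact mul_mem (hconj i) (inv_mem hA)
  have hLn : ∀ g ∈ G, ∀ x ∈ (⁅ggsK p c, ggsK p c⁆ : Subgroup (AutR p)),
      g * x * g⁻¹ ∈ (⁅ggsK p c, ggsK p c⁆ : Subgroup (AutR p)) := fun g hg x hx =>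
    conj_mem_commutator (conj_mem_ggsK g hg) hx
  set π : ℤ → RVertex p := fun i => resLetter (ggsPos p c i) with hπ
  have hπne : ∀ i j : ℤ, (i : ZMod p) ≠ j → π i ≠ π j := fun i j hij h =>
    hpos i j hij (resLetter_injective h)
  have hf : IsFractalAt G (π 0) := by
    refine isFractalAt_closure ?_
    rintro s (rfl | rfl)
    · refine ⟨_, hconj 1, (ggsConj_spec 1 _).1, ?_⟩
      have := (ggsConj_spec (c := c) 1 (ggsPos p c 0)).2
      rwa [if_neg (hpos 0 1 h01)] at this
    · refine ⟨_, hconj 0, (ggsConj_spec 0 _).1, ?_⟩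
      have := (ggsConj_spec (c := c) 0 (ggsPos p c 0)).2
      rwa [if_pos rfl] at this
  -- elements of `K` supported below two letters
  have hE : ∀ (j l s : ℤ), (0 : ℤ) ≠ (j : ZMod p) → (0 : ℤ) ≠ (l : ZMod p) → (j : ZMod p) ≠ l →
      ∃ z, graft (π 0) (ggsY p c s) * graft (π j) z ∈ ggsK p c := by
    intro j l s hj hl hjl
    have h0 : ggsConj p c 0 * (ggsConj p c j)⁻¹ ∈ ggsK p c := by
      rw [ggsConj_mul_inv]; exact mul_mem (ggsY_mem _) (inv_mem (ggsY_mem _))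
    have h1 := conj_mem_ggsK _ (zpow_mem (hconj l) s) _ h0
    rw [ggsConj_mul_inv_eq_graft (hpos 0 j hj)] at h1
    have hsec : ∀ i : ℤ, (i : ZMod p) ≠ l → app (ggsConj p c l ^ s) (π i) = π i ∧
        IsSection (ggsConj p c l ^ s) (π i) (ggsA p c ^ s) := by
      intro i hi
      have h2 := ggsConj_spec (c := c) l (ggsPos p c i)
      rw [if_neg (hpos i l hi)] at h2
      exact ⟨app_zpow_eq_self h2.1 s, h2.2.zpow h2.1 s⟩
    refine ⟨ggsA p c ^ s * (ggsA p c * (ggsB p c)⁻¹) * (ggsA p c ^ s)⁻¹, ?_⟩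
    have h2 := conj_graft (hsec 0 hl).2 (ggsY p c 0)
    have h3 := conj_graft (hsec j hjl).2 (ggsA p c * (ggsB p c)⁻¹)
    rw [(hsec 0 hl).1, conj_ggsY, add_zero] at h2
    rw [(hsec j hjl).1] at h3
    rw [← h2, ← h3]
    change _ * (graft (π 0) _ * graft (π j) _) * _ ∈ _ at h1
    convert h1 using 1
    group
  have hcomm : ∀ (i j : ℤ), (i : ZMod p) ≠ j → ∀ x y, Commute (graft (π i) x) (graft (π j) y) :=
    fun i j hij x y => commute_graft (level_resLetter_eq _ _) (hπne i j hij) x y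
  refine spectra_of_generators (L := ⁅ggsK p c, ggsK p c⁆) (v := π 0) ?_ ?_ hf hLn ?_ ?_
    (Subgroup.commutator_mono hKG hKG) ?_
  · rintro s (rfl | rfl) w hw <;> obtain ⟨x, rfl⟩ := exists_resLetter hw
    · exact ⟨1, one_mem _, (ggsA_isRotation x).2⟩
    · refine ⟨_, ?_, ggsB_isSection x⟩
      split_ifs
      · exact hB
      · exact hA
  · intro w hw
    obtain ⟨x, rfl⟩ := exists_resLetter hw
    -- `π 0` is the letter `-1`, so reaching `x` takes a rotation by `x + 1`, where each factor
    -- `ggsA` contributes `c`.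
    refine ⟨_, zpow_mem hA ((((x + 1) * (c : ZMod p)⁻¹).val : ℕ) : ℤ), ?_⟩
    have := (ggsA_isRotation (p := p) (c := c)).zpow ((((x + 1) * (c : ZMod p)⁻¹).val : ℕ) : ℤ)
    rw [Int.cast_natCast, ZMod.natCast_zmod_val, inv_mul_cancel_right₀ hc0] at this
    rw [(this _).1]
    refine congrArg resLetter ?_
    rw [ggsPos]
    push_cast
    ring
  -- If `K'` were trivial, `ggsY p c 0` would commute with `E`. Since it maps `π 2` to `π 1`,
  -- comparing sections at `π 2` identifies those of `E` at `π 2` and `π 1`, which are `1` and `ggsA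
  -- * ggsB⁻¹`; but `ggsA` moves the first level and `ggsB` does not.
  · intro h0
    have hmem : ⁅ggsY p c 0, ggsConj p c 0 * (ggsConj p c 1)⁻¹⁆ ∈
        (⁅ggsK p c, ggsK p c⁆ : Subgroup (AutR p)) := by
      refine Subgroup.commutator_mem_commutator (ggsY_mem 0) ?_
      rw [ggsConj_mul_inv]; exact mul_mem (ggsY_mem _) (inv_mem (ggsY_mem _))
    rw [h0, Subgroup.mem_bot, commutatorElement_eq_one_iff_mul_comm,
      ggsConj_mul_inv_eq_graft (hpos 0 1 h01)] at hmem
    set E := graft (resLetter (ggsPos p c 0)) (ggsY p c 0) *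
      graft (resLetter (ggsPos p c 1)) (ggsA p c * (ggsB p c)⁻¹) with hEdef
    have hy : app (ggsY p c 0) (π 2) = π 1 := by
      rw [ggsY_zero, app_mul, (ggsA_isRotation.inv _).1, ggsB_app]
      refine congrArg resLetter ?_
      rw [ggsPos, ggsPos]
      push_cast
      ring
    obtain ⟨s, hs⟩ := exists_isSection (ggsY p c 0) (π 2)
    have hfix : ∀ (i j : ℤ) x, app (graft (π i) x) (π j) = π j := fun i j x =>
      graft_of_level_le x (level_resLetter_eq _ _).le
    have hsec : ∀ (i j : ℤ) x, (i : ZMod p) ≠ j → IsSection (graft (π i) x) (π j) 1 :=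
      fun i j x hij => graft_isSection_of_ne (level_resLetter_eq _ _) (hπne i j hij) x
    have hE1 : IsSection E (π 1) (1 * (ggsA p c * (ggsB p c)⁻¹)) :=
      IsSection.mul (by rw [show app (graft _ _) (π 1) = π 1 from hfix 1 1 _]; exact hsec 0 1 _ h01)
        (graft_isSection _ _)
    have hE2 : IsSection E (π 2) (1 * 1) :=
      IsSection.mul (by rw [show app (graft _ _) (π 2) = π 2 from hfix 1 2 _]; exact hsec 0 2 _ h02)
        (hsec 1 2 _ h12)
    have hE2' : app E (π 2) = π 2 := by
      rw [hEdef, app_mul]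
      exact (congrArg _ (hfix 1 2 _)).trans (hfix 0 2 _)
    have hl : IsSection (ggsY p c 0 * E) (π 2) (s * (1 * 1)) :=
      IsSection.mul (by rw [hE2']; exact hs) hE2
    have hr : IsSection (E * ggsY p c 0) (π 2) (1 * (ggsA p c * (ggsB p c)⁻¹) * s) :=
      IsSection.mul (by rw [hy]; exact hE1) hs
    rw [hmem] at hl
    have heq := hl.unique hr
    rw [mul_one, mul_one, one_mul, eq_comm, mul_eq_right, mul_inv_eq_one] at heq
    have h1 := (ggsA_isRotation (p := p) (c := c) 0).1
    rw [heq, ggsB_app, zero_add] at h1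
    exact hc0 (resLetter_injective h1).symm
  · refine commutator_le_of_closure (fun g hg => hf.conj_mem_comap_graft hLn g (hKG hg)) ?_
    rintro _ ⟨s, rfl⟩ _ ⟨t, rfl⟩
    -- The companions are placed at the different letters `π 1` and `π 2`, so they drop out of the
    -- commutator and only the part at `π 0` is left.
    obtain ⟨z, hz⟩ := hE 1 2 s h01 h02 h12
    obtain ⟨w, hw⟩ := hE 2 1 t h02 h01 h12.symm
    have := Subgroup.commutator_mem_commutator hz hw
    rw [commutatorElement_mul_mul_of_commute (hcomm 1 0 h01.symm _ _) (hcomm 1 2 h12 _ _)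
      (hcomm 2 0 h02.symm _ _), ← map_commutatorElement] at this
    exact this
  -- `G' ≤ K`, since modulo `K` the two generators coincide; hence `G'' ≤ K'`.
  · refine Subgroup.commutator_mono ?_ ?_ <;>
    · refine commutator_le_of_closure conj_mem_ggsK ?_
      have hAB : ⁅ggsA p c, ggsB p c⁆ ∈ ggsK p c := by
        have h1 := conj_ggsY (p := p) (c := c) 0 1
        rw [zpow_one, add_zero] at h1
        have h2 : ⁅ggsA p c, ggsB p c⁆ = ggsY p c 1 * (ggsY p c 0)⁻¹ := by
          rw [← h1, ggsY_zero, commutatorElement_def]; group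
        rw [h2]
        exact mul_mem (ggsY_mem _) (inv_mem (ggsY_mem _))
      rintro s (rfl | rfl) t (rfl | rfl)
      · rw [commutatorElement_self]; exact one_mem _
      · exact hAB
      · rw [← commutatorElement_inv]; exact inv_mem hAB
      · rw [commutatorElement_self]; exact one_mem _

end GGS

end RootedTree

theorem mainTheorem8 :
    -- condition (i) for branch profinite groups and nice filtrations
    (∀ (m : ℕ → ℕ) (G : Subgroup (AutT m)), IsClosed (G : Set (AutT m)) → IsBranch G →
      ∀ N : FiltrationSeries G, IsNice G N → RistFullDimensional G N) ∧
    -- condition (ii) for the level-stabilizer filtration, for `G` and for its closure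
    (∀ (m : ℕ) (G K : Subgroup (AutR m)) (i : ℕ), IsWeaklyBranch G → K ≤ G → K.relIndex G ≠ 0 →
      IsWeaklyRegularBranchOver G (derivedTerm K i) →
      (m.Prime ∧ (G : Set (AutR m)) ⊆ padicAut m) ∨ IsTopologicallyFG G →
      DerivedRistFullDimensional G (levelFiltration G) ∧
      DerivedRistFullDimensional G.topologicalClosure (levelFiltration G.topologicalClosure)) ∧
    -- the spectra of the closures of the main examples
    (hspec (levelFiltration basilica.topologicalClosure) = Set.Icc 0 1 ∧
      normalHspec (levelFiltration basilica.topologicalClosure) = {0, 1}) ∧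
    (hspec (levelFiltration brunnerSidkiVieira.topologicalClosure) = Set.Icc 0 1 ∧
      normalHspec (levelFiltration brunnerSidkiVieira.topologicalClosure) = {0, 1}) ∧
    (∀ p c : ℕ, p.Prime → p ≠ 2 → ¬ p ∣ c →
      hspec (levelFiltration (constantGGS p c).topologicalClosure) = Set.Icc 0 1 ∧
      normalHspec (levelFiltration (constantGGS p c).topologicalClosure) = {0, 1}) := by
  refine ⟨fun m G _ hG N _ => hG.ristFullDimensional N, fun m G K i _ hKG hK h _ =>
    derivedRistFullDimensional_of_derivedTerm hKG hK h, basilica_spectra, bsv_spectra,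
    fun p c hp hp2 hc => ?_⟩
  have := Fact.mk hp
  exact constantGGS_spectra hp2 hc
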